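/- Let $n\ge 2$, let $\Lambda(n)$ be the exterior algebra over $\mathbb C$ on generators $\xi_1,\dots,\xi_n$, let $\partial_i$ be the superderivation of $\Lambda(n)$ with $\partial_i(\xi_j)=\delta_{ij}$, and let $W(n)$ be the Lie superalgebra of superderivations of $\Lambda(n)$. Let $T$ be the group of invertible diagonal $n\times n$ complex matrices, acting on $\Lambda(n)$ by algebra automorphisms with $t\cdot\xi_i=t_i\xi_i$, and on $W(n)$ by conjugation. Let $\mathfrak f\supset\tilde{\mathfrak f}$ be the Lie subsuperalgebras of $W(n)$ with even and odd parts $$\mathfrak f_{\bar 0}=\mathrm{span}\{\xi_i\partial_i: 1\le i\le n\},\qquad \tilde{\mathfrak f}_{\bar 0}=\mathrm{span}\{\xi_i\partial_i: 2\le i\le n\},\qquad \mathfrak f_{\bar 1}=\tilde{\mathfrak f}_{\bar 1}=\mathrm{span}\{\partial_1,\ \xi_1\xi_i\partial_i: 2\le i\le n\}.$$ For $\mathfrak a\in\{\mathfrak f,\tilde{\mathfrak f}\}$ let $\mathcal C_{(\mathfrak a,\mathfrak a_{\bar 0})}$ be the category of $\mathfrak a$-supermodules that are, as $\mathfrak a_{\bar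 0}$-supermodules, direct sums of finite dimensional simple ones. Let $\mathrm H^\bullet(\mathfrak a,\mathfrak a_{\bar 0};U)$ denote relative Lie superalgebra cohomology, the cohomology of the complex of cochains $C^p=\mathrm{Hom}_{\mathfrak a_{\bar 0}}(\Lambda_s^p(\mathfrak a/\mathfrak a_{\bar 0}),U)$, where $\Lambda_s^p$ is the super exterior power. For a finite dimensional $M$ in $\mathcal C_{(\mathfrak a,\mathfrak a_{\bar 0})}$ let $I_{(\mathfrak a,\mathfrak a_{\bar 0})}(M)$ be the annihilator of $\mathrm H^\bullet(\mathfrak a,\mathfrak a_{\bar 0};\mathrm{Hom}_{\mathbb C}(M,M))$ in the commutative ring $\mathrm H^\bullet(\mathfrak a,\mathfrak a_{\bar 0};\mathbb C)$, and let the support variety $\mathcal V_{(\mathfrak a,\mathfrak a_{\bar 0})}(M)$ be the closed subset of $\mathrm{MaxSpec}\,\mathrm H^\bullet(\mathfrak a,\mathfrak a_{\bar 0};\mathbb C)$ defined by this ideal. Let $\mathrm{res}:\mathrm H^\bullet(\mathfrak f,\mathfrak f_{\bar 0};\mathbb C)\to \mathrm H^\bullet(\tilde{\mathfrak f},\tilde{\mathfrak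 f}_{\bar 0};\mathbb C)$ be the restriction map and $\mathrm{res}^*$ the induced map of maximal spectra, $\mathrm{res}^*(\mathfrak m)=\mathrm{res}^{-1}(\mathfrak m)$. The torus $T$ acts on $\mathrm H^\bullet(\tilde{\mathfrak f},\tilde{\mathfrak f}_{\bar 0};\mathbb C)$ by $(t\cdot\varphi)(x)=\varphi(t^{-1}x)$ on cochains, hence on its maximal spectrum. **Theorem.** Let $M$ be a finite dimensional object of $\mathcal C_{(\mathfrak f,\mathfrak f_{\bar 0})}$. Then $\mathcal V_{(\tilde{\mathfrak f},\tilde{\mathfrak f}_{\bar 0})}(M)$ is $T$-stable and $$\mathcal V_{(\tilde{\mathfrak f},\tilde{\mathfrak f}_{\bar 0})}(M)/T\;\cong\;\mathrm{res}^*\bigl(\mathcal V_{(\tilde{\mathfrak f},\tilde{\mathfrak f}_{\bar 0})}(M)\bigr)\;=\;\mathcal V_{(\mathfrak f,\mathfrak f_{\bar 0})}(M).$$ In particular $\mathrm{res}^*:\mathcal V_{(\tilde{\mathfrak f},\tilde{\mathfrak f}_{\bar 0})}(M)\to\mathcal V_{(\mathfrak f,\mathfrak f_{\bar 0})}(M)$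 is surjective. Here $V/T=\mathrm{MaxSpec}\,\mathbb C[V]^T$ is the quotient variety, and the isomorphism is induced by $\mathrm{res}^*$: the restriction map induces an isomorphism from the coordinate ring of $\mathrm{res}^*(V)$ onto $\mathbb C[V]^T$, for $V=\mathcal V_{(\tilde{\mathfrak f},\tilde{\mathfrak f}_{\bar 0})}(M)$. -/

import Mathlib

noncomputable section

namespace SuperCoh

/-- A super vector space over `ℂ`: a `ℤ/2`-graded complex vector space. -/
class SuperSpace (V : Type*) [AddCommGroup V] [Module ℂ V] where
  part : ZMod 2 → Submodule ℂ V
  isCompl : IsCompl (part 0) (part 1)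


open SuperSpace

section Basic

variable {V : Type*} [AddCommGroup V] [Module ℂ V] [SuperSpace V]

/-- The parity operator: `v ↦ (-1)^i v` for `v` homogeneous of degree `i`. -/
def parity (V : Type*) [AddCommGroup V] [Module ℂ V] [SuperSpace V] : V →ₗ[ℂ] V :=
  LinearMap.ofIsCompl (isCompl (V := V)) (part 0).subtype (-(part 1).subtype)

theorem parity_even {v : V} (hv : v ∈ part (V := V) 0) : parity V v = v :=
  LinearMap.ofIsCompl_apply_left (isCompl (V := V)) ⟨v, hv⟩

theorem parity_odd {v : V} (hv : v ∈ part (V := V) 1) : parity V v = -v :=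
  LinearMap.ofIsCompl_apply_right (isCompl (V := V)) ⟨v, hv⟩

theorem exists_parts (v : V) : ∃ a ∈ part (V := V) 0, ∃ b ∈ part (V := V) 1, a + b = v :=
  Submodule.mem_sup.1 ((isCompl (V := V)).sup_eq_top ▸ Submodule.mem_top)

theorem zmod2_cases : ∀ i : ZMod 2, i = 0 ∨ i = 1 := by decide

theorem forall_zmod2 {P : ZMod 2 → Prop} (h0 : P 0) (h1 : P 1) (i : ZMod 2) : P i := by
  fin_cases i
  · exact h0
  · exact h1

theorem homogeneous_induction {P : V → Prop} (hadd : ∀ x y, P x → P y → P (x + y))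
    (hom : ∀ i, ∀ x ∈ part (V := V) i, P x) (v : V) : P v := by
  obtain ⟨a, ha, b, hb, rfl⟩ := exists_parts v
  exact hadd _ _ (hom 0 a ha) (hom 1 b hb)

theorem parity_parity (v : V) : parity V (parity V v) = v := by
  obtain ⟨a, ha, b, hb, rfl⟩ := exists_parts v
  simp [parity_even ha, parity_odd hb]

theorem mem_even_iff {v : V} : v ∈ part (V := V) 0 ↔ parity V v = v := by
  refine ⟨parity_even, fun h => ?_⟩
  obtain ⟨a, ha, b, hb, rfl⟩ := exists_parts v
  rw [map_add, parity_even ha, parity_odd hb] at h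
  have h2 : (2 : ℂ) • b = 0 := by
    rw [two_smul]
    have h' : -b = b := add_left_cancel h
    nth_rewrite 1 [← h']
    simp
  have hb0 : b = 0 := (smul_eq_zero.1 h2).resolve_left two_ne_zero
  simpa [hb0] using ha

theorem mem_odd_iff {v : V} : v ∈ part (V := V) 1 ↔ parity V v = -v := by
  refine ⟨parity_odd, fun h => ?_⟩
  obtain ⟨a, ha, b, hb, rfl⟩ := exists_parts v
  rw [map_add, parity_even ha, parity_odd hb] at h
  have h2 : (2 : ℂ) • a = 0 := by
    rw [two_smul]
    rw [neg_add] at h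
    have h' : a = -a := add_right_cancel h
    nth_rewrite 1 [h']
    simp
  have ha0 : a = 0 := (smul_eq_zero.1 h2).resolve_left two_ne_zero
  simpa [ha0] using hb

/-- The projection onto the even part. -/
def evenProj (V : Type*) [AddCommGroup V] [Module ℂ V] [SuperSpace V] : V →ₗ[ℂ] V :=
  (2⁻¹ : ℂ) • (LinearMap.id + parity V)

/-- The projection onto the odd part. -/
def oddProj (V : Type*) [AddCommGroup V] [Module ℂ V] [SuperSpace V] : V →ₗ[ℂ] V :=
  (2⁻¹ : ℂ) • (LinearMap.id - parity V)

theorem evenProj_even {v : V} (hv : v ∈ part (V := V) 0) : evenProj V v = v := by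
  simp only [evenProj, LinearMap.smul_apply, LinearMap.add_apply, LinearMap.id_apply,
    parity_even hv, ← two_smul ℂ v, smul_smul]
  norm_num

theorem evenProj_odd {v : V} (hv : v ∈ part (V := V) 1) : evenProj V v = 0 := by
  simp [evenProj, parity_odd hv]

theorem oddProj_even {v : V} (hv : v ∈ part (V := V) 0) : oddProj V v = 0 := by
  simp [oddProj, parity_even hv]

theorem oddProj_odd {v : V} (hv : v ∈ part (V := V) 1) : oddProj V v = v := by
  simp only [oddProj, LinearMap.smul_apply, LinearMap.sub_apply, LinearMap.id_apply,
    parity_odd hv, sub_neg_eq_add, ← two_smul ℂ v, smul_smul]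
  norm_num

end Basic

/-- The ground field, concentrated in degree `0`. -/
instance instSuperSpaceComplex : SuperSpace ℂ where
  part i := if i = 0 then ⊤ else ⊥
  isCompl := by simpa using isCompl_top_bot

/-- The endomorphisms of a super vector space: `f` has degree `i` when it maps degree `j`
to degree `i + j`. -/
instance instSuperSpaceEnd {V : Type*} [AddCommGroup V] [Module ℂ V] [SuperSpace V] :
    SuperSpace (Module.End ℂ V) where
  part i :=
    { carrier := {f | ∀ j, ∀ v ∈ part (V := V) j, f v ∈ part (V := V) (i + j)}
      zero_mem' := fun j v _ => by simp
      add_mem' := fun hf hg j v hv => add_mem (hf j v hv) (hg j v hv)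
      smul_mem' := fun c f hf j v hv => Submodule.smul_mem _ c (hf j v hv) }
  isCompl := by
    constructor
    · rw [Submodule.disjoint_def]
      intro f h0 h1
      ext v
      refine homogeneous_induction (P := fun v => f v = 0) ?_ ?_ v
      · intro x y hx hy; simp [hx, hy]
      · refine forall_zmod2 ?_ ?_
        · intro x hx
          exact (Submodule.disjoint_def.1 (isCompl (V := V)).disjoint) _
            (by simpa using h0 0 x hx) (by simpa using h1 0 x hx)
        · intro x hx
          exact (Submodule.disjoint_def.1 (isCompl (V := V)).disjoint) _
            (by simpa [show (1 + 1 : ZMod 2) = 0 from rfl] using h1 1 x hx)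
            (by simpa using h0 1 x hx)
    · rw [codisjoint_iff, eq_top_iff]
      intro f _
      refine Submodule.mem_sup.2
        ⟨(2⁻¹ : ℂ) • (f + parity V * f * parity V), ?_,
          (2⁻¹ : ℂ) • (f - parity V * f * parity V), ?_, ?_⟩
      · refine forall_zmod2 ?_ ?_
        · intro v hv
          rw [show (0 + 0 : ZMod 2) = 0 from rfl, mem_even_iff]
          simp [parity_even hv, parity_parity, add_comm]
        · intro v hv
          rw [show (0 + 1 : ZMod 2) = 1 from rfl, mem_odd_iff]
          simp [parity_odd hv, parity_parity, ← smul_neg]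
      · refine forall_zmod2 ?_ ?_
        · intro v hv
          rw [show (1 + 0 : ZMod 2) = 1 from rfl, mem_odd_iff]
          simp [parity_even hv, parity_parity, ← smul_neg]
        · intro v hv
          rw [show (1 + 1 : ZMod 2) = 0 from rfl, mem_even_iff]
          simp [parity_odd hv, parity_parity, add_comm]
      · rw [← smul_add, add_add_sub_cancel, ← two_smul ℂ f, smul_smul]
        norm_num

theorem end_part_apply {V : Type*} [AddCommGroup V] [Module ℂ V] [SuperSpace V] {i j : ZMod 2}
    {f : Module.End ℂ V} (hf : f ∈ part (V := Module.End ℂ V) i) {v : V}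
    (hv : v ∈ part (V := V) j) : f v ∈ part (V := V) (i + j) :=
  hf j v hv

/-- The sign `(-1)^{ij}`. -/
def sgn (i j : ZMod 2) : ℂ := (-1) ^ (i * j).val

@[simp] theorem sgn_zero_left (j : ZMod 2) : sgn 0 j = 1 := by simp [sgn]
@[simp] theorem sgn_zero_right (j : ZMod 2) : sgn j 0 = 1 := by simp [sgn]
@[simp] theorem sgn_one_one : sgn 1 1 = -1 := by simp [sgn, ZMod.val_one]

/-- A Lie superalgebra over `ℂ`. -/
class LieSuperalgebra (L : Type*) [AddCommGroup L] [Module ℂ L] extends SuperSpace L where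
  bracket : L →ₗ[ℂ] L →ₗ[ℂ] L
  bracket_mem : ∀ {i j : ZMod 2} {x y : L}, x ∈ part i → y ∈ part j → bracket x y ∈ part (i + j)
  skew : ∀ {i j : ZMod 2} {x y : L}, x ∈ part i → y ∈ part j →
    bracket x y = -(sgn i j • bracket y x)
  jacobi : ∀ {i j k : ZMod 2} {x y z : L}, x ∈ part i → y ∈ part j → z ∈ part k →
    bracket x (bracket y z) = bracket (bracket x y) z + sgn i j • bracket y (bracket x z)

open LieSuperalgebra

section Gl

variable {V : Type*} [AddCommGroup V] [Module ℂ V] [SuperSpace V]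

/-- The supercommutator, `[f, g] = f g - (-1)^{ij} g f` for `f`, `g` of degrees `i`, `j`. -/
def superCommutator (V : Type*) [AddCommGroup V] [Module ℂ V] [SuperSpace V] :
    Module.End ℂ V →ₗ[ℂ] Module.End ℂ V →ₗ[ℂ] Module.End ℂ V :=
  LinearMap.mk₂ ℂ
    (fun f g => f * g - g * evenProj _ f - (evenProj _ g - oddProj _ g) * oddProj _ f)
    (fun f f' g => by simp only [map_add, add_mul, mul_add]; abel)
    (fun c f g => by simp [smul_sub])
    (fun f g g' => by simp only [map_add, add_mul, mul_add, sub_mul]; abel)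
    (fun c f g => by simp [smul_sub, sub_mul])

theorem superCommutator_apply {i j : ZMod 2} {f g : Module.End ℂ V}
    (hf : f ∈ part (V := Module.End ℂ V) i) (hg : g ∈ part (V := Module.End ℂ V) j) :
    superCommutator V f g = f * g - sgn i j • (g * f) := by
  obtain rfl | rfl := zmod2_cases i <;> obtain rfl | rfl := zmod2_cases j <;>
    simp [superCommutator, evenProj_even, evenProj_odd, oddProj_even, oddProj_odd, hf, hg]

theorem mul_mem_part {i j : ZMod 2} {f g : Module.End ℂ V}
    (hf : f ∈ part (V := Module.End ℂ V) i) (hg : g ∈ part (V := Module.End ℂ V) j) :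
    f * g ∈ part (V := Module.End ℂ V) (i + j) := fun k v hv => by
  have := end_part_apply hf (end_part_apply hg hv)
  rwa [← add_assoc] at this

theorem superCommutator_mem {i j : ZMod 2} {f g : Module.End ℂ V}
    (hf : f ∈ part (V := Module.End ℂ V) i) (hg : g ∈ part (V := Module.End ℂ V) j) :
    superCommutator V f g ∈ part (V := Module.End ℂ V) (i + j) := by
  rw [superCommutator_apply hf hg]
  exact sub_mem (mul_mem_part hf hg)
    (Submodule.smul_mem _ _ (by rw [add_comm]; exact mul_mem_part hg hf))

/-- The general linear Lie superalgebra `gl(V)`. -/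
instance instLieSuperalgebraEnd : LieSuperalgebra (Module.End ℂ V) where
  bracket := superCommutator V
  bracket_mem := superCommutator_mem
  skew {i j x y} hx hy := by
    rw [superCommutator_apply hx hy, superCommutator_apply hy hx]
    obtain rfl | rfl := zmod2_cases i <;> obtain rfl | rfl := zmod2_cases j <;>
      simp [add_comm]
  jacobi {i j k x y z} hx hy hz := by
    rw [superCommutator_apply hx (superCommutator_mem hy hz),
      superCommutator_apply (superCommutator_mem hx hy) hz,
      superCommutator_apply hy (superCommutator_mem hx hz),
      superCommutator_apply hx hy, superCommutator_apply hy hz, superCommutator_apply hx hz]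
    clear hx hy hz
    obtain rfl | rfl := zmod2_cases i <;> obtain rfl | rfl := zmod2_cases j <;>
      obtain rfl | rfl := zmod2_cases k <;>
      simp [show (1 + 1 : ZMod 2) = 0 from rfl] <;> noncomm_ring

theorem bracket_end {i j : ZMod 2} {f g : Module.End ℂ V}
    (hf : f ∈ part (V := Module.End ℂ V) i) (hg : g ∈ part (V := Module.End ℂ V) j) :
    bracket f g = f * g - sgn i j • (g * f) :=
  superCommutator_apply hf hg

end Gl

/-- A homomorphism of Lie superalgebras (of degree `0`). -/
structure LieSuperHom (L L' : Type*) [AddCommGroup L] [Module ℂ L] [LieSuperalgebra L]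
    [AddCommGroup L'] [Module ℂ L'] [LieSuperalgebra L'] where
  toLin : L →ₗ[ℂ] L'
  map_part : ∀ {i : ZMod 2} {x : L}, x ∈ part (V := L) i → toLin x ∈ part (V := L') i
  map_bracket : ∀ x y : L, toLin (bracket x y) = bracket (toLin x) (toLin y)

section Hom

variable {L L' L'' : Type*} [AddCommGroup L] [Module ℂ L] [LieSuperalgebra L]
  [AddCommGroup L'] [Module ℂ L'] [LieSuperalgebra L']
  [AddCommGroup L''] [Module ℂ L''] [LieSuperalgebra L'']

/-- The composite of two homomorphisms. -/
def LieSuperHom.comp (g : LieSuperHom L' L'') (f : LieSuperHom L L') : LieSuperHom L L'' where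
  toLin := g.toLin ∘ₗ f.toLin
  map_part hx := g.map_part (f.map_part hx)
  map_bracket x y := by simp [f.map_bracket, g.map_bracket]

/-- A bilinear identity may be checked on homogeneous elements. -/
theorem bilin_ext {A : Type*} [AddCommGroup A] [Module ℂ A] {f g : L →ₗ[ℂ] L →ₗ[ℂ] A}
    (h : ∀ i j, ∀ x ∈ part (V := L) i, ∀ y ∈ part (V := L) j, f x y = g x y) : f = g := by
  ext x y
  refine homogeneous_induction (P := fun x => f x y = g x y) ?_ ?_ x
  · intro a b ha hb; simp [ha, hb]
  · intro i x hx
    refine homogeneous_induction (P := fun y => f x y = g x y) ?_ ?_ y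
    · intro a b ha hb; simp [ha, hb]
    · intro j y hy
      exact h i j x hx y hy

/-- The adjoint representation. -/
def adHom (L : Type*) [AddCommGroup L] [Module ℂ L] [LieSuperalgebra L] :
    LieSuperHom L (Module.End ℂ L) where
  toLin := bracket
  map_part hx := fun _ _ hy => bracket_mem hx hy
  map_bracket x y := by
    have key : (bracket (L := L)).compr₂ (bracket (L := L)) =
        (bracket (L := Module.End ℂ L)).compl₁₂ (bracket (L := L)) (bracket (L := L)) := by
      refine bilin_ext fun i j x hx y hy => ?_
      have h1 : (bracket (L := L) x : Module.End ℂ L) ∈ part (V := Module.End ℂ L) i :=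
        fun _ _ hz => bracket_mem hx hz
      have h2 : (bracket (L := L) y : Module.End ℂ L) ∈ part (V := Module.End ℂ L) j :=
        fun _ _ hz => bracket_mem hy hz
      rw [LinearMap.compr₂_apply, LinearMap.compl₁₂_apply, bracket_end h1 h2]
      ext z
      refine homogeneous_induction (P := fun z => bracket (bracket x y) z =
        ((bracket (L := L) x : Module.End ℂ L) * (bracket (L := L) y : Module.End ℂ L) -
          sgn i j • ((bracket (L := L) y : Module.End ℂ L) *
            (bracket (L := L) x : Module.End ℂ L))) z) ?_ ?_ z
      · intro a b ha hb; rw [map_add, map_add, ha, hb]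
      · intro k z hz
        simp [jacobi hx hy hz]
    exact LinearMap.congr_fun₂ key x y

end Hom

/-- A supermodule structure on `M` over the Lie superalgebra `L`: a homomorphism `L → gl(M)`. -/
abbrev SuperRep (L M : Type*) [AddCommGroup L] [Module ℂ L] [LieSuperalgebra L]
    [AddCommGroup M] [Module ℂ M] [SuperSpace M] : Type _ :=
  LieSuperHom L (Module.End ℂ M)

section Rep

variable {L M : Type*} [AddCommGroup L] [Module ℂ L] [LieSuperalgebra L]
    [AddCommGroup M] [Module ℂ M] [SuperSpace M]

/-- The trivial supermodule `ℂ`. -/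
def trivRep (L : Type*) [AddCommGroup L] [Module ℂ L] [LieSuperalgebra L] : SuperRep L ℂ where
  toLin := 0
  map_part _ := by simp
  map_bracket x y := by simp

/-- The supermodule `Hom_ℂ(M, M)`: `x . f = x ∘ f - (-1)^{ij} f ∘ x` for `x`, `f` of
degrees `i`, `j`. -/
def endRep (ρ : SuperRep L M) : SuperRep L (Module.End ℂ M) :=
  (adHom (Module.End ℂ M)).comp ρ

/-- `S` is a subsupermodule of `M` for the action of the even part of `L`. -/
structure IsEvenSub (ρ : SuperRep L M) (S : Submodule ℂ M) : Prop where
  graded : S ≤ (S ⊓ part 0) ⊔ (S ⊓ part 1)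
  stable : ∀ x ∈ part (V := L) 0, ∀ m ∈ S, ρ.toLin x m ∈ S

/-- `S` is a simple subsupermodule of `M` for the action of the even part of `L`. -/
structure IsEvenSimple (ρ : SuperRep L M) (S : Submodule ℂ M) : Prop where
  isSub : IsEvenSub ρ S
  ne_bot : S ≠ ⊥
  eq_bot_or_eq : ∀ S' ≤ S, IsEvenSub ρ S' → S' = ⊥ ∨ S' = S

/-- `M` lies in the category `𝒞_(L, L_0)`: as a supermodule over the even part of `L` it is a
direct sum of finite dimensional simple supermodules. -/
def FinitelySemisimple (ρ : SuperRep L M) : Prop :=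
  ∃ 𝒮 : Set (Submodule ℂ M), (∀ S ∈ 𝒮, IsEvenSimple ρ S ∧ FiniteDimensional ℂ S) ∧
    sSupIndep 𝒮 ∧ sSup 𝒮 = ⊤

end Rep


section Polarization

variable {V A : Type*} [AddCommGroup V] [Module ℂ V] [AddCommGroup A] [Module ℂ A]

/-- A symmetric multilinear map over `ℂ` is determined by its values on the diagonal. -/
theorem eq_zero_of_diag {p : ℕ} (φ : MultilinearMap ℂ (fun _ : Fin p => V) A)
    (hs : ∀ (σ : Equiv.Perm (Fin p)) (x : Fin p → V), φ (x ∘ σ) = φ x)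
    (h : ∀ v, φ (fun _ => v) = 0) : φ = 0 := by
  classical
  ext x
  have key : ∑ s ∈ (Finset.univ : Finset (Fin p)).powerset,
      (-1 : ℂ) ^ (Finset.univ \ s).card • φ (fun _ => ∑ j ∈ s, x j) =
      (p.factorial : ℂ) • φ x := by
    have h1 : ∀ s : Finset (Fin p), φ (fun _ => ∑ j ∈ s, x j) =
        ∑ r : Fin p → Fin p, if Finset.univ.image r ⊆ s then φ (x ∘ r) else 0 := by
      intro s
      rw [MultilinearMap.map_sum_finset φ (fun _ j => x j) (fun _ => s), ← Finset.sum_filter]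
      refine Finset.sum_congr ?_ fun r _ => rfl
      ext r
      simp [Fintype.mem_piFinset, Finset.image_subset_iff]
    simp_rw [h1, Finset.smul_sum]
    rw [Finset.sum_comm]
    have h2 : ∀ r : Fin p → Fin p, (∑ s ∈ (Finset.univ : Finset (Fin p)).powerset,
        (-1 : ℂ) ^ (Finset.univ \ s).card • (if Finset.univ.image r ⊆ s then φ (x ∘ r) else 0)) =
        if Function.Bijective r then φ x else 0 := by
      intro r
      have h3 : ∀ s : Finset (Fin p), (-1 : ℂ) ^ (Finset.univ \ s).card •
          (if Finset.univ.image r ⊆ s then φ (x ∘ r) else 0) =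
          (if Finset.univ.image r ⊆ s then (-1 : ℂ) ^ (Finset.univ \ s).card else 0) •
            φ (x ∘ r) := by
        intro s; split_ifs <;> simp
      simp_rw [h3]
      rw [← Finset.sum_smul, ← Finset.sum_filter]
      have h4 : (∑ s ∈ (Finset.univ : Finset (Fin p)).powerset with Finset.univ.image r ⊆ s,
          (-1 : ℂ) ^ (Finset.univ \ s).card) =
          ∑ t ∈ (Finset.univ \ Finset.univ.image r).powerset, (-1 : ℂ) ^ t.card := by
        refine Finset.sum_bij' (fun s _ => Finset.univ \ s) (fun t _ => Finset.univ \ t)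
          ?_ ?_ ?_ ?_ ?_
        · intro s hs
          simp only [Finset.mem_filter] at hs
          exact Finset.mem_powerset.2 (Finset.sdiff_subset_sdiff le_rfl hs.2)
        · intro t ht
          simp only [Finset.mem_powerset] at ht
          simp only [Finset.mem_filter, Finset.mem_powerset, Finset.subset_univ, true_and]
          intro a ha
          simp only [Finset.mem_sdiff, Finset.mem_univ, true_and]
          intro hat
          exact (Finset.mem_sdiff.1 (ht hat)).2 ha
        · intro s _; simp
        · intro s _; simp
        · intro s _; rfl
      rw [h4]
      by_cases hr : Function.Bijective r
      · rw [if_pos hr, Finset.image_univ_of_surjective hr.2]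
        have := hs (Equiv.ofBijective r hr) x
        simp only [Equiv.coe_ofBijective] at this
        simp [this]
      · rw [if_neg hr]
        have hne : (Finset.univ \ Finset.univ.image r).Nonempty := by
          rw [Finset.sdiff_nonempty]
          intro hsub
          apply hr
          rw [← Finite.surjective_iff_bijective]
          intro b
          simpa using hsub (Finset.mem_univ b)
        have h5 := Finset.sum_powerset_neg_one_pow_card_of_nonempty hne
        have h6 : (∑ t ∈ (Finset.univ \ Finset.univ.image r).powerset, (-1 : ℂ) ^ t.card) = 0 := by
          exact_mod_cast h5
        rw [h6, zero_smul]
    simp_rw [h2]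
    rw [← Finset.sum_filter, Finset.sum_const]
    have h7 : (Finset.univ.filter fun r : Fin p → Fin p => Function.Bijective r).card =
        p.factorial := by
      rw [← Fintype.card_subtype, Fintype.card_congr (Equiv.ofBijective
        (fun e : Equiv.Perm (Fin p) => (⟨e, e.bijective⟩ : {r : Fin p → Fin p //
          Function.Bijective r})) ⟨fun a b hab => by
            ext i; simpa using congrArg (fun r => ((r.1 i : Fin p) : ℕ)) hab,
          fun r => ⟨Equiv.ofBijective r.1 r.2, rfl⟩⟩).symm, Fintype.card_perm, Fintype.card_fin]
    rw [h7, Nat.cast_smul_eq_nsmul]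
  simp only [h, smul_zero, Finset.sum_const_zero] at key
  have := (smul_eq_zero.1 key.symm).resolve_left (by exact_mod_cast p.factorial_ne_zero)
  simpa using this

end Polarization

section Cochains

variable {L L' M : Type*} [AddCommGroup L] [Module ℂ L] [LieSuperalgebra L]
    [AddCommGroup L'] [Module ℂ L'] [LieSuperalgebra L']
    [AddCommGroup M] [Module ℂ M] [SuperSpace M]

/-- The odd part of `L`; it is identified with `L` modulo its even part. -/
abbrev OddPart (L : Type*) [AddCommGroup L] [Module ℂ L] [LieSuperalgebra L] : Type _ :=
  ↥(part (V := L) 1)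

/-- The adjoint action of an even element on the odd part. -/
def adOdd (y : L) (hy : y ∈ part (V := L) 0) : OddPart L →ₗ[ℂ] OddPart L :=
  (bracket y).restrict fun x hx => by simpa using bracket_mem hy hx

/-- The relative cochains `C^p(L, L_0; M) = Hom_{L_0}(Λ_s^p(L / L_0), M)`. As `L / L_0 = L_1` is
purely odd, its super wedge powers are its symmetric powers; so a cochain is a symmetric
multilinear map on `L_1` which commutes with the action of the even part `L_0`. -/
def cochain (ρ : SuperRep L M) (p : ℕ) :
    Submodule ℂ (MultilinearMap ℂ (fun _ : Fin p => OddPart L) M) where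
  carrier := {φ | (∀ (σ : Equiv.Perm (Fin p)) (x : Fin p → OddPart L), φ (x ∘ σ) = φ x) ∧
    ∀ (y : L) (hy : y ∈ part (V := L) 0) (x : Fin p → OddPart L),
      ρ.toLin y (φ x) = ∑ i, φ (Function.update x i (adOdd y hy (x i)))}
  zero_mem' := by constructor <;> simp
  add_mem' := fun ha hb => ⟨fun σ x => by simp [ha.1 σ x, hb.1 σ x],
    fun y hy x => by simp [ha.2 y hy x, hb.2 y hy x, Finset.sum_add_distrib]⟩
  smul_mem' := fun c a ha => ⟨fun σ x => by simp [ha.1 σ x],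
    fun y hy x => by simp [ha.2 y hy x, Finset.smul_sum]⟩

theorem cochain_ext {ρ : SuperRep L M} {p : ℕ}
    {φ ψ : MultilinearMap ℂ (fun _ : Fin p => OddPart L) M} (hφ : φ ∈ cochain ρ p)
    (hψ : ψ ∈ cochain ρ p) (h : ∀ v : OddPart L, φ (fun _ => v) = ψ (fun _ => v)) : φ = ψ := by
  rw [← sub_eq_zero]
  exact eq_zero_of_diag _ (sub_mem hφ hψ).1 fun v => sub_eq_zero.2 (h v)

theorem even_parity (ρ : SuperRep L M) {y : L} (hy : y ∈ part (V := L) 0) (m : M) :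
    ρ.toLin y (parity M m) = parity M (ρ.toLin y m) := by
  obtain ⟨a, ha, b, hb, rfl⟩ := exists_parts m
  have h1 := end_part_apply (ρ.map_part hy) ha
  have h2 := end_part_apply (ρ.map_part hy) hb
  rw [zero_add] at h1 h2
  simp [parity_even ha, parity_odd hb, parity_even h1, parity_odd h2]

theorem odd_parity (ρ : SuperRep L M) {y : L} (hy : y ∈ part (V := L) 1) (m : M) :
    ρ.toLin y (parity M m) = -parity M (ρ.toLin y m) := by
  obtain ⟨a, ha, b, hb, rfl⟩ := exists_parts m
  have h1 := end_part_apply (ρ.map_part hy) ha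
  have h2 := end_part_apply (ρ.map_part hy) hb
  rw [add_zero] at h1
  rw [show (1 + 1 : ZMod 2) = 0 from rfl] at h2
  simp [parity_even ha, parity_odd hb, parity_odd h1, parity_even h2, add_comm]

theorem even_odd_act (ρ : SuperRep L M) {y x : L} (hy : y ∈ part (V := L) 0)
    (hx : x ∈ part (V := L) 1) (m : M) :
    ρ.toLin y (ρ.toLin x m) = ρ.toLin (bracket y x) m + ρ.toLin x (ρ.toLin y m) := by
  rw [ρ.map_bracket, bracket_end (ρ.map_part hy) (ρ.map_part hx)]
  simp

/-- The differential of the relative cochain complex. For a homogeneous cochain `φ` the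
vector `φ(x_1, …, x_p)` has degree `φ + p`, so that `(-1)^p` times the parity operator is the
usual sign `(-1)^φ`; the terms of the usual formula which involve brackets `[x_i, x_j]` vanish,
because these brackets lie in the even part of `L`. -/
def d (ρ : SuperRep L M) (p : ℕ) :
    MultilinearMap ℂ (fun _ : Fin p => OddPart L) M →ₗ[ℂ]
      MultilinearMap ℂ (fun _ : Fin (p + 1) => OddPart L) M where
  toFun φ := (-1 : ℂ) ^ p • ∑ i : Fin (p + 1), LinearMap.uncurryMid (M := fun _ => OddPart L) i
    { toFun := fun x => (ρ.toLin x ∘ₗ parity M).compMultilinearMap φ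
      map_add' := fun a b => by ext; simp
      map_smul' := fun a b => by ext; simp }
  map_add' φ ψ := by ext x; simp [Finset.sum_add_distrib]
  map_smul' c φ := by ext x; simp [Finset.smul_sum, smul_comm c]

theorem d_apply (ρ : SuperRep L M) {p : ℕ}
    (φ : MultilinearMap ℂ (fun _ : Fin p => OddPart L) M) (x : Fin (p + 1) → OddPart L) :
    d ρ p φ x = (-1 : ℂ) ^ p • ∑ i : Fin (p + 1), ρ.toLin (x i)
      (parity M (φ (i.removeNth x))) := by
  simp [d]

theorem d_mem (ρ : SuperRep L M) {p : ℕ}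
    {φ : MultilinearMap ℂ (fun _ : Fin p => OddPart L) M} (hφ : φ ∈ cochain ρ p) :
    d ρ p φ ∈ cochain ρ (p + 1) := by
  constructor
  · intro σ x
    rw [d_apply, d_apply, ← Equiv.sum_comp σ (fun i => ρ.toLin (x i)
      (parity M (φ (i.removeNth x))))]
    congr 1
    refine Finset.sum_congr rfl fun i _ => ?_
    congr 2
    let τ : Fin p ≃ Fin p := (finSuccAboveEquiv i).trans
      ((σ.subtypeEquiv (p := fun j => j ≠ i) (q := fun j => j ≠ σ i) (by simp)).trans
        (finSuccAboveEquiv (σ i)).symm)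
    have hτ : ∀ j, (σ i).succAbove (τ j) = σ (i.succAbove j) := by
      intro j
      have h := (finSuccAboveEquiv (σ i)).apply_symm_apply
        ((σ.subtypeEquiv (p := fun j => j ≠ i) (q := fun j => j ≠ σ i) (by simp))
          (finSuccAboveEquiv i j))
      exact congrArg Subtype.val h
    rw [← hφ.1 τ (Fin.removeNth (σ i) x)]
    congr 1
    funext j
    simp [Fin.removeNth, hτ]
  · intro y hy x
    simp only [d_apply, map_smul, map_sum, ← Finset.smul_sum]
    congr 1
    rw [Finset.sum_comm]
    refine Finset.sum_congr rfl fun i _ => ?_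
    rw [Fin.sum_univ_succAbove _ i, even_odd_act ρ hy (x i).2, even_parity ρ hy, hφ.2 y hy]
    congr 1
    · simp [adOdd]
    · simp only [map_sum]
      refine Finset.sum_congr rfl fun j _ => ?_
      rw [Function.update_of_ne (Fin.succAbove_ne i j).symm]
      congr 3
      ext k
      by_cases hk : k = j
      · subst hk; simp [Fin.removeNth]
      · rw [Function.update_of_ne hk]
        simp [Fin.removeNth, hk]

theorem d_diag (ρ : SuperRep L M) {p : ℕ} (φ : MultilinearMap ℂ (fun _ : Fin p => OddPart L) M)
    (v : OddPart L) :
    d ρ p φ (fun _ => v) =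
      ((-1 : ℂ) ^ p * (p + 1)) • ρ.toLin v (parity M (φ fun _ => v)) := by
  rw [d_apply]
  have : ∀ i : Fin (p + 1), (i.removeNth fun _ : Fin (p + 1) => v) = fun _ => v := fun _ => rfl
  simp only [this, Finset.sum_const, Finset.card_univ, Fintype.card_fin]
  rw [← Nat.cast_smul_eq_nsmul ℂ, smul_smul]
  push_cast
  rfl

theorem bracket_cube {x : L} (hx : x ∈ part (V := L) 1) : bracket (bracket x x) x = 0 := by
  have h1 := jacobi hx hx hx
  have h2 := skew (bracket_mem hx hx) hx
  rw [show (1 + 1 : ZMod 2) = 0 from rfl, sgn_zero_left, one_smul] at h2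
  rw [sgn_one_one, neg_one_smul] at h1
  rw [h2] at h1 ⊢
  have h3 : (3 : ℂ) • bracket x (bracket x x) = 0 := by
    have : (3 : ℂ) • bracket x (bracket x x) = bracket x (bracket x x) -
        (-bracket x (bracket x x) + -bracket x (bracket x x)) := by module
    rw [this, ← h1, sub_self]
  rw [(smul_eq_zero.1 h3).resolve_left (by norm_num), neg_zero]

theorem d_comp_d (ρ : SuperRep L M) {p : ℕ}
    {φ : MultilinearMap ℂ (fun _ : Fin p => OddPart L) M} (hφ : φ ∈ cochain ρ p) :
    d ρ (p + 1) (d ρ p φ) = 0 := by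
  refine cochain_ext (ρ := ρ) (d_mem ρ (d_mem ρ hφ)) (zero_mem _) fun v => ?_
  have h0 : bracket (v : L) v ∈ part (V := L) 0 := bracket_mem v.2 v.2
  have h1 := hφ.2 _ h0 (fun _ => v)
  have h2 : adOdd _ h0 v = 0 := Subtype.ext (bracket_cube v.2)
  have h3 : ρ.toLin (bracket (v : L) v) (φ fun _ => v) = 0 := by
    rw [h1]
    refine Finset.sum_eq_zero fun i _ => ?_
    rw [h2]
    exact MultilinearMap.map_update_zero _ _ _
  have h4 : ρ.toLin v (ρ.toLin v (φ fun _ => v)) = 0 := by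
    rw [ρ.map_bracket, bracket_end (ρ.map_part v.2) (ρ.map_part v.2)] at h3
    have : (2 : ℂ) • ρ.toLin v (ρ.toLin v (φ fun _ => v)) = 0 := by
      rw [← h3]; simp [two_smul]
    exact (smul_eq_zero.1 this).resolve_left two_ne_zero
  rw [d_diag, d_diag]
  simp only [map_smul, odd_parity ρ v.2, map_neg, parity_parity, h4]
  simp

/-- The cocycles of degree `p`. -/
def cocycles (ρ : SuperRep L M) (p : ℕ) :
    Submodule ℂ (MultilinearMap ℂ (fun _ : Fin p => OddPart L) M) :=
  cochain ρ p ⊓ LinearMap.ker (d ρ p)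

/-- The coboundaries of degree `p`. -/
def boundaries (ρ : SuperRep L M) :
    (p : ℕ) → Submodule ℂ (MultilinearMap ℂ (fun _ : Fin p => OddPart L) M)
  | 0 => ⊥
  | p + 1 => (cochain ρ p).map (d ρ p)

/-- The relative cohomology `H^p(L, L_0; M)`. -/
def Coh (ρ : SuperRep L M) (p : ℕ) : Type _ :=
  cocycles ρ p ⧸ (boundaries ρ p).submoduleOf (cocycles ρ p)

instance (ρ : SuperRep L M) (p : ℕ) : AddCommGroup (Coh ρ p) :=
  inferInstanceAs (AddCommGroup (cocycles ρ p ⧸ (boundaries ρ p).submoduleOf (cocycles ρ p)))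

instance (ρ : SuperRep L M) (p : ℕ) : Module ℂ (Coh ρ p) :=
  inferInstanceAs (Module ℂ (cocycles ρ p ⧸ (boundaries ρ p).submoduleOf (cocycles ρ p)))

/-- The cohomology class of a cocycle. -/
def Coh.mk (ρ : SuperRep L M) (p : ℕ) : cocycles ρ p →ₗ[ℂ] Coh ρ p :=
  ((boundaries ρ p).submoduleOf (cocycles ρ p)).mkQ

theorem Coh.mk_surjective (ρ : SuperRep L M) (p : ℕ) : Function.Surjective (Coh.mk ρ p) :=
  Submodule.mkQ_surjective _

theorem Coh.mk_eq_zero {ρ : SuperRep L M} {p : ℕ} {z : cocycles ρ p} :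
    Coh.mk ρ p z = 0 ↔ z.1 ∈ boundaries ρ p :=
  Submodule.Quotient.mk_eq_zero _

/-- Linear maps out of cohomology. -/
def Coh.lift {ρ : SuperRep L M} {p : ℕ} {A : Type*} [AddCommGroup A] [Module ℂ A]
    (f : cocycles ρ p →ₗ[ℂ] A) (h : ∀ z : cocycles ρ p, z.1 ∈ boundaries ρ p →
      f z = 0) : Coh ρ p →ₗ[ℂ] A :=
  Submodule.liftQ _ f fun z hz => h z hz

theorem Coh.lift_mk {ρ : SuperRep L M} {p : ℕ} {A : Type*} [AddCommGroup A] [Module ℂ A]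
    (f : cocycles ρ p →ₗ[ℂ] A) (h : ∀ z : cocycles ρ p, z.1 ∈ boundaries ρ p →
      f z = 0) (z : cocycles ρ p) : Coh.lift f h (Coh.mk ρ p z) = f z :=
  rfl

end Cochains

section Product

variable {L L' M : Type*} [AddCommGroup L] [Module ℂ L] [LieSuperalgebra L]
    [AddCommGroup L'] [Module ℂ L'] [LieSuperalgebra L']
    [AddCommGroup M] [Module ℂ M] [SuperSpace M]

/-- The product of a scalar valued cochain `f` and an `M`-valued cochain `φ`: the sum of
`f(x_S) φ(x_{S'})` over all partitions of the arguments into a set `S` of `p` and a set `S'` of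
`q` elements, written as a sum over permutations. -/
def cup (p q : ℕ) :
    MultilinearMap ℂ (fun _ : Fin p => OddPart L) ℂ →ₗ[ℂ]
      MultilinearMap ℂ (fun _ : Fin q => OddPart L) M →ₗ[ℂ]
        MultilinearMap ℂ (fun _ : Fin (p + q) => OddPart L) M :=
  LinearMap.mk₂ ℂ
    (fun f φ => ((p.factorial * q.factorial : ℕ) : ℂ)⁻¹ • ∑ σ : Equiv.Perm (Fin (p + q)),
      (((TensorProduct.lid ℂ M).toLinearMap.compMultilinearMap (f.domCoprod φ)).domDomCongr
        finSumFinEquiv).domDomCongr σ)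
    (fun f f' φ => by ext x; simp [TensorProduct.add_tmul, Finset.sum_add_distrib])
    (fun c f φ => by ext x; simp [mul_smul, Finset.smul_sum, smul_comm c])
    (fun f φ φ' => by ext x; simp [TensorProduct.tmul_add, Finset.sum_add_distrib])
    (fun c f φ => by ext x; simp [Finset.smul_sum, smul_comm c])

theorem cup_apply {p q : ℕ} (f : MultilinearMap ℂ (fun _ : Fin p => OddPart L) ℂ)
    (φ : MultilinearMap ℂ (fun _ : Fin q => OddPart L) M) (x : Fin (p + q) → OddPart L) :
    cup p q f φ x = ((p.factorial * q.factorial : ℕ) : ℂ)⁻¹ • ∑ σ : Equiv.Perm (Fin (p + q)),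
      f (fun i => x (σ (Fin.castAdd q i))) • φ (fun j => x (σ (Fin.natAdd p j))) := by
  simp [cup]

theorem cup_diag {p q : ℕ} (f : MultilinearMap ℂ (fun _ : Fin p => OddPart L) ℂ)
    (φ : MultilinearMap ℂ (fun _ : Fin q => OddPart L) M) (v : OddPart L) :
    cup p q f φ (fun _ => v) = (((p.factorial * q.factorial : ℕ) : ℂ)⁻¹ * (p + q).factorial *
      f (fun _ => v)) • φ (fun _ => v) := by
  rw [cup_apply, Finset.sum_const, Finset.card_univ, Fintype.card_perm, Fintype.card_fin,
    ← Nat.cast_smul_eq_nsmul ℂ, smul_smul, smul_smul]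

theorem triv_even {p : ℕ} {f : MultilinearMap ℂ (fun _ : Fin p => OddPart L) ℂ}
    (hf : f ∈ cochain (trivRep L) p) (y : L) (hy : y ∈ part (V := L) 0)
    (x : Fin p → OddPart L) : ∑ i, f (Function.update x i (adOdd y hy (x i))) = 0 := by
  rw [← hf.2 y hy x]
  simp [trivRep]

theorem cup_mem {ρ : SuperRep L M} {p q : ℕ}
    {f : MultilinearMap ℂ (fun _ : Fin p => OddPart L) ℂ} (hf : f ∈ cochain (trivRep L) p)
    {φ : MultilinearMap ℂ (fun _ : Fin q => OddPart L) M} (hφ : φ ∈ cochain ρ q) :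
    cup p q f φ ∈ cochain ρ (p + q) := by
  constructor
  · intro τ x
    rw [cup_apply, cup_apply, ← Equiv.sum_comp (Equiv.mulLeft τ) (fun σ : Equiv.Perm _ =>
      f (fun i => x (σ (Fin.castAdd q i))) • φ (fun j => x (σ (Fin.natAdd p j))))]
    rfl
  · intro y hy x
    simp only [cup_apply, map_smul, map_sum, ← Finset.smul_sum]
    congr 1
    rw [Finset.sum_comm]
    refine Finset.sum_congr rfl fun σ _ => ?_
    rw [hφ.2 y hy, ← Equiv.sum_comp σ, Fin.sum_univ_add]
    have h1 : ∀ i : Fin p, f (fun k => Function.update x (σ (Fin.castAdd q i))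
          (adOdd y hy (x (σ (Fin.castAdd q i)))) (σ (Fin.castAdd q k))) •
        φ (fun k => Function.update x (σ (Fin.castAdd q i))
          (adOdd y hy (x (σ (Fin.castAdd q i)))) (σ (Fin.natAdd p k))) =
        f (Function.update (fun k => x (σ (Fin.castAdd q k))) i
          (adOdd y hy (x (σ (Fin.castAdd q i))))) • φ (fun k => x (σ (Fin.natAdd p k))) := by
      intro i
      congr 2
      · funext k
        by_cases hk : k = i
        · subst hk; simp
        · rw [Function.update_of_ne hk, Function.update_of_ne (by simpa using hk)]
      · funext k
        rw [Function.update_of_ne]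
        simp only [ne_eq, EmbeddingLike.apply_eq_iff_eq]
        intro h
        have := congrArg Fin.val h
        simp at this
        omega
    have h2 : ∀ i : Fin q, f (fun k => Function.update x (σ (Fin.natAdd p i))
          (adOdd y hy (x (σ (Fin.natAdd p i)))) (σ (Fin.castAdd q k))) •
        φ (fun k => Function.update x (σ (Fin.natAdd p i))
          (adOdd y hy (x (σ (Fin.natAdd p i)))) (σ (Fin.natAdd p k))) =
        f (fun k => x (σ (Fin.castAdd q k))) • φ (Function.update
          (fun k => x (σ (Fin.natAdd p k))) i (adOdd y hy (x (σ (Fin.natAdd p i))))) := by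
      intro i
      congr 2
      · funext k
        rw [Function.update_of_ne]
        simp only [ne_eq, EmbeddingLike.apply_eq_iff_eq]
        intro h
        have := congrArg Fin.val h
        simp at this
        omega
      · funext k
        by_cases hk : k = i
        · subst hk; simp
        · rw [Function.update_of_ne hk, Function.update_of_ne (by simpa using hk)]
    simp only [h1, h2]
    rw [← Finset.sum_smul, triv_even hf y hy, zero_smul, zero_add, Finset.smul_sum]

theorem d_triv {p : ℕ} (f : MultilinearMap ℂ (fun _ : Fin p => OddPart L) ℂ) :
    d (trivRep L) p f = 0 := by
  ext x
  rw [d_apply]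
  simp [trivRep]

theorem mem_cocycles_triv {p : ℕ} {f : MultilinearMap ℂ (fun _ : Fin p => OddPart L) ℂ} :
    f ∈ cocycles (trivRep L) p ↔ f ∈ cochain (trivRep L) p :=
  ⟨fun h => h.1, fun h => ⟨h, d_triv f⟩⟩

theorem boundaries_triv (p : ℕ) : boundaries (trivRep L) p = ⊥ := by
  cases p with
  | zero => rfl
  | succ p =>
    rw [eq_bot_iff]
    rintro _ ⟨f, -, rfl⟩
    simp [d_triv]

/-- The product commutes with the differential up to sign. -/
theorem d_cup {ρ : SuperRep L M} {p q : ℕ}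
    {f : MultilinearMap ℂ (fun _ : Fin p => OddPart L) ℂ} (hf : f ∈ cochain (trivRep L) p)
    {φ : MultilinearMap ℂ (fun _ : Fin q => OddPart L) M} (hφ : φ ∈ cochain ρ q) :
    d ρ (p + q) (cup p q f φ) = (-1 : ℂ) ^ p • cup p (q + 1) f (d ρ q φ) := by
  refine cochain_ext (ρ := ρ) (d_mem ρ (cup_mem hf hφ))
    (Submodule.smul_mem _ _ (cup_mem hf (d_mem ρ hφ))) fun v => ?_
  refine (d_diag ρ _ v).trans (Eq.trans ?_
    (congrArg (fun m => (-1 : ℂ) ^ p • m) (cup_diag (q := q + 1) f (d ρ q φ) v)).symm)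
  rw [cup_diag, d_diag]
  simp only [map_smul, smul_smul]
  congr 1
  have h1 : ((q : ℂ) + 1) ≠ 0 := by exact_mod_cast q.succ_ne_zero
  have h2 : ((q.factorial : ℕ) : ℂ) ≠ 0 := by exact_mod_cast q.factorial_ne_zero
  have h3 : ((p.factorial : ℕ) : ℂ) ≠ 0 := by exact_mod_cast p.factorial_ne_zero
  rw [show p + (q + 1) = (p + q) + 1 from rfl, Nat.factorial_succ, Nat.factorial_succ]
  push_cast
  field_simp
  ring

/-- The product of cocycles. -/
def cupCocycles (ρ : SuperRep L M) (p q : ℕ) :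
    cocycles (trivRep L) p →ₗ[ℂ] cocycles ρ q →ₗ[ℂ] cocycles ρ (p + q) :=
  LinearMap.mk₂ ℂ
    (fun f φ => ⟨cup p q f.1 φ.1, cup_mem f.2.1 φ.2.1, by
      change d ρ (p + q) (cup p q f.1 φ.1) = 0
      rw [d_cup f.2.1 φ.2.1, LinearMap.mem_ker.1 φ.2.2, map_zero, smul_zero]⟩)
    (fun f f' φ => Subtype.ext (by simp)) (fun c f φ => Subtype.ext (by simp))
    (fun f φ φ' => Subtype.ext (by simp)) (fun c f φ => Subtype.ext (by simp))

theorem cup_boundaries {ρ : SuperRep L M} {p q : ℕ}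
    {f : MultilinearMap ℂ (fun _ : Fin p => OddPart L) ℂ} (hf : f ∈ cochain (trivRep L) p)
    {φ : MultilinearMap ℂ (fun _ : Fin q => OddPart L) M} (hφ : φ ∈ boundaries ρ q) :
    cup p q f φ ∈ boundaries ρ (p + q) := by
  cases q with
  | zero =>
    rw [show φ = 0 from hφ, map_zero]
    exact zero_mem _
  | succ q =>
    obtain ⟨ψ, hψ, rfl⟩ := hφ
    refine ⟨(-1 : ℂ) ^ p • cup p q f ψ, Submodule.smul_mem _ _ (cup_mem hf hψ), ?_⟩
    rw [map_smul]
    change (-1 : ℂ) ^ p • d ρ (p + q) (cup p q f ψ) = _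
    rw [d_cup hf hψ, smul_smul, ← mul_pow]
    simp

/-- The product `H^p(L, L_0; ℂ) × H^q(L, L_0; M) → H^{p+q}(L, L_0; M)`. -/
def cohMul (ρ : SuperRep L M) (p q : ℕ) :
    Coh (trivRep L) p →ₗ[ℂ] Coh ρ q →ₗ[ℂ] Coh ρ (p + q) :=
  Coh.lift
    ((LinearMap.flip (Coh.lift (((cupCocycles ρ p q).compr₂ (Coh.mk ρ (p + q))).flip)
      (fun z hz => by
        ext f
        exact Coh.mk_eq_zero.2 (cup_boundaries f.2.1 hz)))))
    (fun z hz => by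
      have : z = 0 := Subtype.ext (by rw [boundaries_triv] at hz; exact hz)
      rw [this, map_zero])

theorem cohMul_mk (ρ : SuperRep L M) {p q : ℕ} (f : cocycles (trivRep L) p) (φ : cocycles ρ q) :
    cohMul ρ p q (Coh.mk _ p f) (Coh.mk ρ q φ) = Coh.mk ρ (p + q) (cupCocycles ρ p q f φ) :=
  rfl

theorem cupCocycles_diag (ρ : SuperRep L M) {p q : ℕ} (f : cocycles (trivRep L) p)
    (φ : cocycles ρ q) (v : OddPart L) :
    (cupCocycles ρ p q f φ).1 (fun _ => v) =
      (((p.factorial * q.factorial : ℕ) : ℂ)⁻¹ * (p + q).factorial *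
        f.1 (fun _ => v)) • φ.1 (fun _ => v) :=
  cup_diag f.1 φ.1 v

theorem gradedMk_ext {ρ : SuperRep L M} {p q : ℕ} (h : p = q) (φ : cocycles ρ p)
    (ψ : cocycles ρ q) (hd : ∀ v : OddPart L, φ.1 (fun _ => v) = ψ.1 (fun _ => v)) :
    GradedMonoid.mk (A := Coh ρ) p (Coh.mk ρ p φ) = GradedMonoid.mk q (Coh.mk ρ q ψ) := by
  subst h
  rw [show φ = ψ from Subtype.ext (cochain_ext φ.2.1 ψ.2.1 hd)]

/-- The unit of the cohomology ring. -/
def oneCocycle (L : Type*) [AddCommGroup L] [Module ℂ L] [LieSuperalgebra L] :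
    cocycles (trivRep L) 0 :=
  ⟨MultilinearMap.constOfIsEmpty ℂ _ 1, mem_cocycles_triv.2
    ⟨fun σ x => rfl, fun y hy x => by simp [trivRep]⟩⟩

instance : GradedMonoid.GOne (Coh (trivRep L)) where
  one := Coh.mk (trivRep L) 0 (oneCocycle L)

instance : GradedMonoid.GMul (Coh (trivRep L)) where
  mul {p q} a b := cohMul (trivRep L) p q a b

instance : GradedMonoid.GMonoid (Coh (trivRep L)) where
  one_mul := by
    rintro ⟨p, a⟩
    obtain ⟨f, rfl⟩ := Coh.mk_surjective _ _ a
    refine gradedMk_ext (zero_add p) (cupCocycles _ 0 p (oneCocycle L) f) f fun v => ?_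
    rw [cupCocycles_diag]
    have h3 : ((p.factorial : ℕ) : ℂ) ≠ 0 := by exact_mod_cast p.factorial_ne_zero
    simp [oneCocycle, h3]
  mul_one := by
    rintro ⟨p, a⟩
    obtain ⟨f, rfl⟩ := Coh.mk_surjective _ _ a
    refine gradedMk_ext (add_zero p) (cupCocycles _ p 0 f (oneCocycle L)) f fun v => ?_
    rw [cupCocycles_diag]
    have h3 : ((p.factorial : ℕ) : ℂ) ≠ 0 := by exact_mod_cast p.factorial_ne_zero
    simp [oneCocycle, h3]
  mul_assoc := by
    rintro ⟨p, a⟩ ⟨q, b⟩ ⟨r, c⟩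
    obtain ⟨f, rfl⟩ := Coh.mk_surjective _ _ a
    obtain ⟨g, rfl⟩ := Coh.mk_surjective _ _ b
    obtain ⟨h, rfl⟩ := Coh.mk_surjective _ _ c
    refine gradedMk_ext (add_assoc p q r)
      (cupCocycles _ (p + q) r (cupCocycles _ p q f g) h)
      (cupCocycles _ p (q + r) f (cupCocycles _ q r g h)) fun v => ?_
    simp only [cupCocycles_diag, smul_eq_mul, add_assoc]
    have h1 : ((p.factorial : ℕ) : ℂ) ≠ 0 := by exact_mod_cast p.factorial_ne_zero
    have h2 : (((p + q).factorial : ℕ) : ℂ) ≠ 0 := by exact_mod_cast (p + q).factorial_ne_zero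
    have h3 : (((q + r).factorial : ℕ) : ℂ) ≠ 0 := by exact_mod_cast (q + r).factorial_ne_zero
    have h4 : ((q.factorial : ℕ) : ℂ) ≠ 0 := by exact_mod_cast q.factorial_ne_zero
    have h5 : ((r.factorial : ℕ) : ℂ) ≠ 0 := by exact_mod_cast r.factorial_ne_zero
    push_cast
    field_simp

theorem graded_mul_comm (a b : GradedMonoid (Coh (trivRep L))) : a * b = b * a := by
  obtain ⟨p, a⟩ := a
  obtain ⟨q, b⟩ := b
  obtain ⟨f, rfl⟩ := Coh.mk_surjective _ _ a
  obtain ⟨g, rfl⟩ := Coh.mk_surjective _ _ b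
  refine gradedMk_ext (add_comm p q) (cupCocycles _ p q f g) (cupCocycles _ q p g f) fun v => ?_
  simp only [cupCocycles_diag, smul_eq_mul, add_comm q p]
  push_cast
  ring

instance : DirectSum.GCommRing (Coh (trivRep L)) where
  mul_zero a := map_zero _
  zero_mul b := by
    change cohMul (trivRep L) _ _ 0 b = 0
    simp
  mul_add a b c := map_add _ _ _
  add_mul a b c := by
    change cohMul (trivRep L) _ _ (a + b) c = cohMul _ _ _ a c + cohMul _ _ _ b c
    simp
  natCast n := n • Coh.mk (trivRep L) 0 (oneCocycle L)
  natCast_zero := zero_smul _ _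
  natCast_succ n := by
    rw [add_smul, one_smul]
    rfl
  intCast n := n • Coh.mk (trivRep L) 0 (oneCocycle L)
  intCast_ofNat n := by simp
  intCast_negSucc_ofNat n := by
    rw [Int.negSucc_eq, neg_smul]
    norm_cast
  mul_comm := graded_mul_comm

theorem graded_smul_mul (c : ℂ) (a b : GradedMonoid (Coh (trivRep L))) :
    (c • a) * b = c • (a * b) := by
  obtain ⟨p, a⟩ := a
  obtain ⟨q, b⟩ := b
  change GradedMonoid.mk (p + q) (cohMul _ p q (c • a) b) =
    GradedMonoid.mk (p + q) (c • cohMul _ p q a b)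
  simp

instance : DirectSum.GAlgebra ℂ (Coh (trivRep L)) where
  toFun :=
    { toFun := fun c => c • Coh.mk (trivRep L) 0 (oneCocycle L)
      map_zero' := zero_smul _ _
      map_add' := fun a b => add_smul _ _ _ }
  map_one := one_smul _ _
  map_mul r s := by
    have h := graded_smul_mul r (1 : GradedMonoid (Coh (trivRep L)))
      (s • (1 : GradedMonoid (Coh (trivRep L))))
    rw [one_mul, smul_smul] at h
    exact h.symm
  commutes r x := graded_mul_comm _ _
  smul_def r x := by
    have h := graded_smul_mul r (1 : GradedMonoid (Coh (trivRep L))) x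
    rw [one_mul] at h
    exact h.symm

/-- The cohomology ring `H^•(L, L_0; ℂ)`. -/
abbrev CohRing (L : Type*) [AddCommGroup L] [Module ℂ L] [LieSuperalgebra L] : Type _ :=
  DirectSum ℕ (Coh (trivRep L))

/-- The total cohomology `H^•(L, L_0; M)`. -/
abbrev CohModule (ρ : SuperRep L M) : Type _ :=
  DirectSum ℕ (Coh ρ)

instance (ρ : SuperRep L M) : DirectSum.Gmodule (Coh (trivRep L)) (Coh ρ) where
  smul {p q} a b := cohMul ρ p q a b
  one_smul := by
    rintro ⟨p, a⟩
    obtain ⟨f, rfl⟩ := Coh.mk_surjective _ _ a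
    refine gradedMk_ext (zero_add p) (cupCocycles _ 0 p (oneCocycle L) f) f fun v => ?_
    rw [cupCocycles_diag]
    have h3 : ((p.factorial : ℕ) : ℂ) ≠ 0 := by exact_mod_cast p.factorial_ne_zero
    simp [oneCocycle, h3]
  mul_smul := by
    rintro ⟨p, a⟩ ⟨q, b⟩ ⟨r, c⟩
    obtain ⟨f, rfl⟩ := Coh.mk_surjective _ _ a
    obtain ⟨g, rfl⟩ := Coh.mk_surjective _ _ b
    obtain ⟨h, rfl⟩ := Coh.mk_surjective _ _ c
    refine gradedMk_ext (add_assoc p q r)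
      (cupCocycles _ (p + q) r (cupCocycles _ p q f g) h)
      (cupCocycles _ p (q + r) f (cupCocycles _ q r g h)) fun v => ?_
    simp only [cupCocycles_diag, smul_eq_mul, smul_smul, add_assoc]
    congr 1
    have h1 : ((p.factorial : ℕ) : ℂ) ≠ 0 := by exact_mod_cast p.factorial_ne_zero
    have h2 : (((p + q).factorial : ℕ) : ℂ) ≠ 0 := by exact_mod_cast (p + q).factorial_ne_zero
    have h3 : (((q + r).factorial : ℕ) : ℂ) ≠ 0 := by exact_mod_cast (q + r).factorial_ne_zero
    have h4 : ((q.factorial : ℕ) : ℂ) ≠ 0 := by exact_mod_cast q.factorial_ne_zero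
    have h5 : ((r.factorial : ℕ) : ℂ) ≠ 0 := by exact_mod_cast r.factorial_ne_zero
    push_cast
    field_simp
  smul_add a b c := map_add _ _ _
  smul_zero a := map_zero _
  add_smul a b c := by
    change cohMul ρ _ _ (a + b) c = cohMul ρ _ _ a c + cohMul ρ _ _ b c
    simp
  zero_smul b := by
    change cohMul ρ _ _ 0 b = 0
    simp


end Product

section Restriction

variable {L L' L'' M : Type*} [AddCommGroup L] [Module ℂ L] [LieSuperalgebra L]
    [AddCommGroup L'] [Module ℂ L'] [LieSuperalgebra L']
    [AddCommGroup L''] [Module ℂ L''] [LieSuperalgebra L'']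
    [AddCommGroup M] [Module ℂ M] [SuperSpace M]

/-- The map between the odd parts. -/
def LieSuperHom.odd (α : LieSuperHom L' L) : OddPart L' →ₗ[ℂ] OddPart L :=
  α.toLin.restrict fun _ hx => α.map_part hx

/-- Pulling back multilinear maps along a homomorphism. -/
def pull (α : LieSuperHom L' L) (M : Type*) [AddCommGroup M] [Module ℂ M] (p : ℕ) :
    MultilinearMap ℂ (fun _ : Fin p => OddPart L) M →ₗ[ℂ]
      MultilinearMap ℂ (fun _ : Fin p => OddPart L') M where
  toFun φ := φ.compLinearMap fun _ => α.odd
  map_add' φ ψ := by ext x; simp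
  map_smul' c φ := by ext x; simp

theorem pull_apply (α : LieSuperHom L' L) {p : ℕ}
    (φ : MultilinearMap ℂ (fun _ : Fin p => OddPart L) M) (x : Fin p → OddPart L') :
    pull α M p φ x = φ fun i => α.odd (x i) :=
  rfl

theorem pull_mem (α : LieSuperHom L' L) {ρ : SuperRep L M} {ρ' : SuperRep L' M}
    (h : ∀ x, ρ'.toLin x = ρ.toLin (α.toLin x)) {p : ℕ}
    {φ : MultilinearMap ℂ (fun _ : Fin p => OddPart L) M} (hφ : φ ∈ cochain ρ p) :
    pull α M p φ ∈ cochain ρ' p := by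
  refine ⟨fun σ x => hφ.1 σ fun i => α.odd (x i), fun y hy x => ?_⟩
  rw [h, pull_apply, hφ.2 _ (α.map_part hy)]
  refine Finset.sum_congr rfl fun i _ => ?_
  rw [pull_apply]
  congr 1
  funext k
  by_cases hk : k = i
  · subst hk
    simp only [Function.update_self]
    exact Subtype.ext (α.map_bracket _ _).symm
  · simp [Function.update_of_ne hk]

theorem d_pull (α : LieSuperHom L' L) {ρ : SuperRep L M} {ρ' : SuperRep L' M}
    (h : ∀ x, ρ'.toLin x = ρ.toLin (α.toLin x)) {p : ℕ}
    (φ : MultilinearMap ℂ (fun _ : Fin p => OddPart L) M) :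
    d ρ' p (pull α M p φ) = pull α M (p + 1) (d ρ p φ) := by
  ext x
  rw [d_apply, pull_apply, d_apply]
  simp only [h]
  rfl

/-- The restriction map on cohomology. -/
def resCoh (α : LieSuperHom L' L) {ρ : SuperRep L M} {ρ' : SuperRep L' M}
    (h : ∀ x, ρ'.toLin x = ρ.toLin (α.toLin x)) (p : ℕ) : Coh ρ p →ₗ[ℂ] Coh ρ' p :=
  Coh.lift (Coh.mk ρ' p ∘ₗ (pull α M p).restrict fun φ hφ => ⟨pull_mem α h hφ.1, by
      change d ρ' p (pull α M p φ) = 0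
      rw [d_pull α h, show d ρ p φ = 0 from hφ.2, map_zero]⟩)
    fun z hz => Coh.mk_eq_zero.2 (by
      cases p with
      | zero =>
        have h0 : z.1 = 0 := hz
        have h1 : z = 0 := Subtype.ext h0
        rw [h1, map_zero]
        exact zero_mem _
      | succ p =>
        obtain ⟨ψ, hψ, hz⟩ := hz
        exact ⟨pull α M p ψ, pull_mem α h hψ, by rw [d_pull α h, hz]; rfl⟩)

theorem triv_comp (α : LieSuperHom L' L) (x : L') :
    (trivRep L').toLin x = (trivRep L).toLin (α.toLin x) :=
  rfl

theorem resCoh_triv_mk (α : LieSuperHom L' L) {p : ℕ} (f : cocycles (trivRep L) p) :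
    resCoh α (triv_comp α) p (Coh.mk _ p f) = Coh.mk (trivRep L') p
      ⟨pull α ℂ p f.1, mem_cocycles_triv.2 (pull_mem α (triv_comp α) f.2.1)⟩ :=
  rfl

/-- The restriction map `H^•(L, L_0; ℂ) → H^•(L', L'_0; ℂ)` on cohomology rings. -/
def resRing (α : LieSuperHom L' L) : CohRing L →ₐ[ℂ] CohRing L' :=
  DirectSum.toAlgebra ℂ _ (fun p => DirectSum.lof ℂ ℕ (Coh (trivRep L')) p ∘ₗ
      resCoh α (triv_comp α) p)
    (by
      change DirectSum.of (Coh (trivRep L')) 0 (resCoh α (triv_comp α) 0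
        (Coh.mk _ 0 (oneCocycle L))) = _
      rw [resCoh_triv_mk]
      rfl)
    (fun {p q} a b => by
      change DirectSum.of (Coh (trivRep L')) _ (resCoh α (triv_comp α) (p + q)
        (cohMul _ p q a b)) = DirectSum.of (Coh (trivRep L')) _ (resCoh α (triv_comp α) p a) *
          DirectSum.of (Coh (trivRep L')) _ (resCoh α (triv_comp α) q b)
      obtain ⟨f, rfl⟩ := Coh.mk_surjective _ _ a
      obtain ⟨g, rfl⟩ := Coh.mk_surjective _ _ b
      rw [DirectSum.of_mul_of, cohMul_mk, resCoh_triv_mk, resCoh_triv_mk, resCoh_triv_mk]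
      refine congrArg (DirectSum.of (Coh (trivRep L')) (p + q)) ?_
      refine Eq.trans ?_ (cohMul_mk _ _ _).symm
      congr 1
      apply Subtype.ext
      ext x
      change cup p q f.1 g.1 (fun i => α.odd (x i)) = cup p q (pull α ℂ p f.1) (pull α ℂ q g.1) x
      rw [cup_apply, cup_apply]
      rfl)

theorem resRing_of (α : LieSuperHom L' L) {p : ℕ} (a : Coh (trivRep L) p) :
    resRing α (DirectSum.of _ p a) = DirectSum.of _ p (resCoh α (triv_comp α) p a) :=
  DirectSum.toAddMonoid_of _ _ _

theorem resRing_comp (α : LieSuperHom L' L) (β : LieSuperHom L'' L') :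
    resRing (α.comp β) = (resRing β).comp (resRing α) := by
  refine DirectSum.algHom_ext _ _ fun p a => ?_
  obtain ⟨f, rfl⟩ := Coh.mk_surjective _ _ a
  rw [AlgHom.comp_apply, resRing_of, resRing_of, resRing_of]
  rfl

theorem resRing_id (α : LieSuperHom L L) (h : ∀ x, α.toLin x = x) :
    resRing α = AlgHom.id ℂ _ := by
  refine DirectSum.algHom_ext _ _ fun p a => ?_
  obtain ⟨f, rfl⟩ := Coh.mk_surjective _ _ a
  rw [AlgHom.id_apply, resRing_of, resCoh_triv_mk]
  congr 2
  apply Subtype.ext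
  ext x
  rw [pull_apply]
  congr 1
  funext i
  exact Subtype.ext (h _)

/-- The annihilator of `H^•(L, L_0; Hom_ℂ(M, M))` in the cohomology ring. -/
def supportIdeal (ρ : SuperRep L M) : Ideal (CohRing L) :=
  Module.annihilator (CohRing L) (CohModule (endRep ρ))

/-- The support variety of `M`, as the closed subset of the maximal ideal spectrum of the
cohomology ring defined by the annihilator. -/
def support (ρ : SuperRep L M) : Set (MaximalSpectrum (CohRing L)) :=
  {m | supportIdeal ρ ≤ m.asIdeal}

end Restriction

section Quotients

variable {A G : Type*} [CommRing A] [Algebra ℂ A] [Group G]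

/-- The ideal of functions vanishing on a set of points of the maximal ideal spectrum. -/
def vanishing (V : Set (MaximalSpectrum A)) : Ideal A := ⨅ m ∈ V, m.asIdeal

/-- The coordinate ring of a subvariety `V` of the maximal ideal spectrum of `A`. -/
abbrev CoordRing (V : Set (MaximalSpectrum A)) : Type _ := A ⧸ vanishing V

/-- The action on points induced by an action of the group `G` on the algebra `A` :
`a (g x) = (g⁻¹ a) (x)`. -/
def pointAct (τ : G →* (A →ₐ[ℂ] A)) (g : G) (m : MaximalSpectrum A) : MaximalSpectrum A where
  asIdeal := m.asIdeal.comap (τ g⁻¹)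
  isMaximal := Ideal.comap_isMaximal_of_surjective _ fun a => ⟨τ g a, by
    rw [← AlgHom.mul_apply, ← map_mul, inv_mul_cancel, map_one, AlgHom.one_apply]⟩

/-- `V` is stable under `G`. -/
def IsStable (τ : G →* (A →ₐ[ℂ] A)) (V : Set (MaximalSpectrum A)) : Prop :=
  ∀ g, ∀ m ∈ V, pointAct τ g m ∈ V

theorem IsStable.le_comap {τ : G →* (A →ₐ[ℂ] A)} {V : Set (MaximalSpectrum A)}
    (hV : IsStable τ V) (g : G) : vanishing V ≤ (vanishing V).comap (τ g) := by
  intro a ha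
  simp only [vanishing, Ideal.mem_comap, Submodule.mem_iInf] at ha ⊢
  intro m hm
  have := ha _ (hV g⁻¹ m hm)
  simpa [pointAct] using this

/-- The induced action on the coordinate ring of a stable subvariety. -/
def coordAct {τ : G →* (A →ₐ[ℂ] A)} {V : Set (MaximalSpectrum A)} (hV : IsStable τ V) (g : G) :
    CoordRing V →ₐ[ℂ] CoordRing V :=
  Ideal.quotientMapₐ (vanishing V) (τ g) (hV.le_comap g)

/-- The ring of invariants `ℂ[V]^G`. It is the coordinate ring of the quotient `V / G`. -/
def invariants {τ : G →* (A →ₐ[ℂ] A)} {V : Set (MaximalSpectrum A)} (hV : IsStable τ V) :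
    Subalgebra ℂ (CoordRing V) where
  carrier := {a | ∀ g, coordAct hV g a = a}
  mul_mem' := fun ha hb g => by rw [map_mul, ha g, hb g]
  add_mem' := fun ha hb g => by rw [map_add, ha g, hb g]
  algebraMap_mem' := fun c g => by rw [AlgHom.commutes]

end Quotients

section Sub

/-- A Lie subsuperalgebra. -/
structure LieSubsuperalgebra (G : Type*) [AddCommGroup G] [Module ℂ G] [LieSuperalgebra G] where
  carrier : Submodule ℂ G
  graded : carrier ≤ (carrier ⊓ part 0) ⊔ (carrier ⊓ part 1)
  bracket_mem' : ∀ x ∈ carrier, ∀ y ∈ carrier, bracket x y ∈ carrier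

variable {G : Type*} [AddCommGroup G] [Module ℂ G] [LieSuperalgebra G]

instance (S : LieSubsuperalgebra G) : LieSuperalgebra S.carrier where
  part i := (part i).comap S.carrier.subtype
  isCompl := by
    constructor
    · rw [Submodule.disjoint_def]
      intro x h0 h1
      exact Subtype.ext ((Submodule.disjoint_def.1 (isCompl (V := G)).disjoint) _ h0 h1)
    · rw [codisjoint_iff, eq_top_iff]
      rintro ⟨x, hx⟩ -
      obtain ⟨a, ha, b, hb, hab⟩ := Submodule.mem_sup.1 (S.graded hx)
      exact Submodule.mem_sup.2 ⟨⟨a, ha.1⟩, ha.2, ⟨b, hb.1⟩, hb.2, Subtype.ext hab⟩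
  bracket := LinearMap.mk₂ ℂ (fun x y => ⟨bracket x.1 y.1, S.bracket_mem' _ x.2 _ y.2⟩)
    (fun _ _ _ => Subtype.ext (by simp)) (fun _ _ _ => Subtype.ext (by simp))
    (fun _ _ _ => Subtype.ext (by simp)) (fun _ _ _ => Subtype.ext (by simp))
  bracket_mem hx hy := bracket_mem (L := G) hx hy
  skew hx hy := Subtype.ext (skew (L := G) hx hy)
  jacobi hx hy hz := Subtype.ext (jacobi (L := G) hx hy hz)

/-- The inclusion of a Lie subsuperalgebra into a larger one. -/
def LieSubsuperalgebra.inclusion {S T : LieSubsuperalgebra G} (h : S.carrier ≤ T.carrier) :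
    LieSuperHom S.carrier T.carrier where
  toLin := Submodule.inclusion h
  map_part hx := hx
  map_bracket _ _ := rfl

/-- The restriction of a homomorphism which preserves a Lie subsuperalgebra. -/
def LieSuperHom.restr (α : LieSuperHom G G) (S : LieSubsuperalgebra G)
    (h : ∀ x ∈ S.carrier, α.toLin x ∈ S.carrier) : LieSuperHom S.carrier S.carrier where
  toLin := α.toLin.restrict h
  map_part hx := α.map_part hx
  map_bracket x y := Subtype.ext (α.map_bracket x.1 y.1)

theorem span_bilin {A B C : Type*} [AddCommGroup A] [Module ℂ A] [AddCommGroup B] [Module ℂ B]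
    [AddCommGroup C] [Module ℂ C] (f : A →ₗ[ℂ] B →ₗ[ℂ] C) {s : Set A} {t : Set B}
    {N : Submodule ℂ C} (h : ∀ a ∈ s, ∀ b ∈ t, f a b ∈ N) :
    ∀ a ∈ Submodule.span ℂ s, ∀ b ∈ Submodule.span ℂ t, f a b ∈ N := by
  have : Submodule.map₂ f (Submodule.span ℂ s) (Submodule.span ℂ t) ≤ N := by
    rw [Submodule.map₂_span_span, Submodule.span_le]
    rintro _ ⟨a, ha, b, hb, rfl⟩
    exact h a ha b hb
  exact Submodule.map₂_le.1 this

/-- The Lie subsuperalgebra spanned by a set `s` of even and a set `t` of odd elements. -/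
def LieSubsuperalgebra.ofSpan (s t : Set G) (hs : ∀ x ∈ s, x ∈ part (V := G) 0)
    (ht : ∀ x ∈ t, x ∈ part (V := G) 1)
    (hss : ∀ x ∈ s, ∀ y ∈ s, bracket x y ∈ Submodule.span ℂ (s ∪ t))
    (hst : ∀ x ∈ s, ∀ y ∈ t, bracket x y ∈ Submodule.span ℂ (s ∪ t))
    (htt : ∀ x ∈ t, ∀ y ∈ t, bracket x y ∈ Submodule.span ℂ (s ∪ t)) :
    LieSubsuperalgebra G where
  carrier := Submodule.span ℂ (s ∪ t)
  graded := by
    rw [Submodule.span_le]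
    rintro x (hx | hx)
    · exact Submodule.mem_sup_left ⟨Submodule.subset_span (Or.inl hx), hs x hx⟩
    · exact Submodule.mem_sup_right ⟨Submodule.subset_span (Or.inr hx), ht x hx⟩
  bracket_mem' := span_bilin bracket (by
    rintro x (hx | hx) y (hy | hy)
    · exact hss x hx y hy
    · exact hst x hx y hy
    · rw [skew (ht x hx) (hs y hy)]
      exact neg_mem (Submodule.smul_mem _ _ (hst y hy x hx))
    · exact htt x hx y hy)

end Sub

section Cartan

/-- The exterior algebra `Λ(n)` of `ℂ^n`. -/
def Lam (n : ℕ) : Type := ExteriorAlgebra ℂ (Fin n → ℂ)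

instance instRingLam (n : ℕ) : Ring (Lam n) :=
  inferInstanceAs (Ring (ExteriorAlgebra ℂ (Fin n → ℂ)))

instance instAlgebraLam (n : ℕ) : Algebra ℂ (Lam n) :=
  inferInstanceAs (Algebra ℂ (ExteriorAlgebra ℂ (Fin n → ℂ)))

/-- The `ℤ/2`-grading of `Λ(n)` by the parity of the total degree. -/
instance instSuperSpaceLam (n : ℕ) : SuperSpace (Lam n) where
  part := CliffordAlgebra.evenOdd (0 : QuadraticForm ℂ (Fin n → ℂ))
  isCompl := CliffordAlgebra.evenOdd_isCompl (0 : QuadraticForm ℂ (Fin n → ℂ))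

variable {n : ℕ}

/-- The embedding of `ℂ^n` into `Λ(n)`. -/
def lin (v : Fin n → ℂ) : Lam n := ExteriorAlgebra.ι ℂ v

/-- The generator `ξ_i` of `Λ(n)`. -/
def xi (i : Fin n) : Lam n := lin (Pi.single i 1)

/-- The multiplication operator by `ξ_i`. -/
def X (i : Fin n) : Module.End ℂ (Lam n) := LinearMap.mulLeft ℂ (xi i)

/-- The superderivation `∂_i` of `Λ(n)`, with `∂_i(ξ_j) = δ_{ij}`. -/
def del (i : Fin n) : Module.End ℂ (Lam n) :=
  CliffordAlgebra.contractLeft (Q := (0 : QuadraticForm ℂ (Fin n → ℂ))) (LinearMap.proj i)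

/-- The even element `ξ_i ∂_i`. -/
def hElt (i : Fin n) : Module.End ℂ (Lam n) := X i * del i

theorem del_lin_mul (i : Fin n) (v : Fin n → ℂ) (x : Lam n) :
    del i (lin v * x) = v i • x - lin v * del i x :=
  CliffordAlgebra.contractLeft_ι_mul (Q := (0 : QuadraticForm ℂ (Fin n → ℂ))) _ _ _

theorem lin_sq (v : Fin n → ℂ) : lin v * lin v = 0 :=
  ExteriorAlgebra.ι_sq_zero v

theorem lin_mul_lin (v w : Fin n → ℂ) : lin v * lin w = -(lin w * lin v) :=
  eq_neg_of_add_eq_zero_left (ExteriorAlgebra.ι_add_mul_swap (R := ℂ) v w)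

theorem lam_induction {P : Lam n → Prop} (h1 : ∀ r, P (algebraMap ℂ _ r))
    (h2 : ∀ x y, P x → P y → P (x + y)) (h3 : ∀ v x, P x → P (lin v * x)) (x : Lam n) : P x :=
  CliffordAlgebra.left_induction (Q := (0 : QuadraticForm ℂ (Fin n → ℂ))) (P := P) h1 h2
    (fun x v hx => h3 v x hx) x

theorem lam_ext {f g : Module.End ℂ (Lam n)} (h1 : f 1 = g 1)
    (h2 : ∀ (v : Fin n → ℂ) (x : Lam n), f x = g x → f (lin v * x) = g (lin v * x)) :
    f = g := by
  refine LinearMap.ext fun x => ?_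
  refine lam_induction (P := fun x => f x = g x) (fun r => ?_) (fun x y hx hy => ?_) h2 x
  · rw [Algebra.algebraMap_eq_smul_one, map_smul, map_smul, h1]
  · rw [map_add, map_add, hx, hy]

theorem del_X (i j : Fin n) : del i * X j = (if i = j then 1 else 0) - X j * del i := by
  refine LinearMap.ext fun x => ?_
  change del i (xi j * x) = (if i = j then (1 : Module.End ℂ (Lam n)) else 0) x - xi j * del i x
  rw [xi, del_lin_mul]
  congr 1
  split_ifs with h
  · subst h
    rw [Pi.single_eq_same, one_smul]
    rfl
  · rw [Pi.single_eq_of_ne h, zero_smul]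
    rfl

theorem del_del (i j : Fin n) : del i * del j = -(del j * del i) :=
  LinearMap.ext fun x =>
    CliffordAlgebra.contractLeft_comm (Q := (0 : QuadraticForm ℂ (Fin n → ℂ))) _ _ x

theorem X_X (i j : Fin n) : X i * X j = -(X j * X i) := by
  refine LinearMap.ext fun x => ?_
  change xi i * (xi j * x) = -(xi j * (xi i * x))
  rw [← mul_assoc, ← mul_assoc, xi, xi, lin_mul_lin, neg_mul]

theorem X_sq (i : Fin n) : X i * X i = 0 := by
  refine LinearMap.ext fun x => ?_
  change xi i * (xi i * x) = 0
  rw [← mul_assoc, xi, lin_sq, zero_mul]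

theorem lin_mul_mem {i j : ZMod 2} (h : i + 1 = j) (v : Fin n → ℂ) {x : Lam n}
    (hx : x ∈ part (V := Lam n) i) : lin v * x ∈ part (V := Lam n) j := by
  have := SetLike.mul_mem_graded (A := CliffordAlgebra.evenOdd (0 : QuadraticForm ℂ (Fin n → ℂ)))
    (CliffordAlgebra.ι_mem_evenOdd_one _ v) hx
  rw [add_comm, h] at this
  exact this

theorem X_mem (i : Fin n) : X i ∈ part (V := Module.End ℂ (Lam n)) 1 := fun _ _ hv =>
  lin_mul_mem (add_comm _ _) _ hv

theorem zmod2_add : ∀ j : ZMod 2, 1 + j + 1 = j := by decide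

theorem zmod2_succ : ∀ j : ZMod 2, j + 1 + 1 = j := by decide

/-- An induction principle for homogeneous elements of `Λ(n)`. -/
theorem lam_hom_induction {P : Lam n → Prop} {j : ZMod 2}
    (h1 : j = 0 → ∀ r, P (algebraMap ℂ _ r)) (h1' : j = 1 → ∀ v, P (lin v))
    (h2 : ∀ x y, P x → P y → P (x + y))
    (h3 : ∀ a b x, x ∈ part (V := Lam n) j → P x → P (lin a * (lin b * x)))
    (v : Lam n) (hv : v ∈ part (V := Lam n) j) : P v := by
  refine CliffordAlgebra.evenOdd_induction (0 : QuadraticForm ℂ (Fin n → ℂ)) j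
    (motive := fun x _ => P x) (fun v hv => ?_) (fun x y _ _ hx hy => h2 x y hx hy)
    (fun a b x hx hx' => ?_) v hv
  · obtain rfl | rfl := zmod2_cases j
    · have hv' : v ∈ LinearMap.range (CliffordAlgebra.ι
          (0 : QuadraticForm ℂ (Fin n → ℂ))) ^ 0 := hv
      rw [pow_zero] at hv'
      obtain ⟨r, rfl⟩ := Submodule.mem_one.1 hv'
      exact h1 rfl r
    · have hv' : v ∈ LinearMap.range (CliffordAlgebra.ι
          (0 : QuadraticForm ℂ (Fin n → ℂ))) ^ 1 := hv
      rw [pow_one] at hv'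
      obtain ⟨w, rfl⟩ := hv'
      exact h1' rfl w
  · rw [mul_assoc]
    exact h3 a b x hx hx'

theorem algebraMap_mem (r : ℂ) : algebraMap ℂ (Lam n) r ∈ part (V := Lam n) 0 :=
  CliffordAlgebra.one_le_evenOdd_zero (0 : QuadraticForm ℂ (Fin n → ℂ))
    (Submodule.mem_one.2 ⟨r, rfl⟩)

theorem lin_mem (v : Fin n → ℂ) : lin v ∈ part (V := Lam n) 1 :=
  CliffordAlgebra.ι_mem_evenOdd_one (0 : QuadraticForm ℂ (Fin n → ℂ)) v

theorem del_algebraMap (i : Fin n) (r : ℂ) : del i (algebraMap ℂ (Lam n) r) = 0 :=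
  CliffordAlgebra.contractLeft_algebraMap (Q := (0 : QuadraticForm ℂ (Fin n → ℂ))) _ r

theorem del_lin (i : Fin n) (v : Fin n → ℂ) : del i (lin v) = algebraMap ℂ (Lam n) (v i) :=
  CliffordAlgebra.contractLeft_ι (Q := (0 : QuadraticForm ℂ (Fin n → ℂ))) _ v

theorem del_mem (i : Fin n) : del i ∈ part (V := Module.End ℂ (Lam n)) 1 := by
  intro j v hv
  refine lam_hom_induction (P := fun v => del i v ∈ part (V := Lam n) (1 + j)) (fun _ r => ?_)
    (fun hj v => ?_) (fun x y hx hy => ?_) (fun a b x hx hx' => ?_) v hv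
  · rw [del_algebraMap]
    exact zero_mem _
  · subst hj
    rw [del_lin]
    exact algebraMap_mem _
  · rw [map_add]
    exact add_mem hx hy
  · rw [del_lin_mul, del_lin_mul]
    exact sub_mem (Submodule.smul_mem _ _ (lin_mul_mem (add_comm _ _) b hx))
      (lin_mul_mem (add_comm _ _) a (sub_mem (Submodule.smul_mem _ _ hx)
        (lin_mul_mem (zmod2_add j) b hx')))

section Relations

variable {R : Type*} [Ring R] {c c' x x' y y' : R}

theorem rel_X (h : y * x' = c - x' * y) (h' : x * x' = -(x' * x)) :
    x * y * x' = x' * (x * y) + x * c := by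
  rw [mul_assoc, h, mul_sub, ← mul_assoc, h', neg_mul, mul_assoc, sub_neg_eq_add, add_comm]

theorem rel_comm (h1 : x * y * x' = x' * (x * y) + c) (h2 : x * y * y' = y' * (x * y) - c')
    (h3 : c * y' = x' * c') : x * y * (x' * y') = x' * y' * (x * y) := by
  rw [← mul_assoc, h1, add_mul, mul_assoc x', h2, mul_sub, h3, mul_assoc x', sub_add_cancel]

theorem rel_del (h : y' * x = c - x * y') (h' : y * y' = -(y' * y)) :
    x * y * y' = y' * (x * y) - c * y := by
  rw [mul_assoc, h', ← mul_assoc y', h, sub_mul, mul_neg, mul_assoc]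
  abel

theorem rel_y1 {h h' : R} (h1 : h * x = x * h + c) (h2 : h * h' = h' * h) :
    h * (x * h') = x * h' * h + c * h' := by
  rw [← mul_assoc, h1, add_mul, mul_assoc, h2, mul_assoc]

theorem rel_y2 {h : R} (h1 : y * x = 1 - x * y) (h2 : h * y = y * h) :
    y * (x * h) = -(x * h * y) + h := by
  rw [← mul_assoc, h1, sub_mul, one_mul, mul_assoc, mul_assoc, h2, neg_add_eq_sub]

theorem rel_y3 {h h' : R} (h1 : h * x = x * h) (h2 : x * x = 0) :
    x * h * (x * h') = 0 := by
  rw [mul_assoc, ← mul_assoc h, h1, mul_assoc, ← mul_assoc x, h2, zero_mul]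

end Relations

section Gl

variable {V : Type*} [AddCommGroup V] [Module ℂ V] [SuperSpace V] {i : ZMod 2}
    {f g c : Module.End ℂ V}

theorem bracket_of_comm (hf : f ∈ part (V := Module.End ℂ V) 0)
    (hg : g ∈ part (V := Module.End ℂ V) i) (h : f * g = g * f + c) : bracket f g = c := by
  rw [bracket_end hf hg, h, sgn_zero_left, one_smul, add_sub_cancel_left]

theorem bracket_of_anticomm (hf : f ∈ part (V := Module.End ℂ V) 1)
    (hg : g ∈ part (V := Module.End ℂ V) 1) (h : f * g = -(g * f) + c) : bracket f g = c := by
  rw [bracket_end hf hg, h, sgn_one_one, neg_one_smul]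
  abel

end Gl

theorem hElt_mem (i : Fin n) : hElt i ∈ part (V := Module.End ℂ (Lam n)) 0 := by
  have h := mul_mem_part (X_mem i) (del_mem i)
  rw [show (1 : ZMod 2) + 1 = 0 by decide] at h
  exact h


theorem hElt_X (i j : Fin n) :
    hElt i * X j = X j * hElt i + (if i = j then X j else 0) := by
  refine (rel_X (del_X i j) (X_X i j)).trans ?_
  split_ifs with h
  · subst h
    exact congrArg _ (mul_one _)
  · exact congrArg _ (mul_zero _)

theorem hElt_del (i j : Fin n) :
    hElt i * del j = del j * hElt i - (if i = j then del j else 0) := by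
  refine (rel_del (del_X j i) (del_del i j)).trans ?_
  split_ifs with h h' h'
  · subst h
    exact congrArg _ (one_mul _)
  · exact absurd h.symm h'
  · exact absurd h'.symm h
  · exact congrArg _ (zero_mul _)

theorem hElt_hElt (i j : Fin n) : hElt i * hElt j = hElt j * hElt i := by
  refine rel_comm (hElt_X i j) (hElt_del i j) ?_
  split_ifs
  · rfl
  · exact (zero_mul _).trans (mul_zero _).symm

theorem bracket_hElt_hElt (i j : Fin n) : bracket (hElt i) (hElt j) = 0 :=
  bracket_of_comm (hElt_mem i) (hElt_mem j) ((hElt_hElt i j).trans (add_zero _).symm)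

theorem bracket_hElt_del (i j : Fin n) :
    bracket (hElt i) (del j) = -(if i = j then del j else 0) :=
  bracket_of_comm (hElt_mem i) (del_mem j) ((hElt_del i j).trans (sub_eq_add_neg _ _))

theorem bracket_del_del (i j : Fin n) : bracket (del i) (del j) = 0 :=
  bracket_of_anticomm (del_mem i) (del_mem j) ((del_del i j).trans (add_zero _).symm)

variable [NeZero n]

/-- The odd element `ξ_1 ξ_i ∂_i`; the index `1` of the first generator is written `0`. -/
def yElt (i : Fin n) : Module.End ℂ (Lam n) := X 0 * hElt i

theorem yElt_mem (i : Fin n) : yElt i ∈ part (V := Module.End ℂ (Lam n)) 1 := by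
  have h := mul_mem_part (X_mem 0) (hElt_mem i)
  rw [show (1 : ZMod 2) + 0 = 1 by decide] at h
  exact h

theorem bracket_hElt_yElt (i j : Fin n) :
    bracket (hElt i) (yElt j) = if i = 0 then yElt j else 0 := by
  refine bracket_of_comm (hElt_mem i) (yElt_mem j)
    ((rel_y1 (hElt_X i 0) (hElt_hElt i j)).trans ?_)
  split_ifs
  · rfl
  · exact congrArg _ (zero_mul _)

theorem hElt_del_zero {j : Fin n} (hj : j ≠ 0) : hElt j * del 0 = del 0 * hElt j := by
  rw [hElt_del, if_neg hj]
  exact sub_zero _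

theorem hElt_X_zero {j : Fin n} (hj : j ≠ 0) : hElt j * X 0 = X 0 * hElt j := by
  rw [hElt_X, if_neg hj]
  exact add_zero _

theorem bracket_del_yElt {j : Fin n} (hj : j ≠ 0) : bracket (del 0) (yElt j) = hElt j :=
  bracket_of_anticomm (del_mem 0) (yElt_mem j)
    (rel_y2 ((del_X 0 0).trans (by rw [if_pos rfl])) (hElt_del_zero hj))

theorem bracket_yElt_yElt {i j : Fin n} (hi : i ≠ 0) (hj : j ≠ 0) :
    bracket (yElt i) (yElt j) = 0 := by
  have h : ∀ {i j : Fin n}, i ≠ 0 → yElt i * yElt j = 0 := fun hi =>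
    rel_y3 (hElt_X_zero hi) (X_sq 0)
  refine bracket_of_anticomm (yElt_mem i) (yElt_mem j) ?_
  rw [h hi, h hj]
  exact (neg_zero (G := Module.End ℂ (Lam n))).symm.trans (add_zero _).symm

/-- The odd part of `𝔣` and `𝔣̃` : it is spanned by `∂_1` and the `ξ_1 ξ_i ∂_i`, `i = 2, …, n`. -/
def oddGen (n : ℕ) [NeZero n] : Set (Module.End ℂ (Lam n)) :=
  {x | x = del 0 ∨ ∃ i : Fin n, i ≠ 0 ∧ x = yElt i}

/-- The Lie subsuperalgebra of `W(n)`, the superderivations of `Λ(n)` inside `gl(Λ(n))`, which is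
spanned by the `ξ_i ∂_i` with `i ∈ I` and by `∂_1` and the `ξ_1 ξ_i ∂_i`, `i = 2, …, n`. -/
def subW (I : Set (Fin n)) (hI : ∀ i, i ≠ 0 → i ∈ I) :
    LieSubsuperalgebra (Module.End ℂ (Lam n)) :=
  LieSubsuperalgebra.ofSpan (hElt '' I) (oddGen n)
    (by rintro _ ⟨i, -, rfl⟩; exact hElt_mem i)
    (by
      rintro _ (rfl | ⟨i, -, rfl⟩)
      · exact del_mem 0
      · exact yElt_mem i)
    (by
      rintro _ ⟨i, -, rfl⟩ _ ⟨j, -, rfl⟩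
      rw [bracket_hElt_hElt]
      exact zero_mem _)
    (by
      rintro _ ⟨i, -, rfl⟩ _ (rfl | ⟨j, hj, rfl⟩)
      · rw [bracket_hElt_del]
        split_ifs
        · exact neg_mem (Submodule.subset_span (Or.inr (Or.inl rfl)))
        · simp
      · rw [bracket_hElt_yElt]
        split_ifs
        · exact Submodule.subset_span (Or.inr (Or.inr ⟨j, hj, rfl⟩))
        · exact zero_mem _)
    (by
      have key : ∀ j : Fin n, j ≠ 0 → hElt j ∈ Submodule.span ℂ (hElt '' I ∪ oddGen n) :=
        fun j hj => Submodule.subset_span (Or.inl ⟨j, hI j hj, rfl⟩)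
      rintro _ (rfl | ⟨i, hi, rfl⟩) _ (rfl | ⟨j, hj, rfl⟩)
      · rw [bracket_del_del]
        exact zero_mem _
      · rw [bracket_del_yElt hj]
        exact key j hj
      · rw [skew (yElt_mem i) (del_mem 0), bracket_del_yElt hi]
        exact neg_mem (Submodule.smul_mem _ _ (key i hi))
      · rw [bracket_yElt_yElt hi hj]
        exact zero_mem _)

/-- The detecting subalgebra `𝔣` of `W(n)`, with even part spanned by `ξ_i ∂_i`, `i = 1, …, n`. -/
def det (n : ℕ) [NeZero n] : LieSubsuperalgebra (Module.End ℂ (Lam n)) :=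
  subW Set.univ fun i _ => Set.mem_univ i

/-- The subalgebra `𝔣̃` of `𝔣`, with even part spanned by `ξ_i ∂_i`, `i = 2, …, n`. -/
def detTilde (n : ℕ) [NeZero n] : LieSubsuperalgebra (Module.End ℂ (Lam n)) :=
  subW {i | i ≠ 0} fun _ hi => hi

theorem detTilde_le (n : ℕ) [NeZero n] : (detTilde n).carrier ≤ (det n).carrier :=
  Submodule.span_mono (Set.union_subset_union_left _ (Set.image_mono (Set.subset_univ _)))

/-- The inclusion of `𝔣̃` into `𝔣`. -/
def incl (n : ℕ) [NeZero n] : LieSuperHom (detTilde n).carrier (det n).carrier :=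
  LieSubsuperalgebra.inclusion (detTilde_le n)

end Cartan

section Conj

variable {V : Type*} [AddCommGroup V] [Module ℂ V] [SuperSpace V]

/-- Conjugation by an even invertible operator `a` with inverse `b`, as an automorphism
of `gl(V)`. -/
def conjHom (a b : Module.End ℂ V) (ha : a ∈ part (V := Module.End ℂ V) 0)
    (hb : b ∈ part (V := Module.End ℂ V) 0) (hba : b * a = 1) :
    LieSuperHom (Module.End ℂ V) (Module.End ℂ V) where
  toLin := LinearMap.mulLeft ℂ a ∘ₗ LinearMap.mulRight ℂ b
  map_part {i x} hx := by
    have h := mul_mem_part ha (mul_mem_part hx hb)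
    rw [zero_add, add_zero] at h
    exact h
  map_bracket x y := by
    have key : (bracket (L := Module.End ℂ V)).compr₂
          (LinearMap.mulLeft ℂ a ∘ₗ LinearMap.mulRight ℂ b) =
        (bracket (L := Module.End ℂ V)).compl₁₂
          (LinearMap.mulLeft ℂ a ∘ₗ LinearMap.mulRight ℂ b)
          (LinearMap.mulLeft ℂ a ∘ₗ LinearMap.mulRight ℂ b) := by
      refine bilin_ext fun i j x hx y hy => ?_
      have h : ∀ {k : ZMod 2} {z : Module.End ℂ V}, z ∈ part (V := Module.End ℂ V) k →
          a * (z * b) ∈ part (V := Module.End ℂ V) k := fun hz => by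
        have h := mul_mem_part ha (mul_mem_part hz hb)
        rw [zero_add, add_zero] at h
        exact h
      have h' : ∀ z w : Module.End ℂ V, a * (z * b) * (a * (w * b)) = a * (z * w * b) := by
        intro z w
        rw [mul_assoc, mul_assoc z, ← mul_assoc b, hba, one_mul, mul_assoc z]
      change a * (bracket x y * b) = bracket (a * (x * b)) (a * (y * b))
      rw [bracket_end (h hx) (h hy), bracket_end hx hy, h', h', sub_mul, mul_sub,
        smul_mul_assoc, mul_smul_comm]
    exact LinearMap.congr_fun₂ key x y

theorem conjHom_apply (a b : Module.End ℂ V) (ha : a ∈ part (V := Module.End ℂ V) 0)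
    (hb : b ∈ part (V := Module.End ℂ V) 0) (hba : b * a = 1) (x : Module.End ℂ V) :
    (conjHom a b ha hb hba).toLin x = a * (x * b) :=
  rfl

end Conj

section Torus

variable {n : ℕ}

/-- The action of the diagonal matrix with entries `t_i` on `Λ(n)` : the algebra homomorphism
with `ξ_i ↦ t_i ξ_i`. -/
def scaleAlg (t : Fin n → ℂˣ) : Lam n →ₐ[ℂ] Lam n :=
  ExteriorAlgebra.map (LinearMap.pi fun i => (t i : ℂ) • LinearMap.proj (R := ℂ) i)

/-- `scaleAlg t` as a linear operator. -/
def scale (t : Fin n → ℂˣ) : Module.End ℂ (Lam n) := (scaleAlg t).toLinearMap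

theorem scale_one_elt (t : Fin n → ℂˣ) : scale t (1 : Lam n) = 1 :=
  map_one (scaleAlg t)

theorem scale_algebraMap (t : Fin n → ℂˣ) (r : ℂ) :
    scale t (algebraMap ℂ (Lam n) r) = algebraMap ℂ (Lam n) r := by
  rw [Algebra.algebraMap_eq_smul_one, map_smul, scale_one_elt]

theorem scale_lin (t : Fin n → ℂˣ) (v : Fin n → ℂ) :
    scale t (lin v) = lin fun i => (t i : ℂ) * v i :=
  ExteriorAlgebra.map_apply_ι _ v

theorem scale_mul (t : Fin n → ℂˣ) (x y : Lam n) : scale t (x * y) = scale t x * scale t y :=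
  map_mul (scaleAlg t) x y

theorem scale_scale (t s : Fin n → ℂˣ) : scale t * scale s = scale (t * s) := by
  refine lam_ext ?_ fun v x hx => ?_
  · change scale t (scale s 1) = _
    rw [scale_one_elt, scale_one_elt, scale_one_elt]
  · change scale t (scale s _) = _
    change scale t (scale s x) = scale (t * s) x at hx
    rw [scale_mul, scale_mul, scale_mul, hx, scale_lin, scale_lin, scale_lin]
    simp [mul_assoc]

theorem scale_one : scale (1 : Fin n → ℂˣ) = 1 := by
  refine lam_ext (scale_one_elt _) fun v x hx => ?_
  rw [scale_mul, hx, scale_lin]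
  simp

theorem scale_mem (t : Fin n → ℂˣ) : scale t ∈ part (V := Module.End ℂ (Lam n)) 0 := by
  intro j v hv
  rw [zero_add]
  refine lam_hom_induction (P := fun v => scale t v ∈ part (V := Lam n) j) (fun hj r => ?_)
    (fun hj v => ?_) (fun x y hx hy => ?_) (fun a b x hx hx' => ?_) v hv
  · subst hj
    rw [scale_algebraMap]
    exact algebraMap_mem _
  · subst hj
    rw [scale_lin]
    exact lin_mem _
  · rw [map_add]
    exact add_mem hx hy
  · rw [scale_mul, scale_mul, scale_lin, scale_lin]
    exact lin_mul_mem (zmod2_succ j) _ (lin_mul_mem rfl _ hx')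

theorem scale_inv_mul (t : Fin n → ℂˣ) : scale t⁻¹ * scale t = 1 := by
  rw [scale_scale, inv_mul_cancel, scale_one]

/-- The action of the torus `T` of diagonal matrices on `gl(Λ(n))` by conjugation. -/
def torusConj (t : Fin n → ℂˣ) : LieSuperHom (Module.End ℂ (Lam n)) (Module.End ℂ (Lam n)) :=
  conjHom (scale t) (scale t⁻¹) (scale_mem t) (scale_mem _) (scale_inv_mul t)

theorem torusConj_of (t : Fin n → ℂˣ) {x y : Module.End ℂ (Lam n)}
    (h : scale t * x = y * scale t) : (torusConj t).toLin x = y := by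
  change scale t * (x * scale t⁻¹) = y
  rw [← mul_assoc, h, mul_assoc, scale_scale, mul_inv_cancel, scale_one, mul_one]

theorem scale_X (t : Fin n → ℂˣ) (i : Fin n) : scale t * X i = ((t i : ℂ) • X i) * scale t := by
  refine LinearMap.ext fun x => ?_
  change scale t (xi i * x) = (t i : ℂ) • (xi i * scale t x)
  rw [scale_mul, xi, scale_lin, ← smul_mul_assoc]
  congr 1
  have : (fun j => (t j : ℂ) * (Pi.single i 1 : Fin n → ℂ) j) = (t i : ℂ) • Pi.single i 1 := by
    funext j
    by_cases h : j = i
    · subst h; simp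
    · simp [h]
  rw [this]
  exact map_smul (ExteriorAlgebra.ι ℂ) _ _

theorem scale_del (t : Fin n → ℂˣ) (i : Fin n) :
    scale t * del i = (((t i)⁻¹ : ℂˣ) : ℂ) • del i * scale t := by
  refine lam_ext ?_ fun v x hx => ?_
  · change scale t (del i 1) = (((t i)⁻¹ : ℂˣ) : ℂ) • del i (scale t 1)
    have h : del i (1 : Lam n) = 0 := by
      have := del_algebraMap i (1 : ℂ)
      rwa [map_one] at this
    rw [scale_one_elt, h, map_zero, smul_zero]
  · change scale t (del i x) = (((t i)⁻¹ : ℂˣ) : ℂ) • del i (scale t x) at hx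
    change scale t (del i (lin v * x)) = (((t i)⁻¹ : ℂˣ) : ℂ) • del i (scale t (lin v * x))
    rw [scale_mul, scale_lin, del_lin_mul, del_lin_mul, map_sub, map_smul, scale_mul, hx,
      scale_lin, smul_sub, smul_smul, ← mul_assoc, Units.inv_mul, one_mul, mul_smul_comm]

theorem torusConj_hElt (t : Fin n → ℂˣ) (i : Fin n) : (torusConj t).toLin (hElt i) = hElt i := by
  refine torusConj_of t ?_
  have h : scale t * hElt i = scale t * X i * del i := (mul_assoc _ _ _).symm
  rw [h, scale_X, mul_assoc, scale_del, smul_mul_assoc, smul_mul_assoc, mul_smul_comm, smul_smul,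
    Units.mul_inv, one_smul]
  exact (mul_assoc _ _ _).symm

theorem torusConj_del (t : Fin n → ℂˣ) (i : Fin n) :
    (torusConj t).toLin (del i) = (((t i)⁻¹ : ℂˣ) : ℂ) • del i :=
  torusConj_of t (scale_del t i)

variable [NeZero n]

theorem torusConj_yElt (t : Fin n → ℂˣ) (i : Fin n) :
    (torusConj t).toLin (yElt i) = (t 0 : ℂ) • yElt i := by
  have h0 : (torusConj t).toLin (yElt i) =
      (torusConj t).toLin (X 0) * (torusConj t).toLin (hElt i) := by
    change scale t * (X 0 * hElt i * scale t⁻¹) =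
      scale t * (X 0 * scale t⁻¹) * (scale t * (hElt i * scale t⁻¹))
    simp only [mul_assoc]
    rw [← mul_assoc (scale t⁻¹) (scale t), scale_inv_mul, one_mul]
  rw [h0, torusConj_hElt, torusConj_of t (scale_X t 0), smul_mul_assoc]
  rfl

theorem torusConj_mem (t : Fin n → ℂˣ) :
    ∀ x ∈ (detTilde n).carrier, (torusConj t).toLin x ∈ (detTilde n).carrier := by
  have : (detTilde n).carrier ≤ (detTilde n).carrier.comap (torusConj t).toLin := by
    refine Submodule.span_le.2 ?_
    rintro x (⟨i, hi, rfl⟩ | rfl | ⟨i, hi, rfl⟩)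
    · change (torusConj t).toLin (hElt i) ∈ (detTilde n).carrier
      rw [torusConj_hElt]
      exact Submodule.subset_span (Or.inl ⟨i, hi, rfl⟩)
    · change (torusConj t).toLin (del 0) ∈ (detTilde n).carrier
      rw [torusConj_del]
      exact Submodule.smul_mem _ _ (Submodule.subset_span (Or.inr (Or.inl rfl)))
    · change (torusConj t).toLin (yElt i) ∈ (detTilde n).carrier
      rw [torusConj_yElt]
      exact Submodule.smul_mem _ _ (Submodule.subset_span (Or.inr (Or.inr ⟨i, hi, rfl⟩)))
  exact this

/-- The action of the torus `T` on `𝔣̃`. -/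
def torusAct (n : ℕ) [NeZero n] (t : Fin n → ℂˣ) :
    LieSuperHom (detTilde n).carrier (detTilde n).carrier :=
  (torusConj t).restr (detTilde n) (torusConj_mem t)

/-- The action of the torus `T` on the cohomology ring of `𝔣̃`, given on cochains by
`(t . φ)(x) = φ(t⁻¹ x)`. -/
def torusRing (n : ℕ) [NeZero n] :
    (Fin n → ℂˣ) →* (CohRing (detTilde n).carrier →ₐ[ℂ] CohRing (detTilde n).carrier) where
  toFun t := resRing (torusAct n t⁻¹)
  map_one' := resRing_id _ fun x => Subtype.ext (by
    change scale (1 : Fin n → ℂˣ)⁻¹ * (x.1 * scale (1 : Fin n → ℂˣ)⁻¹⁻¹) = x.1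
    rw [inv_one, inv_one, scale_one, mul_one, one_mul])
  map_mul' t s := by
    change _ = (resRing (torusAct n t⁻¹)).comp (resRing (torusAct n s⁻¹))
    rw [← resRing_comp]
    have h : torusAct n (t * s)⁻¹ = (torusAct n s⁻¹).comp (torusAct n t⁻¹) := by
      rw [LieSuperHom.mk.injEq]
      refine LinearMap.ext fun x => Subtype.ext ?_
      change scale (t * s)⁻¹ * (x.1 * scale (t * s)⁻¹⁻¹) =
        scale s⁻¹ * (scale t⁻¹ * (x.1 * scale t⁻¹⁻¹) * scale s⁻¹⁻¹)
      simp only [mul_assoc]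
      rw [scale_scale, ← mul_assoc (scale s⁻¹), scale_scale, inv_inv, inv_inv, inv_inv, mul_inv_rev]
    rw [h]

end Torus

end SuperCoh

end

open SuperCoh

/-!
# Support varieties of the detecting subalgebras of `W(n)`

Write `L' ⊆ L` for `𝔣̃ ⊆ 𝔣`, `S` and `R` for their cohomology rings and `h` for `ξ_1 ∂_1`. The two
odd parts agree, the even part of `L'` acts trivially on them, and `ad h` acts on them with
eigenvalues `1` and `-1`. Since the coboundaries with trivial coefficients vanish, `S` is the ring
of all polynomial functions on the odd part. It is graded by the weights of `h`, which are those of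
the torus (`weightComp`), and restriction identifies `R` with the part of weight `0`.

The cohomology with coefficients in `Hom_ℂ(M, M)` is an algebra, so a class annihilates it as soon
as its product with the identity of `M` is a coboundary (`mem_supportIdeal_iff`). The element `h`
acts semisimply on `M` by Schur's lemma, hence on all cochains, so one may take weight components in
the equation which says that a multiple of the identity is a coboundary
(`IsWeightExtension.mem_boundaries_of_add`). Two consequences follow: the annihilator `J` in `S` is
homogeneous for the weights, and the annihilator in `R` is the preimage of `J`, because the
`L`-cochains are the `L'`-cochains of weight `0`. Note that the weights of `h` on `M` may be any
complex numbers, so the torus itself need not act on `M`.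

The rest is the theory of quotients by a torus (`exists_quotient`). The variety of `J` is stable as
`J` is homogeneous. For a maximal ideal `m ⊇ J ∩ R` the ideal `J + m S` is proper, as its component
of weight `0` is `m`, which gives a point of the variety of `J` above `m`. An invariant function on
the variety is represented by its component of weight `0`, since the eigenspaces of the torus in the
coordinate ring are independent. Contractions of maximal ideals are maximal because the residue
fields of `S`, which has countable dimension, are `ℂ`.
-/

noncomputable section

namespace SuperCoh

open SuperSpace LieSuperalgebra

/-! ### Semisimple operators -/

section Semisimple

variable {V W : Type*} [AddCommGroup V] [Module ℂ V] [AddCommGroup W] [Module ℂ W]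

/-- An operator is semisimple when the space is spanned by submodules on each of which it is a
scalar. -/
theorem isSemisimple_of_sSup_eq_top [FiniteDimensional ℂ V] {f : Module.End ℂ V}
    {s : Set (Submodule ℂ V)} (hs : sSup s = ⊤) (h : ∀ S ∈ s, ∃ μ, S ≤ f.eigenspace μ) :
    f.IsSemisimple := by
  classical
  -- The product of the `X - μ` over the distinct eigenvalues is squarefree and kills `f`.
  let q : Polynomial ℂ := ∏ μ ∈ (minpoly ℂ f).roots.toFinset, (Polynomial.X - Polynomial.C μ)
  have hq : Squarefree q := Polynomial.Separable.squarefree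
    (Polynomial.separable_prod_X_sub_C_iff'.2 fun x _ y _ hxy => hxy)
  refine Module.End.isSemisimple_of_squarefree_aeval_eq_zero hq ?_
  rw [← LinearMap.ker_eq_top, eq_top_iff, ← hs, sSup_le_iff]
  intro S hS
  obtain ⟨μ, hμ⟩ := h S hS
  refine hμ.trans fun v hv => ?_
  rw [LinearMap.mem_ker]
  by_cases hv0 : v = 0
  · rw [hv0, map_zero]
  have hev : f.HasEigenvalue μ := Module.End.hasEigenvalue_of_hasEigenvector ⟨hv, hv0⟩
  rw [Module.End.aeval_apply_of_hasEigenvector ⟨hv, hv0⟩]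
  have : q.eval μ = 0 := by
    rw [Polynomial.eval_prod]
    refine Finset.prod_eq_zero (i := μ) ?_ (by simp)
    rw [Multiset.mem_toFinset,
      Polynomial.mem_roots (minpoly.ne_zero (Algebra.IsIntegral.isIntegral f))]
    exact Module.End.isRoot_of_hasEigenvalue hev
  rw [this, zero_smul]

theorem isSemisimple_algHom [FiniteDimensional ℂ V] {f : Module.End ℂ V} (hf : f.IsSemisimple)
    (φ : Module.End ℂ V →ₐ[ℂ] Module.End ℂ W) : (φ f).IsSemisimple :=
  Module.End.isSemisimple_of_squarefree_aeval_eq_zero hf.minpoly_squarefree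
    (by rw [Polynomial.aeval_algHom_apply, minpoly.aeval, map_zero])

theorem isSemisimple_mulLeft [FiniteDimensional ℂ V] {f : Module.End ℂ V} (hf : f.IsSemisimple) :
    Module.End.IsSemisimple (LinearMap.mulLeft ℂ f) :=
  Module.End.isSemisimple_of_squarefree_aeval_eq_zero hf.minpoly_squarefree (by
    change Polynomial.aeval (Algebra.lmul ℂ (Module.End ℂ V) f) _ = 0
    rw [Polynomial.aeval_algHom_apply, minpoly.aeval, map_zero])

theorem aeval_mulRight {B : Type*} [Ring B] [Algebra ℂ B] (b : B) (q : Polynomial ℂ) :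
    Polynomial.aeval (LinearMap.mulRight ℂ b) q = LinearMap.mulRight ℂ (Polynomial.aeval b q) := by
  induction q using Polynomial.induction_on' with
  | add p q hp hq => rw [map_add, map_add, hp, hq]; ext x; simp [mul_add]
  | monomial n c =>
    ext x
    simp [Polynomial.aeval_monomial, Algebra.algebraMap_eq_smul_one]

theorem isSemisimple_mulRight [FiniteDimensional ℂ V] {f : Module.End ℂ V} (hf : f.IsSemisimple) :
    Module.End.IsSemisimple (LinearMap.mulRight ℂ f) :=
  Module.End.isSemisimple_of_squarefree_aeval_eq_zero hf.minpoly_squarefree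
    ((aeval_mulRight f _).trans (by rw [minpoly.aeval, LinearMap.mulRight_zero_eq_zero]))

theorem isSemisimple_of_mul_self {f : Module.End ℂ V} [FiniteDimensional ℂ V] (hf : f * f = 1) :
    f.IsSemisimple := by
  have hq : Squarefree (Polynomial.X ^ 2 - Polynomial.C (1 : ℂ)) :=
    (Polynomial.separable_X_pow_sub_C (1 : ℂ) (by norm_num) one_ne_zero).squarefree
  exact Module.End.isSemisimple_of_squarefree_aeval_eq_zero hq (by simp [pow_two, hf])

theorem isSemisimple_sum_of_commute [FiniteDimensional ℂ V] {ι : Type*} {f : ι → Module.End ℂ V}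
    (hf : ∀ i, (f i).IsSemisimple) (hc : ∀ i j, Commute (f i) (f j)) (s : Finset ι) :
    (∑ i ∈ s, f i).IsSemisimple := by
  classical
  induction s using Finset.induction_on with
  | empty => rw [Finset.sum_empty]; exact Module.End.isSemisimple_zero
  | insert i s hi ih =>
    rw [Finset.sum_insert hi]
    exact Module.End.IsSemisimple.add_of_commute (Commute.sum_right _ _ _ fun j _ => hc i j)
      (hf i) ih

/-- The kernel and the range of a semisimple operator are disjoint. -/
theorem apply_eq_zero_of_apply_apply {f : Module.End ℂ V} [FiniteDimensional ℂ V]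
    (hf : f.IsSemisimple) {v : V} (h : f (f v) = 0) : f v = 0 := by
  have h1 : v ∈ f.genEigenspace 0 2 := by
    have : v ∈ f.genEigenspace 0 (2 : ℕ) := by
      rw [Module.End.mem_genEigenspace_nat]
      simpa [pow_two] using h
    exact this
  rw [hf.isFinitelySemisimple.genEigenspace_eq_eigenspace 0 (by norm_num),
    Module.End.mem_eigenspace_iff, zero_smul] at h1
  exact h1

/-- The kernel and the range of a semisimple operator span the space. -/
theorem exists_ker_add_range {f : Module.End ℂ V} [FiniteDimensional ℂ V]
    (hf : f.IsSemisimple) (v : V) : ∃ a b, f a = 0 ∧ v = a + f b := by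
  have h : LinearMap.ker f ⊔ LinearMap.range f = ⊤ := by
    refine Submodule.eq_top_of_disjoint _ _ ?_ ?_
    · rw [add_comm, LinearMap.finrank_range_add_finrank_ker]
    · rw [Submodule.disjoint_def]
      rintro _ hx ⟨y, rfl⟩
      exact apply_eq_zero_of_apply_apply hf hx
  obtain ⟨a, ha, _, ⟨b, rfl⟩, hab⟩ := Submodule.mem_sup.1 (h ▸ Submodule.mem_top : v ∈ _)
  exact ⟨a, b, ha, hab.symm⟩

/-- Taking the zero weight component of a preimage: if `d` intertwines the semisimple operators
`w` and `w'` on the `w`-stable subspace `N`, and `d v = g + w' g'` with `w' g = 0`, then `g` is the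
image of a vector of `N` killed by `w`. -/
theorem exists_preimage_of_isSemisimple [FiniteDimensional ℂ V] [FiniteDimensional ℂ W]
    {w : Module.End ℂ V} {w' : Module.End ℂ W} (hw : w.IsSemisimple) (hw' : w'.IsSemisimple)
    {d : V →ₗ[ℂ] W} {N : Submodule ℂ V} (hN : ∀ v ∈ N, w v ∈ N)
    (hd : ∀ v ∈ N, d (w v) = w' (d v)) {v : V} (hv : v ∈ N) {g g' : W} (hg : w' g = 0)
    (h : d v = g + w' g') : ∃ u ∈ N, w u = 0 ∧ d u = g := by
  obtain ⟨a, b, ha, hab⟩ := exists_ker_add_range (hw.restrict (p := N) hN) ⟨v, hv⟩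
  have ha' : w a = 0 := congrArg Subtype.val ha
  have hab' : v = a + w b := congrArg Subtype.val hab
  refine ⟨a, a.2, ha', ?_⟩
  have h1 : w' (d a) = 0 := by rw [← hd a a.2, ha', map_zero]
  have h2 : w' (d b - g') = g - d a := by
    rw [map_sub, ← hd b b.2, sub_eq_sub_iff_add_eq_add, add_comm, ← map_add, ← hab', h]
  have h3 : w' (w' (d b - g')) = 0 := by rw [h2, map_sub, hg, h1, sub_zero]
  rw [apply_eq_zero_of_apply_apply hw' h3] at h2
  exact (sub_eq_zero.1 h2.symm).symm

end Semisimple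

/-! ### Derivations of spaces of multilinear maps -/

section Derivation

variable {U A : Type*} [AddCommGroup U] [Module ℂ U] [AddCommGroup A] [Module ℂ A] {p : ℕ}

/-- Applying the operator `D` to the argument of index `i` of a multilinear map. -/
def slot (A : Type*) [AddCommGroup A] [Module ℂ A] (D : Module.End ℂ U) (i : Fin p) :
    Module.End ℂ (MultilinearMap ℂ (fun _ : Fin p => U) A) :=
  MultilinearMap.compLinearMapₗ (Function.update (fun _ => LinearMap.id) i D)

theorem slot_apply (D : Module.End ℂ U) (i : Fin p)
    (φ : MultilinearMap ℂ (fun _ : Fin p => U) A) (x : Fin p → U) :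
    slot A D i φ x = φ (Function.update x i (D (x i))) := by
  refine congrArg φ (funext fun j => ?_)
  by_cases h : j = i
  · subst h; simp
  · simp [h]

/-- Applying an operator to the values of a multilinear map. -/
def post (U A : Type*) [AddCommGroup U] [Module ℂ U] [AddCommGroup A] [Module ℂ A] (p : ℕ) :
    Module.End ℂ A →ₐ[ℂ] Module.End ℂ (MultilinearMap ℂ (fun _ : Fin p => U) A) :=
  AlgHom.ofLinearMap
    { toFun := fun H => H.compMultilinearMapₗ ℂ
      map_add' := fun _ _ => by ext; simp
      map_smul' := fun _ _ => by ext; simp }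
    (by ext; simp) (fun _ _ => by ext; simp)

theorem post_apply (H : Module.End ℂ A) (φ : MultilinearMap ℂ (fun _ : Fin p => U) A)
    (x : Fin p → U) : post U A p H φ x = H (φ x) :=
  rfl

/-- The action on multilinear maps of an operator which acts by `H` on the values and by `D` on
the arguments. -/
def deriv (H : Module.End ℂ A) (D : Module.End ℂ U) (p : ℕ) :
    Module.End ℂ (MultilinearMap ℂ (fun _ : Fin p => U) A) :=
  post U A p H - ∑ i, slot A D i

theorem deriv_apply (H : Module.End ℂ A) (D : Module.End ℂ U)
    (φ : MultilinearMap ℂ (fun _ : Fin p => U) A) (x : Fin p → U) :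
    deriv H D p φ x = H (φ x) - ∑ i, φ (Function.update x i (D (x i))) := by
  simp [deriv, slot_apply, post_apply, LinearMap.sub_apply, LinearMap.sum_apply]

/-- The operator `deriv H D p` is a sum of commuting semisimple operators. -/
theorem isSemisimple_deriv [FiniteDimensional ℂ U] [FiniteDimensional ℂ A] {H : Module.End ℂ A}
    {D : Module.End ℂ U} (hH : H.IsSemisimple) (hD : D * D = 1) :
    (deriv H D p).IsSemisimple := by
  have h1 : ∀ i, (slot (p := p) A D i).IsSemisimple := fun i => by
    refine isSemisimple_of_mul_self ?_
    ext φ x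
    have h2 : D (D (x i)) = x i := LinearMap.congr_fun hD (x i)
    simp [slot_apply, h2]
  refine Module.End.IsSemisimple.sub_of_commute (Commute.sum_right _ _ _ ?_)
    (isSemisimple_algHom hH (post U A p)) (isSemisimple_sum_of_commute h1 ?_ _)
  · intro i _
    ext φ x
    simp [slot_apply, post_apply]
  · intro i j
    by_cases hij : i = j
    · rw [hij]
    ext φ x
    simp only [Module.End.mul_apply, slot_apply]
    rw [Function.update_of_ne hij, Function.update_of_ne (Ne.symm hij),
      Function.update_comm hij]

end Derivation

/-! ### Cohomology with coefficients in endomorphisms -/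

section EndCoefficients

variable {L M : Type*} [AddCommGroup L] [Module ℂ L] [LieSuperalgebra L]
    [AddCommGroup M] [Module ℂ M] [SuperSpace M]

theorem parity_mul (f g : Module.End ℂ M) :
    parity (Module.End ℂ M) (f * g) =
      parity (Module.End ℂ M) f * parity (Module.End ℂ M) g := by
  obtain ⟨a, ha, b, hb, rfl⟩ := exists_parts f
  obtain ⟨a', ha', b', hb', rfl⟩ := exists_parts g
  have h1 := mul_mem_part ha ha'
  have h2 := mul_mem_part ha hb'
  have h3 := mul_mem_part hb ha'
  have h4 := mul_mem_part hb hb'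
  rw [add_zero] at h1 h3
  rw [zero_add] at h2
  rw [show (1 + 1 : ZMod 2) = 0 from rfl] at h4
  simp only [mul_add, add_mul, map_add, parity_even ha, parity_even ha', parity_odd hb,
    parity_odd hb', parity_even h1, parity_odd h2, parity_odd h3, parity_even h4]
  noncomm_ring

theorem parity_one : parity (Module.End ℂ M) 1 = 1 :=
  parity_even fun j v hv => by rw [zero_add]; exact hv

theorem endRep_even (ρ : SuperRep L M) {y : L} (hy : y ∈ part (V := L) 0) (f : Module.End ℂ M) :
    (endRep ρ).toLin y f = ρ.toLin y * f - f * ρ.toLin y := by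
  change superCommutator M (ρ.toLin y) f = _
  simp [superCommutator, evenProj_even (ρ.map_part hy), oddProj_even (ρ.map_part hy)]

theorem endRep_odd (ρ : SuperRep L M) {x : L} (hx : x ∈ part (V := L) 1) (f : Module.End ℂ M) :
    (endRep ρ).toLin x f = ρ.toLin x * f - parity (Module.End ℂ M) f * ρ.toLin x := by
  change superCommutator M (ρ.toLin x) f = _
  obtain ⟨a, ha, b, hb, rfl⟩ := exists_parts f
  simp [superCommutator, evenProj_odd (ρ.map_part hx), oddProj_odd (ρ.map_part hx),
    evenProj_even ha, evenProj_odd hb, oddProj_even ha, oddProj_odd hb, parity_even ha,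
    parity_odd hb, sub_eq_add_neg]

/-- The product of two cochains with values in `Hom_ℂ(M, M)`, written like `cup` as a sum over
permutations. -/
def mulCup (q p : ℕ) (φ : MultilinearMap ℂ (fun _ : Fin q => OddPart L) (Module.End ℂ M))
    (ψ : MultilinearMap ℂ (fun _ : Fin p => OddPart L) (Module.End ℂ M)) :
    MultilinearMap ℂ (fun _ : Fin (q + p) => OddPart L) (Module.End ℂ M) :=
  ((q.factorial * p.factorial : ℕ) : ℂ)⁻¹ • ∑ σ : Equiv.Perm (Fin (q + p)),
    (((LinearMap.mul' ℂ (Module.End ℂ M)).compMultilinearMap (φ.domCoprod ψ)).domDomCongr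
      finSumFinEquiv).domDomCongr σ

omit [SuperSpace M] in
theorem mulCup_apply {q p : ℕ} (φ : MultilinearMap ℂ (fun _ : Fin q => OddPart L) (Module.End ℂ M))
    (ψ : MultilinearMap ℂ (fun _ : Fin p => OddPart L) (Module.End ℂ M))
    (x : Fin (q + p) → OddPart L) :
    mulCup q p φ ψ x = ((q.factorial * p.factorial : ℕ) : ℂ)⁻¹ •
      ∑ σ : Equiv.Perm (Fin (q + p)),
        φ (fun i => x (σ (Fin.castAdd p i))) * ψ (fun j => x (σ (Fin.natAdd q j))) := by
  simp [mulCup]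

omit [SuperSpace M] in
theorem mulCup_diag {q p : ℕ} (φ : MultilinearMap ℂ (fun _ : Fin q => OddPart L) (Module.End ℂ M))
    (ψ : MultilinearMap ℂ (fun _ : Fin p => OddPart L) (Module.End ℂ M)) (v : OddPart L) :
    mulCup q p φ ψ (fun _ => v) =
      (((q.factorial * p.factorial : ℕ) : ℂ)⁻¹ * (q + p).factorial) •
        (φ (fun _ => v) * ψ (fun _ => v)) := by
  rw [mulCup_apply, Finset.sum_const, Finset.card_univ, Fintype.card_perm, Fintype.card_fin,
    ← Nat.cast_smul_eq_nsmul ℂ, smul_smul]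

theorem mulCup_mem {ρ : SuperRep L M} {q p : ℕ}
    {φ : MultilinearMap ℂ (fun _ : Fin q => OddPart L) (Module.End ℂ M)}
    (hφ : φ ∈ cochain (endRep ρ) q)
    {ψ : MultilinearMap ℂ (fun _ : Fin p => OddPart L) (Module.End ℂ M)}
    (hψ : ψ ∈ cochain (endRep ρ) p) :
    mulCup q p φ ψ ∈ cochain (endRep ρ) (q + p) := by
  constructor
  · intro τ x
    rw [mulCup_apply, mulCup_apply, ← Equiv.sum_comp (Equiv.mulLeft τ) (fun σ : Equiv.Perm _ =>
      φ (fun i => x (σ (Fin.castAdd p i))) * ψ (fun j => x (σ (Fin.natAdd q j))))]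
    rfl
  · intro y hy x
    simp only [mulCup_apply, map_smul, map_sum, ← Finset.smul_sum]
    congr 1
    rw [Finset.sum_comm]
    refine Finset.sum_congr rfl fun σ _ => ?_
    have h0 : ∀ a b : Module.End ℂ M, (endRep ρ).toLin y (a * b) =
        (endRep ρ).toLin y a * b + a * (endRep ρ).toLin y b := fun a b => by
      simp only [endRep_even ρ hy]
      noncomm_ring
    rw [h0, hφ.2 y hy, hψ.2 y hy, ← Equiv.sum_comp σ, Fin.sum_univ_add, Finset.sum_mul,
      Finset.mul_sum]
    congr 1
    · refine Finset.sum_congr rfl fun i _ => ?_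
      congr 2
      · funext k
        by_cases hk : k = i
        · subst hk; simp
        · rw [Function.update_of_ne hk, Function.update_of_ne (by simpa using hk)]
      · funext k
        rw [Function.update_of_ne]
        simp only [ne_eq, EmbeddingLike.apply_eq_iff_eq]
        intro h
        have := congrArg Fin.val h
        simp at this
        omega
    · refine Finset.sum_congr rfl fun i _ => ?_
      congr 2
      · funext k
        rw [Function.update_of_ne]
        simp only [ne_eq, EmbeddingLike.apply_eq_iff_eq]
        intro h
        have := congrArg Fin.val h
        simp at this
        omega
      · funext k
        by_cases hk : k = i
        · subst hk; simp
        · rw [Function.update_of_ne hk, Function.update_of_ne (by simpa using hk)]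

/-- Multiplication by a cocycle commutes with the differential up to sign. -/
theorem d_mulCup {ρ : SuperRep L M} {q p : ℕ}
    {φ : MultilinearMap ℂ (fun _ : Fin q => OddPart L) (Module.End ℂ M)}
    (hφ : φ ∈ cocycles (endRep ρ) q)
    {ψ : MultilinearMap ℂ (fun _ : Fin p => OddPart L) (Module.End ℂ M)}
    (hψ : ψ ∈ cochain (endRep ρ) p) :
    d (endRep ρ) (q + p) (mulCup q p φ ψ) =
      (-1 : ℂ) ^ q • mulCup q (p + 1) φ (d (endRep ρ) p ψ) := by
  refine cochain_ext (ρ := endRep ρ) (d_mem _ (mulCup_mem hφ.1 hψ))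
    (Submodule.smul_mem _ _ (mulCup_mem hφ.1 (d_mem _ hψ))) fun v => ?_
  refine (d_diag _ _ v).trans (Eq.trans ?_
    (congrArg (fun m => (-1 : ℂ) ^ q • m) (mulCup_diag (p := p + 1) φ _ v)).symm)
  have hd : (endRep ρ).toLin v (parity _ (φ fun _ => v)) = 0 := by
    have h := congrArg (fun f => f fun _ => v) (LinearMap.mem_ker.1 hφ.2)
    simp only [d_diag] at h
    refine (smul_eq_zero.1 h).resolve_left (mul_ne_zero ?_ ?_)
    · exact pow_ne_zero _ (by norm_num)
    · exact_mod_cast q.succ_ne_zero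
  -- The cocycle condition says that `φ(v, …, v)` supercommutes with `v`.
  rw [endRep_odd ρ v.2, parity_parity, sub_eq_zero] at hd
  rw [mulCup_diag, d_diag]
  simp only [map_smul, endRep_odd ρ v.2, parity_mul, parity_parity, smul_smul, mul_smul_comm,
    smul_mul_assoc, ← smul_sub]
  have h0 : ρ.toLin v * (parity _ (φ fun _ => v) * parity _ (ψ fun _ => v)) -
      φ (fun _ => v) * ψ (fun _ => v) * ρ.toLin v = φ (fun _ => v) *
        (ρ.toLin v * parity _ (ψ fun _ => v) - ψ (fun _ => v) * ρ.toLin v) := by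
    rw [← mul_assoc, hd]
    noncomm_ring
  rw [h0]
  congr 1
  have h1 : ((p : ℂ) + 1) ≠ 0 := by exact_mod_cast p.succ_ne_zero
  have h2 : ((p.factorial : ℕ) : ℂ) ≠ 0 := by exact_mod_cast p.factorial_ne_zero
  have h3 : ((q.factorial : ℕ) : ℂ) ≠ 0 := by exact_mod_cast q.factorial_ne_zero
  rw [show q + (p + 1) = (q + p) + 1 from rfl, Nat.factorial_succ, Nat.factorial_succ]
  push_cast
  field_simp
  ring

theorem boundaries_le_cochain (ρ : SuperRep L M) (p : ℕ) : boundaries ρ p ≤ cochain ρ p := by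
  cases p with
  | zero => exact bot_le
  | succ p =>
    rintro _ ⟨ψ, hψ, rfl⟩
    exact d_mem ρ hψ

/-- Cochains are determined by their diagonal values, so being a coboundary may be checked across
an equality of degrees which is not definitional. -/
theorem mem_boundaries_of_diag {ρ : SuperRep L M} {p q : ℕ} (h : p = q)
    {φ : MultilinearMap ℂ (fun _ : Fin p => OddPart L) M} (hφ : φ ∈ boundaries ρ p)
    {ψ : MultilinearMap ℂ (fun _ : Fin q => OddPart L) M} (hψ : ψ ∈ cochain ρ q)
    (hd : ∀ v : OddPart L, ψ (fun _ => v) = φ (fun _ => v)) : ψ ∈ boundaries ρ q := by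
  subst h
  rwa [cochain_ext hψ (boundaries_le_cochain ρ p hφ) hd]

/-- The cohomology with coefficients in `Hom_ℂ(M, M)` is a module over its own product, so a class
which kills the identity kills everything. -/
theorem cup_mem_boundaries {ρ : SuperRep L M} {p q : ℕ}
    {f : MultilinearMap ℂ (fun _ : Fin p => OddPart L) ℂ} (hf : f ∈ cochain (trivRep L) p)
    (h : f.smulRight (1 : Module.End ℂ M) ∈ boundaries (endRep ρ) p)
    {φ : MultilinearMap ℂ (fun _ : Fin q => OddPart L) (Module.End ℂ M)}
    (hφ : φ ∈ cocycles (endRep ρ) q) : cup p q f φ ∈ boundaries (endRep ρ) (p + q) := by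
  have hdiag : ∀ v : OddPart L, cup p q f φ (fun _ => v) =
      mulCup q p φ (f.smulRight 1) (fun _ => v) := fun v => by
    rw [cup_diag, mulCup_diag, MultilinearMap.smulRight_apply, mul_smul_comm, mul_one, smul_smul,
      mul_comm p.factorial, add_comm p]
  cases p with
  | zero =>
    have h0 : f.smulRight (1 : Module.End ℂ M) = 0 := h
    have : cup 0 q f φ = 0 := cochain_ext (cup_mem hf hφ.1) (zero_mem (cochain (endRep ρ) _))
      fun v => by simp only [hdiag, h0, mulCup_diag, zero_apply, mul_zero, smul_zero]
    rw [this]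
    exact zero_mem _
  | succ p =>
    obtain ⟨ψ, hψ, h⟩ := h
    refine mem_boundaries_of_diag (add_comm q (p + 1)) (φ := mulCup q (p + 1) φ (f.smulRight 1))
      ⟨(-1 : ℂ) ^ q • mulCup q p φ ψ, Submodule.smul_mem _ _ (mulCup_mem hφ.1 hψ), ?_⟩
      (cup_mem hf hφ.1) hdiag
    rw [map_smul]
    change (-1 : ℂ) ^ q • d _ (q + p) (mulCup q p φ ψ) = _
    rw [d_mulCup hφ hψ, h, smul_smul, ← mul_pow]
    simp

theorem smulRight_one_mem (ρ : SuperRep L M) {p : ℕ}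
    {f : MultilinearMap ℂ (fun _ : Fin p => OddPart L) ℂ} (hf : f ∈ cochain (trivRep L) p) :
    f.smulRight (1 : Module.End ℂ M) ∈ cochain (endRep ρ) p := by
  refine ⟨fun σ x => by simp only [MultilinearMap.smulRight_apply, hf.1 σ x], fun y hy x => ?_⟩
  simp only [MultilinearMap.smulRight_apply, ← Finset.sum_smul, triv_even hf, zero_smul,
    endRep_even ρ hy]
  simp

/-- The invariant cochain representing a class with trivial coefficients; there are no nonzero
coboundaries. -/
def Coh.form (L : Type*) [AddCommGroup L] [Module ℂ L] [LieSuperalgebra L] (p : ℕ) :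
    Coh (trivRep L) p →ₗ[ℂ] MultilinearMap ℂ (fun _ : Fin p => OddPart L) ℂ :=
  Coh.lift (cocycles (trivRep L) p).subtype fun z hz => by
    rw [boundaries_triv] at hz
    exact hz

theorem Coh.form_mk {p : ℕ} (z : cocycles (trivRep L) p) :
    Coh.form L p (Coh.mk _ p z) = z.1 :=
  rfl

theorem Coh.form_injective (p : ℕ) : Function.Injective (Coh.form L p) := by
  intro a b h
  obtain ⟨z, rfl⟩ := Coh.mk_surjective _ _ a
  obtain ⟨w, rfl⟩ := Coh.mk_surjective _ _ b
  exact congrArg _ (Subtype.ext h)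

theorem Coh.form_mem {p : ℕ} (a : Coh (trivRep L) p) : Coh.form L p a ∈ cochain (trivRep L) p := by
  obtain ⟨z, rfl⟩ := Coh.mk_surjective _ _ a
  exact z.2.1

/-- The class of an invariant form. -/
def Coh.ofForm {p : ℕ} (f : MultilinearMap ℂ (fun _ : Fin p => OddPart L) ℂ)
    (hf : f ∈ cochain (trivRep L) p) : Coh (trivRep L) p :=
  Coh.mk _ p ⟨f, mem_cocycles_triv.2 hf⟩

theorem Coh.form_ofForm {p : ℕ} {f : MultilinearMap ℂ (fun _ : Fin p => OddPart L) ℂ}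
    (hf : f ∈ cochain (trivRep L) p) : Coh.form L p (Coh.ofForm f hf) = f :=
  rfl

/-- The identity of `M`, as a cocycle of degree `0`. -/
def idCocycle (ρ : SuperRep L M) : cocycles (endRep ρ) 0 :=
  ⟨MultilinearMap.constOfIsEmpty ℂ _ 1, ⟨fun σ x => rfl, fun y hy x => by
    simp [endRep_even ρ hy]⟩, by
    change d (endRep ρ) 0 _ = 0
    ext1 x
    rw [d_apply]
    simp [endRep_odd ρ (x 0).2, parity_one]⟩

theorem of_smul_of (ρ : SuperRep L M) {p q : ℕ} (a : Coh (trivRep L) p) (b : Coh ρ q) :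
    (DirectSum.of (Coh (trivRep L)) p a • DirectSum.of (Coh ρ) q b : CohModule ρ) =
      DirectSum.of (Coh ρ) (p + q) (cohMul ρ p q a b) :=
  DirectSum.Gmodule.of_smul_of _ _ _ _

theorem smul_of_zero_apply (ρ : SuperRep L M) (a : CohRing L) (b : Coh ρ 0) (p : ℕ) :
    (a • DirectSum.of (Coh ρ) 0 b : CohModule ρ) p = cohMul ρ p 0 (a p) b := by
  induction a using DirectSum.induction_on with
  | zero => simp
  | add x y hx hy => rw [add_smul, DirectSum.add_apply, hx, hy, DirectSum.add_apply, map_add]; rfl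
  | of i x =>
    rw [of_smul_of]
    by_cases h : i = p
    · subst h
      rw [DirectSum.of_eq_same]
      exact DirectSum.of_eq_same _ _
    · rw [DirectSum.of_eq_of_ne _ _ _ (Ne.symm h), map_zero]
      exact DirectSum.of_eq_of_ne _ _ _ (Ne.symm h)

/-- A class annihilates the cohomology with coefficients in `Hom_ℂ(M, M)` when each of its
homogeneous components kills the identity of `M`. -/
theorem mem_supportIdeal_iff (ρ : SuperRep L M) (a : CohRing L) : a ∈ supportIdeal ρ ↔
    ∀ p, (Coh.form L p (a p)).smulRight (1 : Module.End ℂ M) ∈ boundaries (endRep ρ) p := by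
  rw [supportIdeal, Module.mem_annihilator]
  constructor
  · intro h p
    have h1 := congrArg (fun z => z p)
      (h (DirectSum.of (Coh (endRep ρ)) 0 (Coh.mk _ 0 (idCocycle ρ))))
    simp only [smul_of_zero_apply] at h1
    obtain ⟨f, hf⟩ := Coh.mk_surjective _ _ (a p)
    rw [← hf, Coh.form_mk]
    rw [← hf, cohMul_mk] at h1
    have h2 : cup p 0 f.1 (idCocycle ρ).1 ∈ boundaries (endRep ρ) p := Coh.mk_eq_zero.1 h1
    have h3 : cup p 0 f.1 (idCocycle ρ).1 = f.1.smulRight 1 := by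
      refine cochain_ext (ρ := endRep ρ) (cup_mem f.2.1 (idCocycle ρ).2.1)
        (smulRight_one_mem ρ f.2.1) fun v => ?_
      have h4 : ((p.factorial : ℕ) : ℂ) ≠ 0 := by exact_mod_cast p.factorial_ne_zero
      refine (cup_diag _ _ v).trans ?_
      simp [idCocycle, h4]
    rwa [h3] at h2
  · intro h m
    classical
    induction m using DirectSum.induction_on with
    | zero => exact smul_zero _
    | add x y hx hy => rw [smul_add, hx, hy, add_zero]
    | of q b =>
      obtain ⟨φ, rfl⟩ := Coh.mk_surjective _ _ b
      rw [← DirectSum.sum_support_of a, Finset.sum_smul]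
      refine Finset.sum_eq_zero fun p _ => ?_
      have hp := h p
      obtain ⟨f, hf⟩ := Coh.mk_surjective _ _ (a p)
      rw [← hf] at hp ⊢
      rw [of_smul_of, cohMul_mk, Coh.mk_eq_zero.2, map_zero]
      exact cup_mem_boundaries f.2.1 hp φ.2

end EndCoefficients

/-! ### Weights of multilinear forms under an involution -/

section Weights

variable {U : Type*} [AddCommGroup U] [Module ℂ U] {p : ℕ}

/-- The projection onto the eigenspace of an involution `D` for the eigenvalue `1`. -/
def posProj (D : Module.End ℂ U) : Module.End ℂ U := (2⁻¹ : ℂ) • (1 + D)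

/-- The projection onto the eigenspace of an involution `D` for the eigenvalue `-1`. -/
def negProj (D : Module.End ℂ U) : Module.End ℂ U := (2⁻¹ : ℂ) • (1 - D)

theorem posProj_add_negProj (D : Module.End ℂ U) : posProj D + negProj D = 1 := by
  rw [posProj, negProj, ← smul_add, add_add_sub_cancel, ← two_smul ℂ (1 : Module.End ℂ U),
    smul_smul]
  norm_num

variable {D : Module.End ℂ U}

theorem posProj_of_eq {v : U} (h : D v = v) : posProj D v = v := by
  simp only [posProj, LinearMap.smul_apply, LinearMap.add_apply, Module.End.one_apply, h,
    ← two_smul ℂ v, smul_smul]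
  norm_num

theorem posProj_of_eq_neg {v : U} (h : D v = -v) : posProj D v = 0 := by
  simp [posProj, h]

theorem negProj_of_eq {v : U} (h : D v = v) : negProj D v = 0 := by
  simp [negProj, h]

theorem negProj_of_eq_neg {v : U} (h : D v = -v) : negProj D v = v := by
  simp only [negProj, LinearMap.smul_apply, LinearMap.sub_apply, Module.End.one_apply, h,
    sub_neg_eq_add, ← two_smul ℂ v, smul_smul]
  norm_num


theorem apply_posProj (hD : D * D = 1) (v : U) : D (posProj D v) = posProj D v := by
  have h : D (D v) = v := LinearMap.congr_fun hD v
  simp [posProj, h, add_comm]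

theorem apply_negProj (hD : D * D = 1) (v : U) : D (negProj D v) = -negProj D v := by
  have h : D (D v) = v := LinearMap.congr_fun hD v
  simp [negProj, h, ← smul_neg]

theorem posProj_apply (hD : D * D = 1) (v : U) : posProj D (D v) = posProj D v := by
  have h : D (D v) = v := LinearMap.congr_fun hD v
  simp [posProj, h, add_comm]

theorem negProj_apply (hD : D * D = 1) (v : U) : negProj D (D v) = -negProj D v := by
  have h : D (D v) = v := LinearMap.congr_fun hD v
  simp [negProj, h, ← smul_neg]

/-- The component of the form `F` of degree `k` in the arguments of eigenvalue `1` and of degree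
`p - k` in the arguments of eigenvalue `-1` of the involution `D`. -/
def weightComp (D : Module.End ℂ U) (k : ℕ) (F : MultilinearMap ℂ (fun _ : Fin p => U) ℂ) :
    MultilinearMap ℂ (fun _ : Fin p => U) ℂ :=
  ∑ s ∈ Finset.powersetCard k (Finset.univ : Finset (Fin p)),
    F.compLinearMap fun i => if i ∈ s then posProj D else negProj D

theorem weightComp_apply (D : Module.End ℂ U) (k : ℕ)
    (F : MultilinearMap ℂ (fun _ : Fin p => U) ℂ) (x : Fin p → U) :
    weightComp D k F x = ∑ s ∈ Finset.powersetCard k (Finset.univ : Finset (Fin p)),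
      F fun i => if i ∈ s then posProj D (x i) else negProj D (x i) := by
  rw [weightComp, sum_apply]
  refine Finset.sum_congr rfl fun s _ => congrArg F (funext fun i => ?_)
  dsimp only
  split_ifs <;> rfl

theorem sum_weightComp (D : Module.End ℂ U) (F : MultilinearMap ℂ (fun _ : Fin p => U) ℂ) :
    ∑ k ∈ Finset.range (p + 1), weightComp D k F = F := by
  classical
  ext x
  rw [sum_apply]
  simp only [weightComp_apply]
  have h := Finset.sum_powerset (Finset.univ : Finset (Fin p)) fun s =>
    F fun i => if i ∈ s then posProj D (x i) else negProj D (x i)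
  rw [Finset.card_univ, Fintype.card_fin] at h
  rw [← h, Finset.powerset_univ]
  have h1 := F.map_add_univ (fun i => posProj D (x i)) (fun i => negProj D (x i))
  have h2 : (fun i => posProj D (x i)) + (fun i => negProj D (x i)) = x := funext fun i =>
    LinearMap.congr_fun (posProj_add_negProj D) (x i)
  rw [h2] at h1
  rw [h1]
  rfl

theorem weightComp_symm (D : Module.End ℂ U) (k : ℕ)
    {F : MultilinearMap ℂ (fun _ : Fin p => U) ℂ}
    (hF : ∀ (σ : Equiv.Perm (Fin p)) (x : Fin p → U), F (x ∘ σ) = F x)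
    (σ : Equiv.Perm (Fin p)) (x : Fin p → U) :
    weightComp D k F (x ∘ σ) = weightComp D k F x := by
  rw [weightComp_apply, weightComp_apply]
  refine Finset.sum_equiv (Equiv.finsetCongr σ) (fun s => ?_) fun s _ => ?_
  · simp [Finset.mem_powersetCard]
  · refine Eq.trans ?_ (hF σ _)
    refine congrArg F (funext fun i => ?_)
    simp

/-- Scaling the two eigenspaces of `D` scales the components of a form. -/
theorem weightComp_scale (D : Module.End ℂ U) (k : ℕ) (hD : D * D = 1)
    (F : MultilinearMap ℂ (fun _ : Fin p => U) ℂ) (a : ℂˣ) (x : Fin p → U) :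
    weightComp D k F (fun i => (a : ℂ) • posProj D (x i) + ((a⁻¹ : ℂˣ) : ℂ) • negProj D (x i)) =
      ((a ^ (2 * (k : ℤ) - p) : ℂˣ) : ℂ) • weightComp D k F x := by
  rw [weightComp_apply, weightComp_apply, Finset.smul_sum]
  refine Finset.sum_congr rfl fun s hs => ?_
  have hs' : s.card = k := (Finset.mem_powersetCard.1 hs).2
  have hPP := fun v => posProj_of_eq (apply_posProj hD v)
  have hPN := fun v => posProj_of_eq_neg (apply_negProj hD v)
  have hNP := fun v => negProj_of_eq (apply_posProj hD v)
  have hNN := fun v => negProj_of_eq_neg (apply_negProj hD v)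
  have h := F.map_smul_univ (fun i => if i ∈ s then (a : ℂ) else ((a⁻¹ : ℂˣ) : ℂ))
    (fun i => if i ∈ s then posProj D (x i) else negProj D (x i))
  have h2 : (∏ i, if i ∈ s then (a : ℂ) else ((a⁻¹ : ℂˣ) : ℂ)) =
      ((a ^ (2 * (k : ℤ) - p) : ℂˣ) : ℂ) := by
    rw [Finset.prod_ite, Finset.prod_const, Finset.prod_const, Finset.filter_mem_eq_inter,
      Finset.univ_inter, Finset.filter_not, Finset.filter_mem_eq_inter, Finset.univ_inter,
      Finset.card_sdiff_of_subset (Finset.subset_univ _), Finset.card_univ, Fintype.card_fin, hs']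
    have hkp : k ≤ p := by
      rw [← hs']
      simpa using Finset.card_le_univ s
    have h3 : 2 * (k : ℤ) - p = k + -((p - k : ℕ) : ℤ) := by
      push_cast [hkp]
      ring
    rw [h3, zpow_add, zpow_neg, zpow_natCast, zpow_natCast, ← inv_pow]
    push_cast
    rfl
  rw [h2] at h
  rw [← h]
  refine congrArg F (funext fun i => ?_)
  split_ifs with hi <;> simp [hPP, hPN, hNP, hNN]

/-- The components of a form are eigenvectors for the derivation induced by `D`; the sign comes from
the action on arguments rather than on values. -/
theorem deriv_weightComp (D : Module.End ℂ U) (k : ℕ) (hD : D * D = 1)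
    (F : MultilinearMap ℂ (fun _ : Fin p => U) ℂ) :
    deriv 0 D p (weightComp D k F) = ((p : ℂ) - 2 * k) • weightComp D k F := by
  ext x
  simp only [deriv_apply, LinearMap.zero_apply, zero_sub, weightComp_apply, smul_apply]
  rw [Finset.sum_comm, ← Finset.sum_neg_distrib, Finset.smul_sum]
  refine Finset.sum_congr rfl fun s hs => ?_
  have hs' : s.card = k := (Finset.mem_powersetCard.1 hs).2
  have h1 : ∀ i : Fin p, (F fun j => if j ∈ s then posProj D (Function.update x i (D (x i)) j)
      else negProj D (Function.update x i (D (x i)) j)) = (if i ∈ s then (1 : ℂ) else -1) •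
        F fun j => if j ∈ s then posProj D (x j) else negProj D (x j) := fun i => by
    have h2 : (fun j => if j ∈ s then posProj D (Function.update x i (D (x i)) j)
        else negProj D (Function.update x i (D (x i)) j)) =
        Function.update (fun j => if j ∈ s then posProj D (x j) else negProj D (x j)) i
          ((if i ∈ s then (1 : ℂ) else -1) •
            if i ∈ s then posProj D (x i) else negProj D (x i)) := funext fun j => by
      by_cases hj : j = i
      · subst hj
        simp only [Function.update_self]
        split_ifs
        · rw [posProj_apply hD, one_smul]
        · rw [negProj_apply hD, neg_one_smul]
      · simp [hj]
    rw [h2, F.map_update_smul, Function.update_eq_self]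
  have h3 : ∑ i, (if i ∈ s then (1 : ℂ) else -1) = 2 * k - p := by
    have h4 : ∀ i, (if i ∈ s then (1 : ℂ) else -1) = 2 * (if i ∈ s then 1 else 0) - 1 :=
      fun i => by split_ifs <;> norm_num
    simp only [h4, Finset.sum_sub_distrib, ← Finset.mul_sum]
    simp [hs']
  simp only [h1, ← Finset.sum_smul, h3, ← neg_smul, neg_sub]

theorem weightComp_deriv (D : Module.End ℂ U) (k : ℕ)
    (F : MultilinearMap ℂ (fun _ : Fin p => U) ℂ) :
    deriv 0 D p (weightComp D k F) = weightComp D k (deriv 0 D p F) := by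
  ext x
  simp only [deriv_apply, LinearMap.zero_apply, zero_sub, weightComp_apply]
  rw [Finset.sum_comm, ← Finset.sum_neg_distrib]
  refine Finset.sum_congr rfl fun s hs => ?_
  congr 1
  refine Finset.sum_congr rfl fun i _ => congrArg F (funext fun j => ?_)
  by_cases hj : j = i
  · subst hj
    simp only [Function.update_self]
    split_ifs
    · simp [posProj]
    · simp [negProj]
  · simp [hj]

theorem weightComp_zero (D : Module.End ℂ U) (k : ℕ) :
    weightComp D k (0 : MultilinearMap ℂ (fun _ : Fin p => U) ℂ) = 0 := by
  ext x
  simp [weightComp_apply]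

end Weights

/-! ### Extensions by an even element with odd weights `±1` -/

section Extension

variable {L L' : Type*} [AddCommGroup L] [Module ℂ L] [LieSuperalgebra L]
    [AddCommGroup L'] [Module ℂ L'] [LieSuperalgebra L']

/-- The homomorphism `α : L' → L` identifies the odd parts of `L'` and `L`, the even part of `L'`
acts trivially on the odd part, and the even part of `L` is spanned by the image of the even part
of `L'` and by an element `h` which centralizes it and acts on the odd part with square `1`. -/
structure IsWeightExtension (α : LieSuperHom L' L) (h : L) : Prop where
  mem : h ∈ part (V := L) 0
  odd_bijective : Function.Bijective α.odd
  bracket_even : ∀ y ∈ part (V := L) 0, bracket h y = 0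
  bracket_odd : ∀ y ∈ part (V := L') 0, ∀ x ∈ part (V := L') 1, bracket y x = 0
  exists_even : ∀ y ∈ part (V := L) 0, ∃ y' ∈ part (V := L') 0, ∃ c : ℂ, y = α.toLin y' + c • h
  bracket_bracket : ∀ x ∈ part (V := L) 1, bracket h (bracket h x) = x

variable {α : LieSuperHom L' L} {h : L} (E : IsWeightExtension α h)
include E

/-- The action of `h` on the odd part. -/
abbrev IsWeightExtension.ad : Module.End ℂ (OddPart L) := adOdd h E.mem

theorem IsWeightExtension.ad_mul_ad : E.ad * E.ad = 1 :=
  LinearMap.ext fun x => Subtype.ext (E.bracket_bracket x x.2)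

theorem IsWeightExtension.exists_lift {p : ℕ} (x : Fin p → OddPart L) :
    ∃ x' : Fin p → OddPart L', (fun i => α.odd (x' i)) = x :=
  ⟨fun i => (E.odd_bijective.2 (x i)).choose,
    funext fun i => (E.odd_bijective.2 (x i)).choose_spec⟩

theorem IsWeightExtension.adOdd_eq_zero {y : L'} (hy : y ∈ part (V := L') 0) :
    adOdd y hy = 0 :=
  LinearMap.ext fun x => Subtype.ext (E.bracket_odd y hy x x.2)

theorem IsWeightExtension.adOdd_image_eq_zero {y : L'} (hy : y ∈ part (V := L') 0) :
    adOdd (α.toLin y) (α.map_part hy) = 0 := by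
  refine LinearMap.ext fun x => Subtype.ext ?_
  obtain ⟨x', rfl⟩ := E.odd_bijective.2 x
  change bracket (α.toLin y) (α.toLin x') = 0
  rw [← α.map_bracket, E.bracket_odd y hy x' x'.2, map_zero]

variable {A : Type*} [AddCommGroup A] [Module ℂ A]

theorem IsWeightExtension.pull_injective (p : ℕ) : Function.Injective (pull α A p) := by
  intro φ ψ hφ
  ext x
  obtain ⟨x', rfl⟩ := E.exists_lift x
  exact congrArg (fun f => f x') hφ

theorem IsWeightExtension.exists_pull {p : ℕ}
    (φ : MultilinearMap ℂ (fun _ : Fin p => OddPart L') A) :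
    ∃ ψ, pull α A p ψ = φ := by
  let e := LinearEquiv.ofBijective α.odd E.odd_bijective
  refine ⟨φ.compLinearMap fun _ => e.symm.toLinearMap, ?_⟩
  ext x
  exact congrArg φ (funext fun i => e.symm_apply_apply (x i))

variable [SuperSpace A]

/-- The `L'`-cochains, seen on the odd part of `L`. The even part of `L'` acts trivially on the
arguments, so only its action on the values matters. -/
theorem IsWeightExtension.pull_mem_cochain_iff {ρ : SuperRep L A} {ρ' : SuperRep L' A}
    (hρ : ∀ x, ρ'.toLin x = ρ.toLin (α.toLin x)) {p : ℕ}
    {φ : MultilinearMap ℂ (fun _ : Fin p => OddPart L) A} :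
    pull α A p φ ∈ cochain ρ' p ↔
      (∀ (σ : Equiv.Perm (Fin p)) (x : Fin p → OddPart L), φ (x ∘ σ) = φ x) ∧
        ∀ y ∈ part (V := L') 0, ∀ x, ρ.toLin (α.toLin y) (φ x) = 0 := by
  constructor
  · rintro ⟨h1, h2⟩
    constructor
    · intro σ x
      obtain ⟨x', rfl⟩ := E.exists_lift x
      exact h1 σ x'
    · intro y hy x
      obtain ⟨x', rfl⟩ := E.exists_lift x
      rw [← hρ]
      refine (h2 y hy x').trans (Finset.sum_eq_zero fun i _ => ?_)
      rw [E.adOdd_eq_zero hy]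
      exact MultilinearMap.map_update_zero _ _ _
  · rintro ⟨h1, h2⟩
    refine ⟨fun σ x => h1 σ fun i => α.odd (x i), fun y hy x => ?_⟩
    rw [hρ, pull_apply, h2 y hy]
    refine (Finset.sum_eq_zero fun i _ => ?_).symm
    rw [E.adOdd_eq_zero hy]
    exact MultilinearMap.map_update_zero _ _ _

theorem IsWeightExtension.pull_triv_mem_iff {p : ℕ}
    {F : MultilinearMap ℂ (fun _ : Fin p => OddPart L) ℂ} :
    pull α ℂ p F ∈ cochain (trivRep L') p ↔
      ∀ (σ : Equiv.Perm (Fin p)) (x : Fin p → OddPart L), F (x ∘ σ) = F x := by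
  rw [E.pull_mem_cochain_iff (triv_comp α)]
  exact and_iff_left fun y _ x => rfl

/-- An `L'`-invariant cochain is `L`-invariant when it has weight `0` for `h`. -/
theorem IsWeightExtension.mem_cochain {ρ : SuperRep L A} {ρ' : SuperRep L' A}
    (hρ : ∀ x, ρ'.toLin x = ρ.toLin (α.toLin x)) {p : ℕ}
    {φ : MultilinearMap ℂ (fun _ : Fin p => OddPart L) A} (hφ : pull α A p φ ∈ cochain ρ' p)
    (h0 : deriv (ρ.toLin h) E.ad p φ = 0) : φ ∈ cochain ρ p := by
  obtain ⟨h1, h2⟩ := (E.pull_mem_cochain_iff hρ).1 hφ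
  refine ⟨h1, fun y hy x => ?_⟩
  obtain ⟨y', hy', c, rfl⟩ := E.exists_even y hy
  have h3 : adOdd (α.toLin y' + c • h) hy = c • E.ad := by
    have h4 := E.adOdd_image_eq_zero hy'
    refine LinearMap.ext fun x => Subtype.ext ?_
    have h5 : bracket (α.toLin y') (x : L) = 0 :=
      congrArg Subtype.val (LinearMap.congr_fun h4 x)
    change bracket (α.toLin y' + c • h) (x : L) = c • bracket h (x : L)
    rw [map_add, LinearMap.add_apply, h5, zero_add, map_smul, LinearMap.smul_apply]
  have h6 := congrArg (fun f => f x) h0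
  simp only [deriv_apply, zero_apply, sub_eq_zero] at h6
  rw [map_add, LinearMap.add_apply, h2 y' hy', zero_add, map_smul, LinearMap.smul_apply, h6, h3,
    Finset.smul_sum]
  refine Finset.sum_congr rfl fun i _ => ?_
  rw [LinearMap.smul_apply, φ.map_update_smul]

theorem IsWeightExtension.deriv_eq_zero {ρ : SuperRep L A} {p : ℕ}
    {φ : MultilinearMap ℂ (fun _ : Fin p => OddPart L) A} (hφ : φ ∈ cochain ρ p) :
    deriv (ρ.toLin h) E.ad p φ = 0 := by
  ext x
  rw [deriv_apply, hφ.2 h E.mem, sub_self]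
  rfl

/-- The differential commutes with the action of `h`. -/
theorem IsWeightExtension.d_deriv (ρ : SuperRep L A) (k : ℂ) {p : ℕ}
    (φ : MultilinearMap ℂ (fun _ : Fin p => OddPart L) A) :
    d ρ p (deriv (ρ.toLin h - k • 1) E.ad p φ) =
      deriv (ρ.toLin h - k • 1) E.ad (p + 1) (d ρ p φ) := by
  ext x
  simp only [d_apply, deriv_apply, map_sub, map_smul, map_sum, ← Finset.smul_sum, ← smul_sub,
    LinearMap.sub_apply, LinearMap.smul_apply, Module.End.one_apply]
  congr 1
  rw [Finset.sum_comm (s := (Finset.univ : Finset (Fin (p + 1)))), ← Finset.sum_sub_distrib]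
  refine Finset.sum_congr rfl fun i _ => ?_
  rw [Fin.sum_univ_succAbove _ i, even_odd_act ρ E.mem (x i).2, even_parity ρ E.mem]
  simp only [Function.update_self, Fin.removeNth_update]
  have h1 : ∀ j : Fin p, i.removeNth (Function.update x (i.succAbove j)
      (E.ad (x (i.succAbove j)))) = Function.update (i.removeNth x) j (E.ad (i.removeNth x j)) := by
    intro j
    funext k
    by_cases hk : k = j
    · subst hk; simp [Fin.removeNth]
    · rw [Function.update_of_ne hk]
      simp [Fin.removeNth, hk]
  have h2 : ((E.ad (x i) : OddPart L) : L) = bracket h (x i : L) := rfl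
  simp only [h1, h2, Function.update_of_ne (Fin.succAbove_ne i _).symm]
  abel

theorem IsWeightExtension.deriv_mem {ρ : SuperRep L A} {ρ' : SuperRep L' A}
    (hρ : ∀ x, ρ'.toLin x = ρ.toLin (α.toLin x)) (k : ℂ) {p : ℕ}
    {φ : MultilinearMap ℂ (fun _ : Fin p => OddPart L) A} (hφ : pull α A p φ ∈ cochain ρ' p) :
    pull α A p (deriv (ρ.toLin h - k • 1) E.ad p φ) ∈ cochain ρ' p := by
  rw [E.pull_mem_cochain_iff hρ] at hφ ⊢
  obtain ⟨h1, h2⟩ := hφ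
  constructor
  · intro σ x
    rw [deriv_apply, deriv_apply, h1, ← Equiv.sum_comp σ fun i =>
      φ (Function.update x i (E.ad (x i)))]
    congr 1
    refine Finset.sum_congr rfl fun i _ => ?_
    rw [← h1 σ (Function.update x _ _), Function.update_comp_equiv]
    simp
  · intro y hy x
    have hc : ρ.toLin (α.toLin y) (ρ.toLin h (φ x)) = 0 := by
      have h3 := ρ.map_bracket h (α.toLin y)
      rw [E.bracket_even _ (α.map_part hy), map_zero,
        bracket_end (ρ.map_part E.mem) (ρ.map_part (α.map_part hy)), sgn_zero_left, one_smul] at h3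
      have h4 := LinearMap.congr_fun (sub_eq_zero.1 h3.symm) (φ x)
      rw [Module.End.mul_apply, Module.End.mul_apply, h2 y hy, map_zero] at h4
      exact h4.symm
    simp [deriv_apply, h2 y hy, hc]

/-- Taking components of weight `k` in the equation that a cochain is a coboundary. -/
theorem IsWeightExtension.mem_boundaries_of_add [FiniteDimensional ℂ (OddPart L)]
    [FiniteDimensional ℂ A] {ρ : SuperRep L A} {ρ' : SuperRep L' A}
    (hρ : ∀ x, ρ'.toLin x = ρ.toLin (α.toLin x)) (hss : (ρ.toLin h).IsSemisimple) (k : ℂ) {p : ℕ}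
    {g g' : MultilinearMap ℂ (fun _ : Fin p => OddPart L) A}
    (hg : deriv (ρ.toLin h - k • 1) E.ad p g = 0)
    (hb : pull α A p (g + deriv (ρ.toLin h - k • 1) E.ad p g') ∈ boundaries ρ' p) :
    pull α A p g ∈ boundaries ρ' p ∧ (k = 0 → g ∈ boundaries ρ p) := by
  -- Shifting the action of `h` on the values by `k` makes weight `k` the kernel.
  have hss' : (ρ.toLin h - k • 1).IsSemisimple := by
    rw [← Algebra.algebraMap_eq_smul_one]
    exact Module.End.isSemisimple_sub_algebraMap_iff.2 hss
  cases p with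
  | zero =>
    have h1 : g + deriv (ρ.toLin h - k • 1) E.ad 0 g' = 0 :=
      E.pull_injective 0 (Eq.trans hb (map_zero _).symm)
    have h2 := congrArg (deriv (ρ.toLin h - k • 1) E.ad 0) h1
    rw [map_add, hg, zero_add, map_zero] at h2
    rw [apply_eq_zero_of_apply_apply (isSemisimple_deriv hss' E.ad_mul_ad) h2, add_zero] at h1
    rw [h1, map_zero]
    exact ⟨zero_mem _, fun _ => zero_mem _⟩
  | succ p =>
    obtain ⟨ψ', hψ', hd⟩ := hb
    obtain ⟨ψ, rfl⟩ := E.exists_pull ψ'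
    rw [d_pull α hρ] at hd
    obtain ⟨u, hu, hu0, hdu⟩ := exists_preimage_of_isSemisimple
      (isSemisimple_deriv (p := p) hss' E.ad_mul_ad)
      (isSemisimple_deriv (p := p + 1) hss' E.ad_mul_ad) (d := d ρ p)
      (N := (cochain ρ' p).comap (pull α A p)) (fun φ hφ => E.deriv_mem hρ k hφ)
      (fun φ _ => E.d_deriv ρ k φ) hψ' hg (E.pull_injective _ hd)
    refine ⟨⟨pull α A p u, hu, by rw [d_pull α hρ, hdu]⟩, ?_⟩
    rintro rfl
    rw [zero_smul, sub_zero] at hu0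
    exact ⟨u, E.mem_cochain hρ hu hu0, hdu⟩

end Extension

/-! ### Weights of the cohomology ring -/

section WeightSpace

variable {A G : Type*} [CommRing A] [Algebra ℂ A] [Group G]

/-- The elements on which a group acts through the power `χ ^ j` of the character `χ`, given as a
function; its multiplicativity plays no role. -/
def weightSpace (τ : G →* (A →ₐ[ℂ] A)) (χ : G → ℂˣ) (j : ℤ) : Submodule ℂ A where
  carrier := {a | ∀ g, τ g a = ((χ g ^ j : ℂˣ) : ℂ) • a}
  zero_mem' := fun g => by simp
  add_mem' := fun ha hb g => by rw [map_add, ha g, hb g, smul_add]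
  smul_mem' := fun c a ha g => by rw [map_smul, ha g, smul_comm]

end WeightSpace

section CohRing

variable {L L' : Type*} [AddCommGroup L] [Module ℂ L] [LieSuperalgebra L]
    [AddCommGroup L'] [Module ℂ L'] [LieSuperalgebra L']

theorem resRing_apply (α : LieSuperHom L' L) (a : CohRing L) (p : ℕ) :
    resRing α a p = resCoh α (triv_comp α) p (a p) := by
  induction a using DirectSum.induction_on with
  | zero => rw [map_zero, DirectSum.zero_apply, DirectSum.zero_apply, map_zero]
  | add x y hx hy => rw [map_add, DirectSum.add_apply, hx, hy, DirectSum.add_apply, map_add]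
  | of i x =>
    rw [resRing_of]
    by_cases h : i = p
    · subst h
      rw [DirectSum.of_eq_same, DirectSum.of_eq_same]
    · rw [DirectSum.of_eq_of_ne _ _ _ (Ne.symm h), DirectSum.of_eq_of_ne _ _ _ (Ne.symm h),
        map_zero]

theorem form_resCoh (α : LieSuperHom L' L) {p : ℕ} (a : Coh (trivRep L) p) :
    Coh.form L' p (resCoh α (triv_comp α) p a) = pull α ℂ p (Coh.form L p a) := by
  obtain ⟨f, rfl⟩ := Coh.mk_surjective _ _ a
  rfl

theorem cohRing_ext {a b : CohRing L} (h : ∀ p, Coh.form L p (a p) = Coh.form L p (b p)) :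
    a = b :=
  DFinsupp.ext fun p => Coh.form_injective p (h p)

variable {α : LieSuperHom L' L} {h : L}

theorem IsWeightExtension.resRing_injective (E : IsWeightExtension α h) :
    Function.Injective (resRing α) := by
  intro a b hab
  refine cohRing_ext fun p => E.pull_injective p ?_
  rw [← form_resCoh, ← form_resCoh, ← resRing_apply, ← resRing_apply, hab]

variable {G : Type*} [Group G]

/-- The group `G` acts on the cohomology ring of `L'` through automorphisms of `L'` which act on
the eigenspaces of `h` in the odd part, for the eigenvalues `1` and `-1`, by a surjective
character `χ` and by its inverse. -/
structure IsWeightTorus (α : LieSuperHom L' L) (h : L)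
    (τ : G →* (CohRing L' →ₐ[ℂ] CohRing L')) (χ : G → ℂˣ) : Prop where
  surjective : Function.Surjective χ
  exists_hom : ∀ g, ∃ θ : LieSuperHom L' L', τ g = resRing θ ∧
    (∀ x ∈ part (V := L') 1, bracket h (α.toLin x) = α.toLin x →
      θ.toLin x = (χ g : ℂ) • x) ∧
    (∀ x ∈ part (V := L') 1, bracket h (α.toLin x) = -α.toLin x →
      θ.toLin x = ((χ g)⁻¹ : ℂˣ).1 • x)

variable {τ : G →* (CohRing L' →ₐ[ℂ] CohRing L')} {χ : G → ℂˣ}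

theorem IsWeightTorus.form_apply (T : IsWeightTorus α h τ χ) (E : IsWeightExtension α h) (g : G)
    (a : CohRing L') {p : ℕ} {F : MultilinearMap ℂ (fun _ : Fin p => OddPart L) ℂ}
    (hF : pull α ℂ p F = Coh.form L' p (a p)) (x : Fin p → OddPart L') :
    Coh.form L' p (τ g a p) x = F fun i => (χ g : ℂ) • posProj E.ad (α.odd (x i)) +
      ((χ g)⁻¹ : ℂˣ).1 • negProj E.ad (α.odd (x i)) := by
  obtain ⟨θ, hθ, h1, h2⟩ := T.exists_hom g
  rw [hθ, resRing_apply, form_resCoh, ← hF, pull_apply, pull_apply]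
  refine congrArg F (funext fun i => ?_)
  obtain ⟨u, hu⟩ := E.odd_bijective.2 (posProj E.ad (α.odd (x i)))
  obtain ⟨v, hv⟩ := E.odd_bijective.2 (negProj E.ad (α.odd (x i)))
  have hx : x i = u + v := E.odd_bijective.1 (by
    rw [map_add, hu, hv]
    exact (LinearMap.congr_fun (posProj_add_negProj E.ad) _).symm)
  have hu' : θ.odd u = (χ g : ℂ) • u := by
    refine Subtype.ext (h1 u u.2 ?_)
    have := apply_posProj E.ad_mul_ad (α.odd (x i))
    rw [← hu] at this
    exact congrArg Subtype.val this
  have hv' : θ.odd v = ((χ g)⁻¹ : ℂˣ).1 • v := by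
    refine Subtype.ext (h2 v v.2 ?_)
    have := apply_negProj E.ad_mul_ad (α.odd (x i))
    rw [← hv] at this
    exact congrArg Subtype.val this
  rw [← hu, ← hv, hx, map_add, map_add, hu', hv', map_smul, map_smul]

/-- The homogeneous class given by a weight component of a form. -/
def IsWeightExtension.compClass (E : IsWeightExtension α h) {p : ℕ} (k : ℕ)
    (F : MultilinearMap ℂ (fun _ : Fin p => OddPart L) ℂ)
    (hF : ∀ (σ : Equiv.Perm (Fin p)) (x : Fin p → OddPart L), F (x ∘ σ) = F x) : CohRing L' :=
  DirectSum.of (Coh (trivRep L')) p (Coh.ofForm (pull α ℂ p (weightComp E.ad k F))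
    (E.pull_triv_mem_iff.2 (weightComp_symm E.ad k hF)))

theorem IsWeightExtension.sum_compClass (E : IsWeightExtension α h) {p : ℕ} {a : CohRing L'}
    (F : MultilinearMap ℂ (fun _ : Fin p => OddPart L) ℂ)
    (hF : ∀ (σ : Equiv.Perm (Fin p)) (x : Fin p → OddPart L), F (x ∘ σ) = F x)
    (ha : pull α ℂ p F = Coh.form L' p (a p)) :
    ∑ k ∈ Finset.range (p + 1), E.compClass k F hF = DirectSum.of (Coh (trivRep L')) p (a p) := by
  simp only [IsWeightExtension.compClass, ← map_sum]
  congr 1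
  apply Coh.form_injective
  rw [map_sum, ← ha]
  simp only [Coh.form_ofForm]
  rw [← map_sum, sum_weightComp]

theorem IsWeightTorus.compClass_mem (T : IsWeightTorus α h τ χ) (E : IsWeightExtension α h)
    {p : ℕ} (k : ℕ) (F : MultilinearMap ℂ (fun _ : Fin p => OddPart L) ℂ)
    (hF : ∀ (σ : Equiv.Perm (Fin p)) (x : Fin p → OddPart L), F (x ∘ σ) = F x) :
    E.compClass k F hF ∈ weightSpace τ χ (2 * (k : ℤ) - p) := by
  intro g
  refine cohRing_ext fun q => ?_
  rw [DirectSum.smul_apply, map_smul]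
  ext x
  by_cases hq : p = q
  · subst hq
    have h1 : pull α ℂ p (weightComp E.ad k F) = Coh.form L' p (E.compClass k F hF p) := by
      rw [IsWeightExtension.compClass, DirectSum.of_eq_same]
      rfl
    rw [T.form_apply E g _ h1, weightComp_scale E.ad k E.ad_mul_ad, ← h1]
    rfl
  · have h1 : E.compClass k F hF q = 0 := DirectSum.of_eq_of_ne _ _ _ (Ne.symm hq)
    have h2 : pull α ℂ q (0 : MultilinearMap ℂ (fun _ : Fin q => OddPart L) ℂ) =
        Coh.form L' q (E.compClass k F hF q) := by rw [h1, map_zero, map_zero]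
    rw [T.form_apply E g _ h2, h1, map_zero]
    simp

/-- The restrictions of classes of `L` have weight `0`. -/
theorem IsWeightTorus.resRing_mem (T : IsWeightTorus α h τ χ) (E : IsWeightExtension α h)
    (a : CohRing L) : resRing α a ∈ weightSpace τ χ 0 := by
  intro g
  rw [zpow_zero, Units.val_one, one_smul]
  refine cohRing_ext fun p => ?_
  set F := Coh.form L p (a p) with hF
  have h1 : pull α ℂ p F = Coh.form L' p (resRing α a p) := by
    rw [resRing_apply, form_resCoh]
  ext x
  rw [T.form_apply E g _ h1, ← h1, pull_apply]
  have h0 : deriv 0 E.ad p F = 0 := E.deriv_eq_zero (Coh.form_mem (a p))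
  have h2 : ∀ k ∈ Finset.range (p + 1), ∀ y : Fin p → OddPart L, weightComp E.ad k F
      (fun i => (χ g : ℂ) • posProj E.ad (y i) + ((χ g)⁻¹ : ℂˣ).1 • negProj E.ad (y i)) =
        weightComp E.ad k F y := by
    intro k _ y
    rw [weightComp_scale E.ad k E.ad_mul_ad]
    have h3 := deriv_weightComp E.ad k E.ad_mul_ad F
    rw [weightComp_deriv, h0, weightComp_zero] at h3
    -- The form is killed by `h`, so only its component with `2 k = p` is nonzero.
    rcases smul_eq_zero.1 h3.symm with h4 | h4
    · have h5 : 2 * (k : ℤ) - p = 0 := by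
        have : (2 * (k : ℂ) - p) = 0 := by linear_combination -h4
        exact_mod_cast this
      rw [h5, zpow_zero, Units.val_one, one_smul]
    · rw [h4]
      simp
  rw [← sum_weightComp E.ad F, sum_apply, sum_apply]
  exact Finset.sum_congr rfl fun k hk => h2 k hk _

/-- A subspace of the cohomology ring of `L'` which is closed under taking weight components is
spanned by its restrictions of classes of `L` and its elements of nonzero weight. -/
theorem IsWeightTorus.le_sup (T : IsWeightTorus α h τ χ) (E : IsWeightExtension α h)
    {J : Submodule ℂ (CohRing L')}
    (hJ : ∀ a ∈ J, ∀ (p k : ℕ) (F : MultilinearMap ℂ (fun _ : Fin p => OddPart L) ℂ)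
      (hF : ∀ (σ : Equiv.Perm (Fin p)) (x : Fin p → OddPart L), F (x ∘ σ) = F x),
      pull α ℂ p F = Coh.form L' p (a p) → E.compClass k F hF ∈ J) :
    J ≤ (LinearMap.range (resRing α).toLinearMap ⊓ J) ⊔ ⨆ j : {j : ℤ // j ≠ 0},
      weightSpace τ χ j ⊓ J := by
  classical
  intro a ha
  rw [← DirectSum.sum_support_of a]
  refine sum_mem fun p _ => ?_
  obtain ⟨F, hFa⟩ := E.exists_pull (Coh.form L' p (a p))
  have hF : ∀ (σ : Equiv.Perm (Fin p)) (x : Fin p → OddPart L), F (x ∘ σ) = F x :=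
    E.pull_triv_mem_iff.1 (hFa ▸ Coh.form_mem (a p))
  rw [← E.sum_compClass F hF hFa]
  refine sum_mem fun k _ => ?_
  have h1 := hJ a ha p k F hF hFa
  by_cases hk : 2 * (k : ℤ) - p = 0
  · refine Submodule.mem_sup_left ⟨?_, h1⟩
    have h2 : weightComp E.ad k F ∈ cochain (trivRep L) p := by
      refine E.mem_cochain (triv_comp α) (E.pull_triv_mem_iff.2 (weightComp_symm E.ad k hF)) ?_
      refine (deriv_weightComp E.ad k E.ad_mul_ad F).trans ?_
      have h3 : (p : ℂ) - 2 * k = 0 := by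
        have : (2 * (k : ℂ) - p) = 0 := by exact_mod_cast hk
        linear_combination -this
      rw [h3, zero_smul]
    refine ⟨DirectSum.of (Coh (trivRep L)) p (Coh.ofForm _ h2), ?_⟩
    exact resRing_of α _
  · exact Submodule.mem_sup_right (Submodule.mem_iSup_of_mem ⟨_, hk⟩ ⟨T.compClass_mem E k F hF, h1⟩)

end CohRing

/-! ### The annihilators -/

section Annihilator

variable {L L' M : Type*} [AddCommGroup L] [Module ℂ L] [LieSuperalgebra L]
    [AddCommGroup L'] [Module ℂ L'] [LieSuperalgebra L'] [AddCommGroup M] [Module ℂ M]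
    [SuperSpace M] [FiniteDimensional ℂ M]
    {α : LieSuperHom L' L} {h : L} (E : IsWeightExtension α h) {ρ : SuperRep L M}
    (hss : (ρ.toLin h).IsSemisimple)
include E hss

theorem IsWeightExtension.isSemisimple_endRep : ((endRep ρ).toLin h).IsSemisimple := by
  have h1 : (endRep ρ).toLin h = LinearMap.mulLeft ℂ (ρ.toLin h) -
      LinearMap.mulRight ℂ (ρ.toLin h) := LinearMap.ext fun f => endRep_even ρ E.mem f
  rw [h1]
  exact Module.End.IsSemisimple.sub_of_commute (LinearMap.commute_mulLeft_right _ _)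
    (isSemisimple_mulLeft hss) (isSemisimple_mulRight hss)

omit hss [FiniteDimensional ℂ M] in
theorem IsWeightExtension.deriv_smulRight {p : ℕ} (k : ℂ)
    (F : MultilinearMap ℂ (fun _ : Fin p => OddPart L) ℂ) :
    deriv ((endRep ρ).toLin h - k • 1) E.ad p (F.smulRight (1 : Module.End ℂ M)) =
      (deriv 0 E.ad p F - k • F).smulRight 1 := by
  ext1 x
  have h1 : (endRep ρ).toLin h (1 : Module.End ℂ M) = 0 := by
    rw [endRep_even ρ E.mem, mul_one, one_mul, sub_self]
  simp only [deriv_apply, MultilinearMap.smulRight_apply, LinearMap.sub_apply,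
    LinearMap.smul_apply, map_smul, h1, Module.End.one_apply, sub_apply, smul_apply,
    LinearMap.zero_apply, ← Finset.sum_smul, zero_sub, smul_eq_mul]
  module

variable [FiniteDimensional ℂ (OddPart L)]

/-- The annihilator of `L'` is closed under taking weight components. -/
theorem IsWeightExtension.compClass_mem_supportIdeal {a : CohRing L'}
    (ha : a ∈ supportIdeal (ρ.comp α)) (p k : ℕ)
    (F : MultilinearMap ℂ (fun _ : Fin p => OddPart L) ℂ)
    (hF : ∀ (σ : Equiv.Perm (Fin p)) (x : Fin p → OddPart L), F (x ∘ σ) = F x)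
    (hFa : pull α ℂ p F = Coh.form L' p (a p)) :
    E.compClass k F hF ∈ supportIdeal (ρ.comp α) := by
  rw [mem_supportIdeal_iff] at ha ⊢
  intro q
  by_cases hq : p = q
  · subst hq
    have h1 : Coh.form L' p (E.compClass k F hF p) = pull α ℂ p (weightComp E.ad k F) := by
      rw [compClass, DirectSum.of_eq_same]
      rfl
    rw [h1]
    have h2 := ha p
    rw [← hFa] at h2
    by_cases hk : k ∈ Finset.range (p + 1)
    · -- The derivation `h - (p - 2k)` acts on the component of index `j` by `2 (k - j)`, so the sum
      -- of the components with `j ≠ k` is in its range.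
      refine (E.mem_boundaries_of_add (ρ := endRep ρ) (ρ' := endRep (ρ.comp α)) (fun x => rfl)
        (E.isSemisimple_endRep hss) ((p : ℂ) - 2 * k)
        (g := (weightComp E.ad k F).smulRight 1)
        (g' := ∑ j ∈ (Finset.range (p + 1)).erase k,
          (2 * ((k : ℂ) - j))⁻¹ • (weightComp E.ad j F).smulRight 1) ?_ ?_).1
      · rw [E.deriv_smulRight, deriv_weightComp _ _ E.ad_mul_ad, sub_self]
        ext1 x
        simp
      · have h3 : (weightComp E.ad k F).smulRight (1 : Module.End ℂ M) +
            deriv ((endRep ρ).toLin h - ((p : ℂ) - 2 * k) • 1) E.ad p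
              (∑ j ∈ (Finset.range (p + 1)).erase k,
                (2 * ((k : ℂ) - j))⁻¹ • (weightComp E.ad j F).smulRight 1) = F.smulRight 1 := by
          have h4 : ∀ j ∈ (Finset.range (p + 1)).erase k,
              deriv ((endRep ρ).toLin h - ((p : ℂ) - 2 * k) • 1) E.ad p
                ((2 * ((k : ℂ) - j))⁻¹ • (weightComp E.ad j F).smulRight 1) =
                (weightComp E.ad j F).smulRight 1 := by
            intro j hj
            have hkj : (2 * ((k : ℂ) - j)) ≠ 0 := mul_ne_zero two_ne_zero
              (sub_ne_zero.2 (by exact_mod_cast (Finset.ne_of_mem_erase hj).symm))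
            rw [map_smul, E.deriv_smulRight, deriv_weightComp _ _ E.ad_mul_ad, ← sub_smul]
            have h5 : (p : ℂ) - 2 * j - (p - 2 * k) = 2 * (k - j) := by ring
            ext1 x
            rw [h5, smul_apply, MultilinearMap.smulRight_apply, smul_apply, smul_assoc,
              inv_smul_smul₀ hkj, MultilinearMap.smulRight_apply]
          rw [map_sum, Finset.sum_congr rfl h4, Finset.add_sum_erase _ (fun j =>
            (weightComp E.ad j F).smulRight (1 : Module.End ℂ M)) hk]
          conv_rhs => rw [← sum_weightComp E.ad F]
          ext1 x
          simp [sum_apply, Finset.sum_smul]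
        rw [h3]
        exact h2
    · have h3 : weightComp E.ad k F = 0 := by
        rw [weightComp, Finset.powersetCard_eq_empty.2, Finset.sum_empty]
        simpa using hk
      rw [h3, map_zero]
      convert zero_mem (boundaries (endRep (ρ.comp α)) p)
      ext1 x
      simp
  · have h1 : E.compClass k F hF q = 0 := DirectSum.of_eq_of_ne _ _ _ (Ne.symm hq)
    rw [h1, map_zero]
    convert zero_mem (boundaries (endRep (ρ.comp α)) q)
    ext1 x
    simp

/-- The annihilator of `L` is the restriction of the annihilator of `L'`. -/
theorem IsWeightExtension.supportIdeal_eq_comap :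
    supportIdeal ρ = (supportIdeal (ρ.comp α)).comap (resRing α) := by
  ext a
  rw [Ideal.mem_comap, mem_supportIdeal_iff, mem_supportIdeal_iff]
  refine forall_congr' fun p => ?_
  rw [resRing_apply, form_resCoh]
  have h0 : (pull α ℂ p (Coh.form L p (a p))).smulRight (1 : Module.End ℂ M) =
      pull α (Module.End ℂ M) p ((Coh.form L p (a p)).smulRight 1) := rfl
  rw [h0]
  constructor
  · intro ha
    cases p with
    | zero =>
      have h1 : (Coh.form L 0 (a 0)).smulRight (1 : Module.End ℂ M) = 0 := ha
      rw [h1, map_zero]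
      exact zero_mem _
    | succ p =>
      obtain ⟨ψ, hψ, hd⟩ := ha
      exact ⟨pull α _ p ψ, pull_mem α (ρ' := endRep (ρ.comp α)) (fun _ => rfl) hψ, by
        rw [d_pull α (ρ := endRep ρ) (fun _ => rfl), hd]⟩
  · intro ha
    refine (E.mem_boundaries_of_add (ρ := endRep ρ) (ρ' := endRep (ρ.comp α)) (fun x => rfl)
      (E.isSemisimple_endRep hss) 0 (g' := 0) ?_ (by rwa [map_zero, add_zero])).2 rfl
    rw [zero_smul, sub_zero]
    exact E.deriv_eq_zero (smulRight_one_mem ρ (Coh.form_mem (a p)))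

end Annihilator

/-! ### Quotients by a torus of weights -/

section Quotient

/-- The eigenspaces for the distinct powers of `2` are independent; this separates weight `0` from
the other weights of an element of the torus on which the character takes the value `2`. -/
theorem eq_zero_of_mem_eigenspace {B : Type*} [AddCommGroup B] [Module ℂ B] (f : Module.End ℂ B)
    {b : B} (h1 : f b = b) (h2 : b ∈ ⨆ j : {j : ℤ // j ≠ 0}, f.eigenspace ((2 : ℂ) ^ (j : ℤ))) :
    b = 0 := by
  have hinj : Function.Injective fun j : ℤ => (2 : ℂ) ^ j := by
    intro i j hij
    have h : (2 : ℝ) ^ i = (2 : ℝ) ^ j := by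
      have := congrArg norm hij
      simpa using this
    exact zpow_right_injective₀ two_pos (by norm_num) h
  have h3 := (f.eigenspaces_iSupIndep.comp hinj) 0
  refine Submodule.disjoint_def.1 h3 b ?_ ?_
  · rw [Function.comp_apply, Module.End.mem_eigenspace_iff]
    simpa using h1
  · rw [iSup_subtype] at h2
    exact h2

variable {R S G : Type*} [CommRing R] [Algebra ℂ R] [CommRing S] [Algebra ℂ S] [Group G]

theorem comap_isMaximal {res : R →ₐ[ℂ] S} {m : Ideal S} (hm : m.IsMaximal)
    (h : Function.Surjective (algebraMap ℂ (S ⧸ m))) :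
    (m.comap res).IsMaximal := by
  have h1 : Function.Surjective ((Ideal.Quotient.mk m).comp res.toRingHom) := fun x => by
    obtain ⟨c, rfl⟩ := h x
    exact ⟨algebraMap ℂ R c, congrArg (Ideal.Quotient.mk m) (res.commutes c)⟩
  let _ := Ideal.Quotient.field m
  have h2 := RingHom.ker_isMaximal_of_surjective _ h1
  rwa [← RingHom.comap_ker, Ideal.mk_ker] at h2

theorem weightSpace_mul {τ : G →* (S →ₐ[ℂ] S)} {χ : G → ℂˣ} {i j : ℤ} {a b : S}
    (ha : a ∈ weightSpace τ χ i) (hb : b ∈ weightSpace τ χ j) :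
    a * b ∈ weightSpace τ χ (i + j) := fun g => by
  rw [map_mul, ha g, hb g, smul_mul_smul_comm, zpow_add, Units.val_mul]

theorem weightSpace_le_eigenspace {τ : G →* (S →ₐ[ℂ] S)} {χ : G → ℂˣ} {g : G}
    (hg : (χ g : ℂ) = 2) (j : ℤ) :
    weightSpace τ χ j ≤ Module.End.eigenspace (τ g).toLinearMap ((2 : ℂ) ^ j) := fun a ha => by
  rw [Module.End.mem_eigenspace_iff, ← hg]
  simpa using ha g

/-- The functions vanishing on the image of `V` are those whose restriction vanishes on `V`. -/
theorem vanishing_image {V : Set (MaximalSpectrum S)} {res : R →ₐ[ℂ] S}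
    {resStar : MaximalSpectrum S → MaximalSpectrum R}
    (h : ∀ m, (resStar m).asIdeal = m.asIdeal.comap res) :
    vanishing (resStar '' V) = (vanishing V).comap res := by
  ext a
  simp [vanishing, Submodule.mem_iInf, h]

variable {res : R →ₐ[ℂ] S} {τ : G →* (S →ₐ[ℂ] S)} {χ : G → ℂˣ} {J : Ideal S}

/-- A maximal ideal of the part of weight `0` which contains the trace of a homogeneous ideal `J`
lies below a maximal ideal containing `J`. -/
theorem exists_isMaximal_comap_eq (hinj : Function.Injective res) {g : G} (hg : (χ g : ℂ) = 2)
    (hres : ∀ a, res a ∈ weightSpace τ χ 0)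
    (htop : ⊤ ≤ LinearMap.range res.toLinearMap ⊔ ⨆ j : {j : ℤ // j ≠ 0}, weightSpace τ χ j)
    (hJ : J.restrictScalars ℂ ≤ (LinearMap.range res.toLinearMap ⊓ J.restrictScalars ℂ) ⊔
      ⨆ j : {j : ℤ // j ≠ 0}, weightSpace τ χ j ⊓ J.restrictScalars ℂ)
    {m : Ideal R} (hm : m.IsMaximal) (hJm : J.comap res ≤ m) :
    ∃ n : Ideal S, n.IsMaximal ∧ J ≤ n ∧ n.comap res = m := by
  -- The component of weight `0` of an element of `J + m S` lies in `m`, so `J + m S` is proper.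
  let W : Submodule ℂ S := ⨆ j : {j : ℤ // j ≠ 0}, weightSpace τ χ j
  let Q : Submodule ℂ S := (m.restrictScalars ℂ).map res.toLinearMap ⊔ W
  have hJQ : J.restrictScalars ℂ ≤ Q := by
    refine hJ.trans (sup_le_sup ?_ (iSup_mono fun j => inf_le_left))
    rintro _ ⟨⟨a, rfl⟩, ha⟩
    exact ⟨a, hJm ha, rfl⟩
  have hmQ : ∀ a ∈ m, ∀ s, s * res a ∈ Q := by
    intro a ha s
    have hs : s ∈ LinearMap.range res.toLinearMap ⊔ W := htop Submodule.mem_top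
    have : LinearMap.range res.toLinearMap ⊔ W ≤ Q.comap (LinearMap.mulRight ℂ (res a)) := by
      refine sup_le ?_ (iSup_le fun j => ?_)
      · rintro _ ⟨b, rfl⟩
        exact Submodule.mem_sup_left ⟨b * a, m.mul_mem_left b ha, map_mul res b a⟩
      · intro b hb
        have h := weightSpace_mul hb (hres a)
        rw [add_zero] at h
        exact Submodule.mem_sup_right (Submodule.mem_iSup_of_mem j h)
    exact this hs
  have hmapQ : ∀ b ∈ m.map res, ∀ s, s * b ∈ Q := by
    intro b hb
    refine Submodule.span_induction (p := fun b _ => ∀ s, s * b ∈ Q) ?_ ?_ ?_ ?_ hb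
    · rintro _ ⟨c, hc, rfl⟩ s
      exact hmQ c hc s
    · intro s
      rw [mul_zero]
      exact zero_mem Q
    · intro x y _ _ hx hy s
      rw [mul_add]
      exact add_mem (hx s) (hy s)
    · intro c x _ hx s
      rw [smul_eq_mul, ← mul_assoc]
      exact hx _
  have hne : J ⊔ m.map res ≠ ⊤ := by
    intro htop'
    obtain ⟨a, ha, b, hb, hab⟩ := Submodule.mem_sup.1 ((Ideal.eq_top_iff_one _).1 htop')
    have h1 : (1 : S) ∈ Q := by
      rw [← hab, ← one_mul b]
      exact add_mem (hJQ ha) (hmapQ b hb 1)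
    obtain ⟨_, ⟨c, hc, rfl⟩, w, hw, h2⟩ := Submodule.mem_sup.1 h1
    have hw1 : w = res (1 - c) := by
      rw [map_sub, map_one, ← h2]
      exact (add_sub_cancel_left _ _).symm
    have hw0 : w = 0 := by
      have hle : W ≤ ⨆ j : {j : ℤ // j ≠ 0},
          Module.End.eigenspace (τ g).toLinearMap ((2 : ℂ) ^ (j : ℤ)) :=
        iSup_mono fun j => weightSpace_le_eigenspace hg j
      refine eq_zero_of_mem_eigenspace (τ g).toLinearMap ?_ (hle hw)
      have h3 := hres (1 - c) g
      rw [zpow_zero, Units.val_one, one_smul] at h3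
      rw [hw1]
      exact h3
    rw [hw0] at hw1
    have h4 : 1 - c = 0 := hinj (hw1.symm.trans (map_zero res).symm)
    exact hm.ne_top ((Ideal.eq_top_iff_one _).2 (sub_eq_zero.1 h4 ▸ hc))
  obtain ⟨n, hn, hle⟩ := Ideal.exists_le_maximal _ hne
  refine ⟨n, hn, le_sup_left.trans hle, ?_⟩
  exact (hm.eq_of_le (Ideal.comap_ne_top _ hn.ne_top)
    (Ideal.map_le_iff_le_comap.1 (le_sup_right.trans hle))).symm

/-- An ideal which is homogeneous for the weights is stable under the group. -/
theorem apply_mem_of_weights (hres : ∀ a, res a ∈ weightSpace τ χ 0)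
    (hJ : J.restrictScalars ℂ ≤ (LinearMap.range res.toLinearMap ⊓ J.restrictScalars ℂ) ⊔
      ⨆ j : {j : ℤ // j ≠ 0}, weightSpace τ χ j ⊓ J.restrictScalars ℂ)
    (g : G) {a : S} (ha : a ∈ J) : τ g a ∈ J := by
  have h1 : J.restrictScalars ℂ ≤ (J.restrictScalars ℂ).comap (τ g).toLinearMap := by
    refine hJ.trans (sup_le ?_ (iSup_le fun j => ?_))
    · rintro _ ⟨⟨a, rfl⟩, ha⟩
      change τ g (res a) ∈ J.restrictScalars ℂ
      rw [hres a g]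
      exact Submodule.smul_mem _ _ ha
    · rintro a ⟨ha, haJ⟩
      change τ g a ∈ J.restrictScalars ℂ
      rw [ha g]
      exact Submodule.smul_mem _ _ haJ
  exact h1 ha

/-- The invariants in the coordinate ring of a stable subvariety come from the part of
weight `0`. -/
theorem exists_eq_of_mem_invariants {g : G} (hg : (χ g : ℂ) = 2)
    (hres : ∀ a, res a ∈ weightSpace τ χ 0)
    (htop : ⊤ ≤ LinearMap.range res.toLinearMap ⊔ ⨆ j : {j : ℤ // j ≠ 0}, weightSpace τ χ j)
    {V : Set (MaximalSpectrum S)} (hT : IsStable τ V) {x : CoordRing V} (hx : x ∈ invariants hT) :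
    ∃ a, Ideal.Quotient.mk (vanishing V) (res a) = x := by
  obtain ⟨s, rfl⟩ := Ideal.Quotient.mk_surjective x
  obtain ⟨_, ⟨a, rfl⟩, w, hw, rfl⟩ := Submodule.mem_sup.1 (htop (Submodule.mem_top (x := s)))
  refine ⟨a, ?_⟩
  have hx0 : Ideal.Quotient.mk (vanishing V) (τ g (res a + w)) =
    Ideal.Quotient.mk (vanishing V) (res a + w) := hx g
  have ha := hres a g
  rw [zpow_zero, Units.val_one, one_smul] at ha
  rw [map_add (τ g), ha, map_add, map_add] at hx0
  have hw0 : Ideal.Quotient.mk (vanishing V) w = 0 := by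
    refine eq_zero_of_mem_eigenspace (coordAct hT g).toLinearMap (add_left_cancel hx0) ?_
    have h1 : (⨆ j : {j : ℤ // j ≠ 0}, weightSpace τ χ j) ≤
        (⨆ j : {j : ℤ // j ≠ 0}, Module.End.eigenspace (coordAct hT g).toLinearMap
          ((2 : ℂ) ^ (j : ℤ))).comap (Ideal.Quotient.mkₐ ℂ (vanishing V)).toLinearMap := by
      refine iSup_le fun j b hb => ?_
      refine Submodule.mem_iSup_of_mem j ?_
      have h2 := (Module.End.mem_eigenspace_iff).1 (weightSpace_le_eigenspace hg j hb)
      rw [Module.End.mem_eigenspace_iff]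
      exact (congrArg (Ideal.Quotient.mkₐ ℂ (vanishing V)) h2).trans (map_smul _ _ _)
    exact h1 hw
  change Ideal.Quotient.mk (vanishing V) (res a) = Ideal.Quotient.mk (vanishing V) (res a + w)
  rw [map_add, hw0, add_zero]

/-- An abstract form of the theorem: `S` is graded by the weights of a torus, with `R` the part of
weight `0`, and `J` is a homogeneous ideal of `S`. -/
theorem exists_quotient (hinj : Function.Injective res) (hχ : Function.Surjective χ)
    (hres : ∀ a, res a ∈ weightSpace τ χ 0)
    (htop : ⊤ ≤ LinearMap.range res.toLinearMap ⊔ ⨆ j : {j : ℤ // j ≠ 0}, weightSpace τ χ j)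
    (hJ : J.restrictScalars ℂ ≤ (LinearMap.range res.toLinearMap ⊓ J.restrictScalars ℂ) ⊔
      ⨆ j : {j : ℤ // j ≠ 0}, weightSpace τ χ j ⊓ J.restrictScalars ℂ)
    (hS : ∀ m : Ideal S, m.IsMaximal → Function.Surjective (algebraMap ℂ (S ⧸ m)))
    {V : Set (MaximalSpectrum S)} (hV : V = {m | J ≤ m.asIdeal})
    {V' : Set (MaximalSpectrum R)} (hV' : V' = {m | J.comap res ≤ m.asIdeal}) :
    ∃ resStar : MaximalSpectrum S → MaximalSpectrum R,
      (∀ m, (resStar m).asIdeal = m.asIdeal.comap res) ∧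
      resStar '' V = V' ∧
      ∃ hT : IsStable τ V,
      ∃ e : CoordRing (resStar '' V) ≃ₐ[ℂ] invariants hT,
        ∀ b, (e (Ideal.Quotient.mk _ b) : CoordRing V) = Ideal.Quotient.mk _ (res b) := by
  obtain ⟨resStar, hstar⟩ : ∃ resStar : MaximalSpectrum S → MaximalSpectrum R,
      ∀ m, (resStar m).asIdeal = m.asIdeal.comap res :=
    ⟨fun m => ⟨m.asIdeal.comap res, comap_isMaximal m.isMaximal (hS _ m.isMaximal)⟩, fun _ => rfl⟩
  obtain ⟨g, hg'⟩ := hχ (Units.mk0 2 two_ne_zero)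
  have hg : (χ g : ℂ) = 2 := by rw [hg']; rfl
  have hT : IsStable τ V := by
    subst hV
    intro g m hm a ha
    exact hm (apply_mem_of_weights hres hJ _ ha)
  refine ⟨resStar, hstar, ?_, hT, ?_⟩
  · subst hV hV'
    apply Set.Subset.antisymm
    · rintro _ ⟨m, hm, rfl⟩
      change J.comap res ≤ _
      rw [hstar]
      exact Ideal.comap_mono hm
    · intro m hm
      obtain ⟨n, hn, hJn, hnm⟩ := exists_isMaximal_comap_eq hinj hg hres htop hJ m.isMaximal hm
      exact ⟨⟨n, hn⟩, hJn, MaximalSpectrum.ext ((hstar _).trans hnm)⟩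
  · have hle := (vanishing_image (V := V) hstar).le
    let f : CoordRing (resStar '' V) →ₐ[ℂ] CoordRing V := Ideal.quotientMapₐ _ res hle
    have hfinj : Function.Injective f :=
      Ideal.quotientMap_injective' (H := hle) (vanishing_image hstar).ge
    have hfinv : ∀ x, f x ∈ invariants hT := by
      intro x g
      obtain ⟨b, rfl⟩ := Ideal.Quotient.mk_surjective x
      have hb := hres b g
      rw [zpow_zero, Units.val_one, one_smul] at hb
      exact congrArg (Ideal.Quotient.mk (vanishing V)) hb
    refine ⟨AlgEquiv.ofBijective (f.codRestrict _ hfinv) ⟨fun a b hab => hfinj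
      (congrArg Subtype.val hab), fun x => ?_⟩, fun b => rfl⟩
    obtain ⟨a, ha⟩ := exists_eq_of_mem_invariants hg hres htop hT x.2
    exact ⟨Ideal.Quotient.mk _ a, Subtype.ext ha⟩

/-- A form of the Nullstellensatz: the residue fields of a complex algebra of countable dimension
are `ℂ`, because the inverses of the `x - c` are linearly independent when `x` is
transcendental. -/
theorem algebraMap_quotient_surjective {ι : Type*} [Countable ι] (b : Module.Basis ι ℂ S)
    (m : Ideal S) (hm : m.IsMaximal) : Function.Surjective (algebraMap ℂ (S ⧸ m)) := by
  let _ := Ideal.Quotient.field m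
  suffices Algebra.IsIntegral ℂ (S ⧸ m) from
    (IsAlgClosed.algebraMap_bijective_of_isIntegral (k := ℂ) (K := S ⧸ m)).2
  rw [← Algebra.isAlgebraic_iff_isIntegral]
  by_contra hna
  rw [Algebra.isAlgebraic_def, not_forall] at hna
  obtain ⟨x, hx⟩ := hna
  have h1 :=
    (Transcendental.linearIndependent_sub_inv (F := ℂ) (E := S ⧸ m) hx).cardinal_lift_le_rank
  have h2 : Module.rank ℂ (S ⧸ m) ≤ Module.rank ℂ S :=
    LinearMap.rank_le_of_surjective (Ideal.Quotient.mkₐ ℂ m).toLinearMap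
      (Ideal.Quotient.mkₐ_surjective ℂ m)
  have h3 : Module.rank ℂ S ≤ Cardinal.aleph0 := by
    have := b.mk_eq_rank
    have h4 : Cardinal.lift.{_} (Module.rank ℂ S) ≤ Cardinal.aleph0 := by
      rw [← this, Cardinal.lift_le_aleph0]
      exact Cardinal.mk_le_aleph0
    exact Cardinal.lift_le_aleph0.1 h4
  have h5 := h1.trans (Cardinal.lift_le_aleph0.2 (h2.trans h3))
  rw [Cardinal.lift_le_aleph0, Cardinal.mk_complex] at h5
  exact absurd h5 (not_le.2 Cardinal.aleph0_lt_continuum)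

end Quotient

/-! ### Support varieties -/

section Conclusion

instance {L : Type*} [AddCommGroup L] [Module ℂ L] [LieSuperalgebra L]
    [FiniteDimensional ℂ (OddPart L)] (p : ℕ) : FiniteDimensional ℂ (Coh (trivRep L) p) :=
  Module.Finite.of_surjective (Coh.mk (trivRep L) p) (Coh.mk_surjective _ p)

theorem cohRing_residueField (L : Type*) [AddCommGroup L] [Module ℂ L] [LieSuperalgebra L]
    [FiniteDimensional ℂ (OddPart L)] (m : Ideal (CohRing L)) (hm : m.IsMaximal) :
    Function.Surjective (algebraMap ℂ (CohRing L ⧸ m)) :=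
  algebraMap_quotient_surjective
    (DFinsupp.basis fun p => Module.finBasis ℂ (Coh (trivRep L) p)) m hm

variable {L L' M : Type*} [AddCommGroup L] [Module ℂ L] [LieSuperalgebra L]
    [AddCommGroup L'] [Module ℂ L'] [LieSuperalgebra L'] [AddCommGroup M] [Module ℂ M]
    [SuperSpace M] [FiniteDimensional ℂ M] {G : Type*} [Group G]
    {α : LieSuperHom L' L} {h : L} {τ : G →* (CohRing L' →ₐ[ℂ] CohRing L')} {χ : G → ℂˣ}

/-- The support of an `L`-supermodule is the quotient by the torus of its support over `L'`. -/
theorem IsWeightTorus.support_quotient (T : IsWeightTorus α h τ χ) (E : IsWeightExtension α h)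
    [FiniteDimensional ℂ L] {ρ : SuperRep L M} (hss : (ρ.toLin h).IsSemisimple) :
    ∃ resStar : MaximalSpectrum (CohRing L') → MaximalSpectrum (CohRing L),
      (∀ m, (resStar m).asIdeal = m.asIdeal.comap (resRing α)) ∧
      resStar '' support (ρ.comp α) = support ρ ∧
      ∃ hT : IsStable τ (support (ρ.comp α)),
      ∃ e : CoordRing (resStar '' support (ρ.comp α)) ≃ₐ[ℂ] invariants hT,
        ∀ b, (e (Ideal.Quotient.mk _ b) : CoordRing (support (ρ.comp α))) =
          Ideal.Quotient.mk _ (resRing α b) := by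
  have : FiniteDimensional ℂ (OddPart L) := inferInstance
  have : FiniteDimensional ℂ (OddPart L') :=
    Module.Finite.of_injective α.odd E.odd_bijective.1
  refine exists_quotient (J := supportIdeal (ρ.comp α)) E.resRing_injective T.surjective
    (T.resRing_mem E) ?_
    (T.le_sup E fun a ha p k F hF hFa => E.compClass_mem_supportIdeal hss ha p k F hF hFa)
    (cohRing_residueField L') rfl ?_
  · have h := T.le_sup E (J := ⊤) fun _ _ _ _ _ _ _ => Submodule.mem_top
    simpa only [inf_top_eq] using h
  · rw [support, E.supportIdeal_eq_comap hss]

end Conclusion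

/-! ### The detecting subalgebras -/

section Semisimple

variable {L M : Type*} [AddCommGroup L] [Module ℂ L] [LieSuperalgebra L]
    [AddCommGroup M] [Module ℂ M] [SuperSpace M] [FiniteDimensional ℂ M]

/-- Schur's lemma: an element which centralizes the even part acts on each simple summand by a
scalar, since its eigenspaces are subsupermodules. -/
theorem FinitelySemisimple.isSemisimple {ρ : SuperRep L M} (hρ : FinitelySemisimple ρ) {h : L}
    (hh : h ∈ part (V := L) 0) (hc : ∀ y ∈ part (V := L) 0, bracket h y = 0) :
    (ρ.toLin h).IsSemisimple := by
  obtain ⟨s, hs, -, hsup⟩ := hρ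
  refine isSemisimple_of_sSup_eq_top hsup fun S hS => ?_
  obtain ⟨hsimple, hfin⟩ := hs S hS
  have : Nontrivial S := Submodule.nontrivial_iff_ne_bot.2 hsimple.ne_bot
  obtain ⟨μ, hμ⟩ := Module.End.exists_eigenvalue
    ((ρ.toLin h).restrict (p := S) (q := S) (hsimple.isSub.stable h hh))
  obtain ⟨v, hv, hv0⟩ := hμ.exists_hasEigenvector
  have hv1 : ρ.toLin h v = μ • (v : M) :=
    congrArg Subtype.val (Module.End.mem_eigenspace_iff.1 hv)
  refine ⟨μ, ?_⟩
  have hpart : ∀ i, ∀ a ∈ part (V := M) i, ρ.toLin h a ∈ part (V := M) i := fun i a ha => by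
    have := end_part_apply (ρ.map_part hh) ha
    rwa [zero_add] at this
  have hsub : IsEvenSub ρ (S ⊓ (ρ.toLin h).eigenspace μ) := by
    constructor
    · rintro x ⟨hxS, hx⟩
      obtain ⟨a, ⟨haS, ha⟩, b, ⟨hbS, hb⟩, rfl⟩ := Submodule.mem_sup.1 (hsimple.isSub.graded hxS)
      rw [SetLike.mem_coe, Module.End.mem_eigenspace_iff, map_add, smul_add] at hx
      have h1 : ρ.toLin h a - μ • a = μ • b - ρ.toLin h b := by
        rw [sub_eq_sub_iff_add_eq_add, hx, add_comm]
      have h2 : ρ.toLin h a - μ • a = 0 := by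
        refine Submodule.disjoint_def.1 (isCompl (V := M)).disjoint _
          (sub_mem (hpart 0 a ha) (Submodule.smul_mem _ _ ha)) ?_
        rw [h1]
        exact sub_mem (Submodule.smul_mem _ _ hb) (hpart 1 b hb)
      refine Submodule.mem_sup.2 ⟨a, ⟨⟨haS, ?_⟩, ha⟩, b, ⟨⟨hbS, ?_⟩, hb⟩, rfl⟩
      · exact Module.End.mem_eigenspace_iff.2 (sub_eq_zero.1 h2)
      · rw [h1] at h2
        exact Module.End.mem_eigenspace_iff.2 (sub_eq_zero.1 h2).symm
    · rintro y hy m ⟨hmS, hm⟩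
      refine ⟨hsimple.isSub.stable y hy m hmS, Module.End.mem_eigenspace_iff.2 ?_⟩
      have h2 := ρ.map_bracket h y
      rw [hc y hy, map_zero, bracket_end (ρ.map_part hh) (ρ.map_part hy), sgn_zero_left,
        one_smul] at h2
      have h3 : ρ.toLin h (ρ.toLin y m) = ρ.toLin y (ρ.toLin h m) :=
        LinearMap.congr_fun (sub_eq_zero.1 h2.symm) m
      rw [h3, Module.End.mem_eigenspace_iff.1 hm, map_smul]
  rcases hsimple.eq_bot_or_eq _ inf_le_left hsub with h0 | h0
  · refine absurd (Subtype.ext ?_) hv0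
    have : (v : M) ∈ S ⊓ (ρ.toLin h).eigenspace μ :=
      ⟨v.2, Module.End.mem_eigenspace_iff.2 hv1⟩
    rw [h0] at this
    exact this
  · exact inf_eq_left.1 h0

end Semisimple

section SubW

variable {n : ℕ} [NeZero n] {I : Set (Fin n)} {hI : ∀ i, i ≠ 0 → i ∈ I}

omit [NeZero n] in
theorem span_hElt_le (I : Set (Fin n)) :
    Submodule.span ℂ (hElt '' I) ≤ part (V := Module.End ℂ (Lam n)) 0 := by
  rw [Submodule.span_le]
  rintro _ ⟨i, -, rfl⟩
  exact hElt_mem i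

theorem span_oddGen_le :
    Submodule.span ℂ (oddGen n) ≤ part (V := Module.End ℂ (Lam n)) 1 := by
  rw [Submodule.span_le]
  rintro _ (rfl | ⟨i, -, rfl⟩)
  · exact del_mem 0
  · exact yElt_mem i

theorem exists_add_of_mem_subW {x : Module.End ℂ (Lam n)} (hx : x ∈ (subW I hI).carrier) :
    ∃ a ∈ Submodule.span ℂ (hElt '' I), ∃ b ∈ Submodule.span ℂ (oddGen n), a + b = x := by
  have h : x ∈ Submodule.span ℂ (hElt '' I ∪ oddGen n) := hx
  rw [Submodule.span_union] at h
  exact Submodule.mem_sup.1 h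

theorem mem_span_hElt {x : Module.End ℂ (Lam n)} (hx : x ∈ (subW I hI).carrier)
    (h0 : x ∈ part (V := Module.End ℂ (Lam n)) 0) : x ∈ Submodule.span ℂ (hElt '' I) := by
  obtain ⟨a, ha, b, hb, rfl⟩ := exists_add_of_mem_subW hx
  have hb0 : b = 0 := Submodule.disjoint_def.1 (isCompl (V := Module.End ℂ (Lam n))).disjoint b
    ((Submodule.add_mem_iff_right _ (span_hElt_le I ha)).1 h0) (span_oddGen_le hb)
  rwa [hb0, add_zero]

theorem mem_span_oddGen {x : Module.End ℂ (Lam n)} (hx : x ∈ (subW I hI).carrier)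
    (h1 : x ∈ part (V := Module.End ℂ (Lam n)) 1) : x ∈ Submodule.span ℂ (oddGen n) := by
  obtain ⟨a, ha, b, hb, rfl⟩ := exists_add_of_mem_subW hx
  have ha0 : a = 0 := Submodule.disjoint_def.1 (isCompl (V := Module.End ℂ (Lam n))).disjoint a
    (span_hElt_le I ha) ((Submodule.add_mem_iff_left _ (span_oddGen_le hb)).1 h1)
  rwa [ha0, zero_add]

theorem bracket_hElt_zero_yElt (j : Fin n) : bracket (hElt (0 : Fin n)) (yElt j) = yElt j := by
  rw [bracket_hElt_yElt, if_pos rfl]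

theorem bracket_hElt_zero_del : bracket (hElt (0 : Fin n)) (del 0) = -del 0 := by
  rw [bracket_hElt_del, if_pos rfl]

theorem bracket_bracket_hElt_zero {x : Module.End ℂ (Lam n)}
    (hx : x ∈ Submodule.span ℂ (oddGen n)) :
    bracket (hElt (0 : Fin n)) (bracket (hElt (0 : Fin n)) x) = x := by
  have h : Set.EqOn (bracket (hElt (0 : Fin n)) ∘ₗ bracket (hElt (0 : Fin n)))
      (LinearMap.id : Module.End ℂ (Lam n) →ₗ[ℂ] Module.End ℂ (Lam n)) (oddGen n) := by
    rintro _ (rfl | ⟨i, -, rfl⟩)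
    · simp [bracket_hElt_zero_del]
    · simp [bracket_hElt_zero_yElt]
  exact LinearMap.eqOn_span h hx

/-- The torus acts on the odd part through the eigenspaces of `ξ_1 ∂_1`. -/
theorem torusConj_apply (t : Fin n → ℂˣ) {x : Module.End ℂ (Lam n)}
    (hx : x ∈ Submodule.span ℂ (oddGen n)) :
    (torusConj t).toLin x = ((t 0 : ℂ) * 2⁻¹) • (x + bracket (hElt (0 : Fin n)) x) +
      ((((t 0)⁻¹ : ℂˣ) : ℂ) * 2⁻¹) • (x - bracket (hElt (0 : Fin n)) x) := by
  let f : Module.End ℂ (Lam n) →ₗ[ℂ] Module.End ℂ (Lam n) :=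
    ((t 0 : ℂ) * 2⁻¹) • (LinearMap.id + bracket (hElt (0 : Fin n))) +
      ((((t 0)⁻¹ : ℂˣ) : ℂ) * 2⁻¹) • (LinearMap.id - bracket (hElt (0 : Fin n)))
  have hf : ∀ x, f x = ((t 0 : ℂ) * 2⁻¹) • (x + bracket (hElt (0 : Fin n)) x) +
      ((((t 0)⁻¹ : ℂˣ) : ℂ) * 2⁻¹) • (x - bracket (hElt (0 : Fin n)) x) := fun _ => rfl
  have h : Set.EqOn (torusConj t).toLin f (oddGen n) := by
    rintro _ (rfl | ⟨i, -, rfl⟩)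
    · rw [hf, torusConj_del, bracket_hElt_zero_del]
      module
    · rw [hf, torusConj_yElt, bracket_hElt_zero_yElt]
      module
  exact LinearMap.eqOn_span h hx

instance : FiniteDimensional ℂ (subW I hI).carrier := by
  refine FiniteDimensional.span_of_finite ℂ (((Set.toFinite I).image _).union ?_)
  refine ((Set.finite_range (yElt (n := n))).insert (del 0)).subset ?_
  rintro _ (rfl | ⟨i, -, rfl⟩)
  · exact Or.inl rfl
  · exact Or.inr ⟨i, rfl⟩

/-- The element `ξ_1 ∂_1` of `𝔣`. -/
def hDet (n : ℕ) [NeZero n] : (det n).carrier :=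
  ⟨hElt 0, Submodule.subset_span (Or.inl ⟨0, trivial, rfl⟩)⟩

theorem isWeightExtension_incl (n : ℕ) [NeZero n] : IsWeightExtension (incl n) (hDet n) where
  mem := hElt_mem 0
  odd_bijective := by
    constructor
    · intro x y hxy
      exact Subtype.ext (Subtype.ext (congrArg (fun z => (z.1.1 : Module.End ℂ (Lam n))) hxy))
    · intro x
      have hx := mem_span_oddGen x.1.2 x.2
      exact ⟨⟨⟨x.1.1, Submodule.span_mono Set.subset_union_right hx⟩, x.2⟩, rfl⟩
  bracket_even y hy := by
    refine Subtype.ext ?_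
    exact span_bilin (N := ⊥) bracket (s := {hElt (0 : Fin n)}) (by
      rintro _ rfl _ ⟨j, -, rfl⟩
      exact bracket_hElt_hElt 0 j) _ (Submodule.mem_span_singleton_self _) _
        (mem_span_hElt y.2 hy)
  bracket_odd y hy x hx := by
    refine Subtype.ext ?_
    refine span_bilin (N := ⊥) bracket ?_ _ (mem_span_hElt y.2 hy) _ (mem_span_oddGen x.2 hx)
    rintro _ ⟨i, hi, rfl⟩ _ (rfl | ⟨j, -, rfl⟩)
    · rw [bracket_hElt_del, if_neg hi, neg_zero]
      exact zero_mem _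
    · rw [bracket_hElt_yElt, if_neg hi]
      exact zero_mem _
  exists_even y hy := by
    have h1 : Submodule.span ℂ (hElt '' (Set.univ : Set (Fin n))) ≤
        Submodule.span ℂ (hElt '' {i | i ≠ 0}) ⊔ Submodule.span ℂ {hElt 0} := by
      rw [Submodule.span_le]
      rintro _ ⟨i, -, rfl⟩
      by_cases hi : i = 0
      · subst hi
        exact Submodule.mem_sup_right (Submodule.mem_span_singleton_self _)
      · exact Submodule.mem_sup_left (Submodule.subset_span ⟨i, hi, rfl⟩)
    obtain ⟨a, ha, b, hb, hab⟩ := Submodule.mem_sup.1 (h1 (mem_span_hElt y.2 hy))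
    obtain ⟨c, rfl⟩ := Submodule.mem_span_singleton.1 hb
    exact ⟨⟨a, Submodule.span_mono Set.subset_union_left ha⟩, span_hElt_le _ ha, c,
      Subtype.ext hab.symm⟩
  bracket_bracket x hx := Subtype.ext (bracket_bracket_hElt_zero (mem_span_oddGen x.2 hx))

theorem isWeightTorus_incl (n : ℕ) [NeZero n] :
    IsWeightTorus (incl n) (hDet n) (torusRing n) fun t => (t 0)⁻¹ where
  surjective c := ⟨fun _ => c⁻¹, inv_inv c⟩
  exists_hom t := by
    refine ⟨torusAct n t⁻¹, rfl, fun x hx h => Subtype.ext ?_, fun x hx h => Subtype.ext ?_⟩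
    · have h1 : bracket (hElt (0 : Fin n)) x.1 = x.1 := congrArg Subtype.val h
      refine (torusConj_apply t⁻¹ (mem_span_oddGen x.2 hx)).trans ?_
      rw [h1, sub_self, smul_zero, add_zero, ← two_smul ℂ x.1, smul_smul, mul_assoc,
        inv_mul_cancel₀ two_ne_zero, mul_one]
      rfl
    · have h1 : bracket (hElt (0 : Fin n)) x.1 = -x.1 := congrArg Subtype.val h
      refine (torusConj_apply t⁻¹ (mem_span_oddGen x.2 hx)).trans ?_
      rw [h1, add_neg_cancel, smul_zero, zero_add, sub_neg_eq_add, ← two_smul ℂ x.1, smul_smul,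
        mul_assoc, inv_mul_cancel₀ two_ne_zero, mul_one]
      rfl

end SubW

end SuperCoh

end

theorem theoremT (n : ℕ) [NeZero n] (hn : 2 ≤ n) {M : Type*} [AddCommGroup M] [Module ℂ M]
    [SuperSpace M] [FiniteDimensional ℂ M] (ρ : SuperRep (det n).carrier M)
    (hρ : FinitelySemisimple ρ) :
    ∃ resStar : MaximalSpectrum (CohRing (detTilde n).carrier) →
        MaximalSpectrum (CohRing (det n).carrier),
      (∀ m, (resStar m).asIdeal = m.asIdeal.comap (resRing (incl n))) ∧
      resStar '' support (ρ.comp (incl n)) = support ρ ∧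
      ∃ hT : IsStable (torusRing n) (support (ρ.comp (incl n))),
      ∃ e : CoordRing (resStar '' support (ρ.comp (incl n))) ≃ₐ[ℂ] invariants hT,
        ∀ b, (e (Ideal.Quotient.mk _ b) : CoordRing (support (ρ.comp (incl n)))) =
          Ideal.Quotient.mk _ (resRing (incl n) b) := by
  have E := isWeightExtension_incl n
  have : FiniteDimensional ℂ (det n).carrier :=
    inferInstanceAs (FiniteDimensional ℂ (subW Set.univ _).carrier)
  exact (isWeightTorus_incl n).support_quotient E (hρ.isSemisimple E.mem E.bracket_even)
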